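/- Let $q$ be a prime power, $n\ge 6$, and let $U=U_n(q)$ be the group of upper unitriangular $n\times n$ matrices over $\mathbb F_q$. For $1\le i\le j<n$ let $\alpha_{i,j}$ denote the positive root $\alpha_i+\dots+\alpha_j$, with root subgroup $X_{\alpha_{i,j}}=\{I_n+c\,e_{i,j+1}: c\in\mathbb F_q\}$. Put $\mathrm{arm}(\alpha_{i,j})=\{\alpha_{i,l}: i\le l<j\}$ and $V_\alpha=\langle X_\beta:\beta\notin \mathrm{arm}(\alpha)\rangle$. An elementary character at $\alpha$ is an induced character $\lambda^U$, where $\lambda$ is a linear character of $V_\alpha$ that is nontrivial on $X_\alpha$ and trivial on $X_\beta$ for every positive root $\beta\ne\alpha$ with $\beta\notin\mathrm{arm}(\alpha)$. Let $\mu(n)=m(m-1)$ if $n=2m$ and $\mu(n)=m^2$ if $n=2m+1$, and let $N_{n,e}(q)$ be the number of irreducible complex characters of $U_n(q)$ of degree $q^e$. Characters of $U_{n-6}(q)$ are inflated to $U$ along the projection of $U$ onto its diagonal block in rows and columns $4,\dots,n-3$ (for $n=6$, $U_0(q)$ is the trivial group). Then for all elementary characters $\xi_1,\xi_2,\xi_3$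 of $U$ at $\alpha_{2,n-3}$, $\alpha_{1,n-2}$, $\alpha_{3,n-1}$ respectively: 1. $\xi_1\otimes\xi_2\otimes\xi_3$ has exactly $q^2$ distinct irreducible constituents. Each of them has degree $q^{3n-14}$ and occurs with multiplicity $1$; that is, $\xi_1\otimes\xi_2\otimes\xi_3$ is their sum. 2. For each constituent $\chi$ of $\xi_1\otimes\xi_2\otimes\xi_3$ and each irreducible character $\theta$ of $U_{n-6}(q)$ of highest degree, the tensor product of $\chi$ with the inflation of $\theta$ to $U$ is an irreducible character of $U$ of third highest degree (exactly two larger numbers are degrees of irreducible characters of $U$), and this degree is $q^{\mu(n)-2}$. Moreover, the number of distinct characters of $U$ obtained as in 2, over all choices of $\xi_1,\xi_2,\xi_3,\chi,\theta$, is $q^2(q-1)^3N_{n-6,\mu(n-6)}(q)$. -/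

import Mathlib

open scoped ComplexConjugate

noncomputable section

/-! Complex characters of a finite group, as functions `G → ℂ`. -/

/-- `Irr(G)`: the characters of the irreducible finite-dimensional complex representations. -/
def irr (G : Type*) [Group G] : Set (G → ℂ) :=
  {χ | ∃ (d : ℕ) (ρ : Representation ℂ G (Fin d → ℂ)), ρ.IsIrreducible ∧ χ = ρ.character}

/-- The inner product `(χ, ψ) = |G|⁻¹ ∑ χ(g) conj(ψ(g))` of class functions. -/
def charInner {G : Type*} [Group G] (χ ψ : G → ℂ) : ℂ :=
  (Nat.card G : ℂ)⁻¹ * ∑ᶠ g : G, χ g * conj (ψ g)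

/-- The irreducible constituents of a character `ξ`; the multiplicity of `χ` in `ξ` is
`charInner ξ χ`. -/
def constituents {G : Type*} [Group G] (ξ : G → ℂ) : Set (G → ℂ) :=
  {χ | χ ∈ irr G ∧ charInner ξ χ ≠ 0}

open Classical in
/-- The character of `G` induced from a linear character `l` of a subgroup `V`:
`l^G(g) = |V|⁻¹ ∑ l(x⁻¹ g x)`, the sum being over all `x` in `G` with `x⁻¹ g x ∈ V`. -/
def indChar {G : Type*} [Group G] (V : Subgroup G) (l : V →* ℂˣ) : G → ℂ := fun g =>
  (Nat.card V : ℂ)⁻¹ * ∑ᶠ x : G,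
    if h : x⁻¹ * g * x ∈ V then ((l ⟨x⁻¹ * g * x, h⟩ : ℂˣ) : ℂ) else 0

/-- The set of degrees of the irreducible characters of `G`. -/
def irrDegrees (G : Type*) [Group G] : Set ℕ :=
  {d | ∃ χ ∈ irr G, χ 1 = (d : ℂ)}

/-- `χ` is an irreducible character whose degree is the `k`-th highest one (`k ≥ 1`): exactly
`k - 1` degrees of irreducible characters of `G` are larger. -/
def IsKthHighestDegree {G : Type*} [Group G] (k : ℕ) (χ : G → ℂ) : Prop :=
  χ ∈ irr G ∧ ∃ d : ℕ, χ 1 = (d : ℂ) ∧ {e | e ∈ irrDegrees G ∧ d < e}.ncard + 1 = k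

/-! The group `U_n(q)` of upper unitriangular matrices and its root subgroups. -/

/-- `U_n(q)`, the group of upper unitriangular `n × n` matrices over `F`. -/
def unitri (n : ℕ) (F : Type*) [Field F] : Subgroup (GL (Fin n) F) where
  carrier := {g | (∀ i j, j < i → (g : Matrix (Fin n) (Fin n) F) i j = 0) ∧
    ∀ i, (g : Matrix (Fin n) (Fin n) F) i i = 1}
  one_mem' := by
    refine ⟨fun i j h => ?_, fun i => ?_⟩
    · simp [h.ne']
    · simp
  mul_mem' := by
    rintro a b ⟨ha, ha'⟩ ⟨hb, hb'⟩
    refine ⟨fun i j h => ?_, fun i => ?_⟩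
    · rw [Units.val_mul, Matrix.mul_apply]
      refine Finset.sum_eq_zero fun k _ => ?_
      rcases lt_or_ge k i with hk | hk
      · rw [ha i k hk, zero_mul]
      · rw [hb k j (h.trans_le hk), mul_zero]
    · rw [Units.val_mul, Matrix.mul_apply, Finset.sum_eq_single i]
      · rw [ha', hb', one_mul]
      · intro k _ hk
        rcases lt_or_gt_of_ne hk with hk | hk
        · rw [ha i k hk, zero_mul]
        · rw [hb k i hk, mul_zero]
      · simp
  inv_mem' := by
    rintro a ⟨ha, ha'⟩
    have hT : (a : Matrix (Fin n) (Fin n) F).BlockTriangular id := fun i j h => ha i j h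
    have hI : ((a⁻¹ : GL (Fin n) F) : Matrix (Fin n) (Fin n) F).BlockTriangular id := by
      rw [Matrix.coe_units_inv]
      have : Invertible (a : Matrix (Fin n) (Fin n) F) := a.invertible
      exact Matrix.blockTriangular_inv_of_blockTriangular hT
    refine ⟨fun i j h => hI h, fun i => ?_⟩
    have h1 : ((a : Matrix (Fin n) (Fin n) F) *
        ((a⁻¹ : GL (Fin n) F) : Matrix (Fin n) (Fin n) F)) i i = 1 := by
      rw [← Units.val_mul, mul_inv_cancel]; simp
    rw [Matrix.mul_apply, Finset.sum_eq_single i] at h1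
    · rwa [ha', one_mul] at h1
    · intro k _ hk
      rcases lt_or_gt_of_ne hk with hk | hk
      · rw [ha i k hk, zero_mul]
      · have : ((a⁻¹ : GL (Fin n) F) : Matrix (Fin n) (Fin n) F) k i = 0 := hI hk
        rw [this, mul_zero]
    · simp

/-- The positive root `α_{i,j} = α_i + ⋯ + α_j` with `1 ≤ i ≤ j < n`, as the pair `(i, j)`. -/
@[ext] structure PosRoot (n : ℕ) where
  i : ℕ
  j : ℕ
  one_le : 1 ≤ i
  le : i ≤ j
  lt : j < n

namespace PosRoot

variable {n : ℕ}

/-- The root subgroup of `α_{i,j}` sits at the entry `(i, j + 1)` (rows and columns numbered from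
`1`), hence at `(i - 1, j)` in the numbering from `0` of `Fin n`. -/
def row (α : PosRoot n) : Fin n := ⟨α.i - 1, by have := α.le; have := α.lt; omega⟩

/-- The column of the entry at which the root subgroup of `α` sits, see `row`. -/
def col (α : PosRoot n) : Fin n := ⟨α.j, α.lt⟩

theorem row_ne_col (α : PosRoot n) : α.row ≠ α.col := by
  have h1 := α.one_le
  have h2 := α.le
  simp only [row, col, ne_eq, Fin.mk.injEq]
  omega

/-- `arm(α_{i,j}) = {α_{i,l} : l = i, …, j - 1}`. -/
def arm (α : PosRoot n) : Set (PosRoot n) := {β | β.i = α.i ∧ β.j < α.j}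

variable (F : Type*) [Field F]

/-- The root subgroup `X_α`: the matrices `I + c e_{i,j+1}` for `c ∈ F`. -/
def rootSubgroup (α : PosRoot n) : Subgroup (unitri n F) where
  carrier := {g | ∃ c : F, ((g : GL (Fin n) F) : Matrix (Fin n) (Fin n) F) =
    Matrix.transvection α.row α.col c}
  one_mem' := ⟨0, by simp⟩
  mul_mem' := by
    rintro a b ⟨c, hc⟩ ⟨d, hd⟩
    refine ⟨c + d, ?_⟩
    rw [Subgroup.coe_mul, Units.val_mul, hc, hd,
      Matrix.transvection_mul_transvection_same _ _ α.row_ne_col]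
  inv_mem' := by
    rintro a ⟨c, hc⟩
    refine ⟨-c, ?_⟩
    rw [Subgroup.coe_inv, Matrix.coe_units_inv, hc]
    refine Matrix.inv_eq_right_inv ?_
    rw [Matrix.transvection_mul_transvection_same _ _ α.row_ne_col]
    simp

/-- The base group `V_α = ⟨X_β : β ∉ arm(α)⟩`. -/
def baseGroup (α : PosRoot n) : Subgroup (unitri n F) :=
  ⨆ β ∈ (α.armᶜ : Set (PosRoot n)), β.rootSubgroup F

variable {F}

/-- The elementary characters at `α`: the characters `l^U`, where `l` is a linear character of
`V_α` that is nontrivial on `X_α` and trivial on all other root subgroups contained in `V_α`. -/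
def IsElementary (α : PosRoot n) (ξ : unitri n F → ℂ) : Prop :=
  ∃ l : α.baseGroup F →* ℂˣ,
    (∃ v : α.baseGroup F, (v : unitri n F) ∈ α.rootSubgroup F ∧ l v ≠ 1) ∧
    (∀ β : PosRoot n, β ∉ α.arm → β ≠ α →
      ∀ v : α.baseGroup F, (v : unitri n F) ∈ β.rootSubgroup F → l v = 1) ∧
    ξ = indChar (α.baseGroup F) l

end PosRoot

/-- The exponent `μ(n)`: `m(m-1)` if `n = 2m` and `m²` if `n = 2m + 1`. -/
def muExp (n : ℕ) : ℕ := if Even n then n / 2 * (n / 2 - 1) else (n / 2) ^ 2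

/-- `N_{n,e}(q)`: the number of irreducible characters of `U_n(q)` of degree `q^e`. -/
def numIrr (n e : ℕ) (F : Type*) [Field F] : ℕ :=
  {χ : unitri n F → ℂ | χ ∈ irr (unitri n F) ∧ χ 1 = (Nat.card F : ℂ) ^ e}.ncard

/-- The projection of `U_n(q)` onto its diagonal block in the rows and columns
`k + 1, …, k + m` (numbered from `1`), identified with `U_m(q)`. -/
def blockHom (k m n : ℕ) (h : k + m ≤ n) (F : Type*) [Field F] : unitri n F →* unitri m F :=
  let e : Fin m → Fin n := fun a => ⟨k + a, by have := a.isLt; omega⟩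
  let f : unitri n F →* Matrix (Fin m) (Fin m) F :=
    { toFun := fun g => ((g : GL (Fin n) F) : Matrix (Fin n) (Fin n) F).submatrix e e
      map_one' := by
        rw [Subgroup.coe_one, Units.val_one]
        refine Matrix.submatrix_one e fun a b hab => ?_
        simp only [e, Fin.mk.injEq] at hab
        exact Fin.ext (by omega)
      map_mul' := by
        intro x y
        ext a b
        rw [Subgroup.coe_mul, Units.val_mul, Matrix.submatrix_apply, Matrix.mul_apply,
          Matrix.mul_apply]
        symm
        have he : Function.Injective e := fun a b hab => by
          simp only [e, Fin.mk.injEq] at hab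
          exact Fin.ext (by omega)
        refine Finset.sum_of_injOn e (fun _ _ _ _ hh => he hh) (fun _ _ => Finset.mem_coe.2
          (Finset.mem_univ _)) ?_ (fun _ _ => rfl)
        intro c _ hc
        by_cases h1 : (c : ℕ) < k
        · rw [x.2.1 (e a) c (by simp only [e, Fin.lt_def]; omega), zero_mul]
        · by_cases h2 : (c : ℕ) < k + m
          · exact absurd ⟨⟨(c : ℕ) - k, by omega⟩, by simp, by
              apply Fin.ext; simp only [e]; omega⟩ hc
          · rw [y.2.1 c (e b) (by simp only [e, Fin.lt_def]; have := b.isLt; omega), mul_zero] }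
  f.toHomUnits.codRestrict (unitri m F) fun g => by
    refine ⟨fun a b hab => ?_, fun a => ?_⟩
    · rw [MonoidHom.coe_toHomUnits]
      exact g.2.1 _ _ (by simp only [e, Fin.lt_def] at hab ⊢; omega)
    · rw [MonoidHom.coe_toHomUnits]
      exact g.2.2 _

/-- The inflation to `U_n(q)`, along `blockHom`, of a function on `U_m(q)`. -/
def inflate (k m n : ℕ) (h : k + m ≤ n) (F : Type*) [Field F] (θ : unitri m F → ℂ) :
    unitri n F → ℂ :=
  fun g => θ (blockHom k m n h F g)

end

/-! Let A be the abelian normal subgroup `corner n F (n - 3)` of matrices differing from 1 only in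
the last three columns of the first n-3 rows, and fix a nontrivial additive character φ of F. For
nonzero a, b, c take the linear character 1 + E ↦ φ(a E_{2,n-2} + b E_{1,n-1} + c E_{3,n}) of A. Its
stabilizer S is cut out by 3(n-6) + 4 independent linear conditions on matrix entries, hence has
index q^{3n-14} (`index_stabGroup`). The linear character extends to S in explicit ways indexed by β
in F² (`stabForm_mul`). In the spirit of Clifford theory, the induced characters `tripleChar` are
irreducible and pairwise distinct, even after multiplication by irreducible characters θ of the
middle block. All of this is one computation, `charInner_tripleChar_mul`: in the Mackey sum the
terms outside S vanish, and the remaining ones reduce to orthogonality on the quotient F² ×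
U_{n-6}(q) of S.

The product of three elementary characters has degree q^{(n-5)+(n-3)+(n-4)} = q² · q^{3n-14}. Each
of the q² characters `tripleChar` with the same a, b, c occurs in it, because the linear characters
involved agree on the intersection of their subgroups (`charInner_indChar_mul_mul_ne_zero`). The
degrees leave no room for other constituents or higher multiplicities.

For the ranking of degrees, let A be instead the corner subgroup with a = n/2, of index q^{μ(n)}. An
irreducible character of degree d lies over a linear character l of A, and the block diagonal part
of the stabilizer of l is 1 + J for a vector space J of matrices. If dim J ≤ 1 this part is abelian
and d = q^{μ(n) - dim J}. If dim J ≥ 2 it contains an abelian subgroup of order at least q², so d ≤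
q^{μ(n)-2} (`degree_trichotomy`). Degrees q^{μ(n)} and q^{μ(n)-1} do occur, by a recursion from n to
n + 2 (`exists_irr_add_two`). Since μ(n) = (3n - 14) + μ(n-6) + 2, the product of a `tripleChar`
with a θ of highest degree has the third highest degree. The final count is that of the parameters:
(q-1)³ triples (a, b, c), q² values of β, and the θ. -/

/-- `χ` is the character of a finite-dimensional complex representation. -/
def IsRepChar {G : Type*} [Group G] (χ : G → ℂ) : Prop :=
  ∃ (d : ℕ) (ρ : Representation ℂ G (Fin d → ℂ)), χ = ρ.character

/-! ### Characters of representations and complete reducibility. -/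

section RepChar

variable {G : Type*} [Group G]

theorem isRepChar_character {V : Type*} [AddCommGroup V] [Module ℂ V] [FiniteDimensional ℂ V]
    (ρ : Representation ℂ G V) : IsRepChar ρ.character := by
  let e : V ≃ₗ[ℂ] (Fin (Module.finrank ℂ V) → ℂ) :=
    LinearEquiv.ofFinrankEq _ _ (by simp)
  let σ : Representation ℂ G (Fin (Module.finrank ℂ V) → ℂ) :=
    { toFun := fun g => e.conj (ρ g)
      map_one' := by ext; simp
      map_mul' := fun g h => by
        rw [map_mul]
        exact LinearEquiv.conj_comp e _ _ }
  refine ⟨_, σ, ?_⟩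
  ext g
  exact (LinearMap.trace_conj' (ρ g) e).symm

theorem isRepChar_of_mem_irr {χ : G → ℂ} (h : χ ∈ irr G) : IsRepChar χ := by
  obtain ⟨d, ρ, _, rfl⟩ := h
  exact ⟨d, ρ, rfl⟩

theorem IsRepChar.mul {χ ψ : G → ℂ} (h : IsRepChar χ) (h' : IsRepChar ψ) : IsRepChar (χ * ψ) := by
  obtain ⟨d, ρ, rfl⟩ := h
  obtain ⟨e, σ, rfl⟩ := h'
  rw [← Representation.char_tensor]
  exact isRepChar_character _

theorem IsRepChar.comp {H : Type*} [Group H] {χ : G → ℂ} (h : IsRepChar χ) (f : H →* G) :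
    IsRepChar (fun x => χ (f x)) := by
  obtain ⟨d, ρ, rfl⟩ := h
  exact ⟨d, ρ.comp f, rfl⟩

theorem IsRepChar.conj_eq {χ : G → ℂ} (h : IsRepChar χ) (x g : G) :
    χ (x⁻¹ * g * x) = χ g := by
  obtain ⟨d, ρ, rfl⟩ := h
  simpa using ρ.char_conj g x⁻¹

theorem exists_pos_of_mem_irr {χ : G → ℂ} (h : χ ∈ irr G) : ∃ d : ℕ, 0 < d ∧ χ 1 = d := by
  obtain ⟨d, ρ, hρ, rfl⟩ := h
  refine ⟨d, Nat.pos_of_ne_zero ?_, by simp⟩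
  rintro rfl
  have : Nontrivial (Subrepresentation ρ) := hρ.toNontrivial
  obtain ⟨p, q, hpq⟩ := this
  refine hpq (Subrepresentation.toSubmodule_injective (Subsingleton.elim _ _))

/-- Maschke's theorem: a proper nonzero subrepresentation has an invariant complement. The strict
bounds on the dimensions feed the strong induction in `IsRepChar.exists_multiset`. -/
theorem exists_character_eq_add [Finite G] {d : ℕ} (ρ : Representation ℂ G (Fin d → ℂ))
    (hd : d ≠ 0) (hρ : ¬ ρ.IsIrreducible) :
    ∃ (a b : ℕ) (σ : Representation ℂ G (Fin a → ℂ)) (τ : Representation ℂ G (Fin b → ℂ)),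
      a < d ∧ b < d ∧ ρ.character = σ.character + τ.character := by
  have : NeZero (Nat.card G : ℂ) := ⟨by simp [Nat.card_pos.ne']⟩
  have hne : Nontrivial (Subrepresentation ρ) := by
    refine ⟨⊥, ⊤, fun h => ?_⟩
    have h' := congrArg Subrepresentation.toSubmodule h
    have : Nonempty (Fin d) := ⟨⟨0, Nat.pos_of_ne_zero hd⟩⟩
    exact bot_ne_top h'
  obtain ⟨p, hp, hp'⟩ : ∃ p : Subrepresentation ρ, p ≠ ⊥ ∧ p ≠ ⊤ := by
    by_contra! hcon
    exact hρ ⟨fun p => or_iff_not_imp_left.2 (hcon p)⟩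
  obtain ⟨q, hpq⟩ := exists_isCompl p
  have hpq' : IsCompl p.toSubmodule q.toSubmodule := by
    refine isCompl_iff.2 ⟨disjoint_iff.2 ?_, codisjoint_iff.2 ?_⟩
    · rw [← Subrepresentation.toSubmodule_inf, hpq.inf_eq_bot]; rfl
    · rw [← Subrepresentation.toSubmodule_sup, hpq.sup_eq_top]; rfl
  have hchar : ρ.character = p.toRepresentation.character + q.toRepresentation.character := by
    let E : Representation.Equiv (p.toRepresentation.prod q.toRepresentation) ρ :=
      Representation.Equiv.mk (Submodule.prodEquivOfIsCompl _ _ hpq') fun g => by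
        ext x <;> simp [Subrepresentation.toRepresentation]
    rw [← Representation.char_iso E]
    ext g
    exact LinearMap.trace_prodMap' _ _
  have hsum := Submodule.finrank_add_eq_of_isCompl hpq'
  rw [Module.finrank_fin_fun] at hsum
  have hp0 : Module.finrank ℂ p.toSubmodule ≠ 0 := fun h =>
    hp (Subrepresentation.toSubmodule_injective (Submodule.finrank_eq_zero.1 h))
  have hq0 : Module.finrank ℂ q.toSubmodule ≠ 0 := fun h => by
    have h1 : p.toSubmodule = ⊤ := by
      apply Submodule.eq_top_of_finrank_eq
      rw [Module.finrank_fin_fun]; omega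
    exact hp' (Subrepresentation.toSubmodule_injective h1)
  obtain ⟨a, σ, hσ⟩ := isRepChar_character p.toRepresentation
  obtain ⟨b, τ, hτ⟩ := isRepChar_character q.toRepresentation
  have ha : (a : ℂ) = Module.finrank ℂ p.toSubmodule := by
    have := congrFun hσ 1
    rw [Representation.char_one, Representation.char_one, Module.finrank_fin_fun] at this
    exact this.symm
  have hb : (b : ℂ) = Module.finrank ℂ q.toSubmodule := by
    have := congrFun hτ 1
    rw [Representation.char_one, Representation.char_one, Module.finrank_fin_fun] at this
    exact this.symm
  norm_cast at ha hb
  exact ⟨a, b, σ, τ, by omega, by omega, by rw [hchar, hσ, hτ]⟩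

/-- Complete reducibility: a character is a sum of irreducible ones. -/
theorem IsRepChar.exists_multiset [Finite G] {χ : G → ℂ} (h : IsRepChar χ) :
    ∃ s : Multiset (G → ℂ), (∀ ψ ∈ s, ψ ∈ irr G) ∧ χ = s.sum := by
  obtain ⟨d, ρ, rfl⟩ := h
  induction d using Nat.strong_induction_on with
  | _ d ih =>
    by_cases hd : d = 0
    · subst hd
      refine ⟨0, by simp, ?_⟩
      ext g
      simp [Representation.character, 
        Subsingleton.elim (ρ g) 0]
    · by_cases hρ : ρ.IsIrreducible
      · exact ⟨{ρ.character}, by simpa using ⟨d, ρ, hρ, rfl⟩, by simp⟩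
      · obtain ⟨a, b, σ, τ, ha, hb, hst⟩ := exists_character_eq_add ρ hd hρ
        obtain ⟨s, hs, hs'⟩ := ih a ha σ
        obtain ⟨t, ht, ht'⟩ := ih b hb τ
        refine ⟨s + t, fun ψ hψ => ?_, by rw [hst, hs', ht', Multiset.sum_add]⟩
        rcases Multiset.mem_add.1 hψ with h | h
        exacts [hs ψ h, ht ψ h]

end RepChar

/-! ### Orthogonality relations and their consequences. -/

section Orthogonality

variable {G : Type*} [Group G]

theorem conj_eq_inv_of_pow_eq_one {z : ℂ} {n : ℕ} (hn : n ≠ 0) (h : z ^ n = 1) :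
    conj z = z⁻¹ := by
  have h1 : ‖z‖ = 1 := Complex.norm_eq_one_of_pow_eq_one h hn
  exact (Complex.inv_eq_conj h1).symm

theorem irr_conj_eq_of_isMulCommutative [Finite G] [IsMulCommutative G] {χ : G → ℂ}
    (h : χ ∈ irr G) (g : G) : conj (χ g) = χ g⁻¹ := by
  obtain ⟨d, ρ, hρ, rfl⟩ := h
  have hd := Representation.IsIrreducible.finrank_eq_one_of_isMulCommutative ρ
  rw [Module.finrank_fin_fun] at hd
  subst hd
  have htr : ∀ f : (Fin 1 → ℂ) →ₗ[ℂ] (Fin 1 → ℂ), LinearMap.trace ℂ _ f = f (fun _ => 1) 0 := by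
    intro f
    rw [LinearMap.trace_eq_matrix_trace ℂ (Pi.basisFun ℂ (Fin 1))]
    have : (Pi.single 0 1 : Fin 1 → ℂ) = fun _ => 1 := by
      ext i; simp [Subsingleton.elim i 0]
    simp [Matrix.trace, this]
  have hmul : ∀ x y : G, ρ.character (x * y) = ρ.character x * ρ.character y := by
    intro x y
    have hy : ρ y (fun _ => 1) = ρ.character y • (fun _ => (1 : ℂ)) := by
      ext i
      simp [Representation.character, htr, Subsingleton.elim i 0]
    simp only [Representation.character, htr] at hy ⊢
    rw [map_mul, Module.End.mul_apply, hy, map_smul, Pi.smul_apply, smul_eq_mul, mul_comm]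
    simp
  have h1 : ρ.character 1 = 1 := by simp
  let f : G →* ℂ := ⟨⟨ρ.character, h1⟩, hmul⟩
  have hpow : ρ.character g ^ Nat.card G = 1 := by
    change f g ^ Nat.card G = 1
    rw [← map_pow, pow_card_eq_one', map_one]
  rw [conj_eq_inv_of_pow_eq_one Nat.card_pos.ne' hpow]
  refine (eq_inv_of_mul_eq_one_left ?_).symm
  rw [← hmul, inv_mul_cancel, h1]

/-- After restriction to the cyclic group generated by g the character is a sum of linear
characters, whose values are roots of unity. -/
theorem IsRepChar.conj_eq_inv [Finite G] {χ : G → ℂ} (h : IsRepChar χ) (g : G) :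
    conj (χ g) = χ g⁻¹ := by
  obtain ⟨s, hs, hsum⟩ := (h.comp (Subgroup.zpowers g).subtype).exists_multiset
  have key : ∀ x : Subgroup.zpowers g, conj (s.sum x) = s.sum x⁻¹ := by
    intro x
    clear hsum
    induction s using Multiset.induction_on with
    | empty => simp
    | cons a s ih =>
      rw [Multiset.sum_cons, Pi.add_apply, Pi.add_apply, map_add,
        ih fun ψ hψ => hs ψ (Multiset.mem_cons_of_mem hψ),
        irr_conj_eq_of_isMulCommutative (hs a (Multiset.mem_cons_self a s))]
  have := key ⟨g, Subgroup.mem_zpowers g⟩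
  rw [← hsum] at this
  exact this

theorem charInner_eq_sum [Fintype G] (χ ψ : G → ℂ) :
    charInner χ ψ = (Nat.card G : ℂ)⁻¹ * ∑ g, χ g * conj (ψ g) := by
  rw [charInner, finsum_eq_sum_of_fintype]

theorem charInner_add_left [Finite G] (χ χ' ψ : G → ℂ) :
    charInner (χ + χ') ψ = charInner χ ψ + charInner χ' ψ := by
  have := Fintype.ofFinite G
  simp only [charInner_eq_sum, Pi.add_apply, add_mul, Finset.sum_add_distrib, mul_add]

theorem charInner_zero_left [Finite G] (ψ : G → ℂ) : charInner 0 ψ = 0 := by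
  have := Fintype.ofFinite G
  simp [charInner_eq_sum]

theorem charInner_conj_symm [Finite G] (χ ψ : G → ℂ) :
    conj (charInner χ ψ) = charInner ψ χ := by
  have := Fintype.ofFinite G
  simp [charInner_eq_sum, mul_comm]

open Classical in
theorem charInner_irr [Finite G] {χ ψ : G → ℂ} (hχ : χ ∈ irr G) (hψ : ψ ∈ irr G) :
    charInner χ ψ = if χ = ψ then 1 else 0 := by
  have := Fintype.ofFinite G
  have hψ' := (isRepChar_of_mem_irr hψ).conj_eq_inv
  rw [charInner_eq_sum]
  simp only [hψ']
  obtain ⟨d, ρ, hρ, rfl⟩ := hχ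
  obtain ⟨e, σ, hσ, rfl⟩ := hψ
  have : Invertible (Nat.card G : ℂ) := invertibleOfNonzero (by simp)
  have h1 := Representation.char_orthonormal ρ σ
  rw [h1]
  by_cases hE : Nonempty (Representation.Equiv σ ρ)
  · obtain ⟨φ⟩ := hE
    rw [if_pos ⟨φ⟩, if_pos (Representation.char_iso φ).symm]
  · rw [if_neg hE, if_neg]
    intro heq
    -- If non-isomorphic representations had the same character, its norm would be both 1 and 0.
    have h2 := Representation.char_orthonormal ρ ρ
    rw [if_pos ⟨Representation.Equiv.refl ρ⟩] at h2
    rw [if_neg hE, ← heq, h2] at h1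
    exact one_ne_zero h1

open Classical in
theorem charInner_multiset_sum [Finite G] (s : Multiset (G → ℂ)) (hs : ∀ ψ ∈ s, ψ ∈ irr G)
    {χ : G → ℂ} (hχ : χ ∈ irr G) : charInner s.sum χ = s.count χ := by
  induction s using Multiset.induction_on with
  | empty => simp [charInner_zero_left]
  | cons a s ih =>
    rw [Multiset.sum_cons, charInner_add_left, ih fun ψ hψ => hs ψ (Multiset.mem_cons_of_mem hψ),
      charInner_irr (hs a (Multiset.mem_cons_self a s)) hχ, Multiset.count_cons]
    simp only [eq_comm (a := χ) (b := a)]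
    split_ifs <;> push_cast <;> ring

theorem charInner_multiset_sum_self [Finite G] (s t : Multiset (G → ℂ)) (hs : ∀ ψ ∈ s, ψ ∈ irr G)
    (ht : ∀ ψ ∈ t, ψ ∈ irr G) :
    ∃ k : ℕ, charInner s.sum t.sum = k := by
  classical
  induction s using Multiset.induction_on with
  | empty => exact ⟨0, by simp [charInner_zero_left]⟩
  | cons a s ih =>
    obtain ⟨k, hk⟩ := ih fun ψ hψ => hs ψ (Multiset.mem_cons_of_mem hψ)
    refine ⟨t.count a + k, ?_⟩
    rw [Multiset.sum_cons, charInner_add_left, hk, ← charInner_conj_symm,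
      charInner_multiset_sum t ht (hs a (Multiset.mem_cons_self a s))]
    simp

/-- A character of norm one is irreducible. -/
theorem IsRepChar.mem_irr_of_charInner_self [Finite G] {χ : G → ℂ} (h : IsRepChar χ)
    (h1 : charInner χ χ = 1) : χ ∈ irr G := by
  classical
  obtain ⟨s, hs, rfl⟩ := h.exists_multiset
  rcases Multiset.empty_or_exists_mem s with rfl | ⟨a, ha⟩
  · simp [charInner_zero_left] at h1
  obtain ⟨t, rfl⟩ := Multiset.exists_cons_of_mem ha
  have hairr := hs a ha
  have ht : ∀ ψ ∈ t, ψ ∈ irr G := fun ψ hψ => hs ψ (Multiset.mem_cons_of_mem hψ)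
  rcases Multiset.empty_or_exists_mem t with rfl | ⟨b, hb⟩
  · simpa using hairr
  exfalso
  have e1 : charInner (a ::ₘ t).sum (a ::ₘ t).sum
      = charInner a (a ::ₘ t).sum + charInner t.sum (a ::ₘ t).sum := by
    rw [← charInner_add_left, ← Multiset.sum_cons]
  have e2 : charInner a (a ::ₘ t).sum = ((t.count a + 1 : ℕ) : ℂ) := by
    rw [← charInner_conj_symm, charInner_multiset_sum _ hs hairr, Multiset.count_cons_self]
    simp
  have e3 : ∃ k : ℕ, 0 < k ∧ charInner t.sum (a ::ₘ t).sum = k := by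
    obtain ⟨u, rfl⟩ := Multiset.exists_cons_of_mem hb
    obtain ⟨k, hk⟩ := charInner_multiset_sum_self u (a ::ₘ b ::ₘ u)
      (fun ψ hψ => ht ψ (Multiset.mem_cons_of_mem hψ)) hs
    have hb' : b ∈ a ::ₘ b ::ₘ u := by simp
    refine ⟨(a ::ₘ b ::ₘ u).count b + k, ?_, ?_⟩
    · have := Multiset.count_pos.2 hb'
      omega
    · rw [Multiset.sum_cons (s := u), charInner_add_left, hk, ← charInner_conj_symm,
        charInner_multiset_sum _ hs (hs b hb')]
      simp
  obtain ⟨k, hk, e3⟩ := e3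
  rw [e1, e2, e3] at h1
  norm_cast at h1
  omega

/-- A character all of whose degree is accounted for by distinct irreducible constituents is
their sum. -/
theorem IsRepChar.eq_sum_of_constituents [Finite G] {Ξ : G → ℂ} (h : IsRepChar Ξ)
    (T : Finset (G → ℂ)) (hT : ∀ χ ∈ T, χ ∈ irr G) (hne : ∀ χ ∈ T, charInner Ξ χ ≠ 0)
    (hdeg : Ξ 1 = ∑ χ ∈ T, χ 1) : Ξ = ∑ χ ∈ T, χ := by
  classical
  obtain ⟨s, hs, rfl⟩ := h.exists_multiset
  -- The set T embeds into the decomposition s. The remaining part r has degree 0, so it is empty,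
  -- because irreducible characters have positive degree.
  have hle : T.val ≤ s := by
    rw [Multiset.le_iff_count]
    intro χ
    by_cases hχ : χ ∈ T.val
    · rw [Multiset.count_eq_one_of_mem T.nodup hχ]
      have := hne χ hχ
      rw [charInner_multiset_sum s hs (hT χ hχ)] at this
      have : s.count χ ≠ 0 := by exact_mod_cast this
      omega
    · rw [Multiset.count_eq_zero_of_notMem hχ]; exact Nat.zero_le _
  obtain ⟨r, rfl⟩ := Multiset.le_iff_exists_add.1 hle
  have hT' : ∑ χ ∈ T, χ = T.val.sum := (Finset.sum_val T).symm
  have hr : r.sum 1 = 0 := by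
    rw [Multiset.sum_add, ← hT', Pi.add_apply, Finset.sum_apply] at hdeg
    exact add_eq_left.1 hdeg
  rcases Multiset.empty_or_exists_mem r with rfl | ⟨a, ha⟩
  · rw [hT', add_zero]
  exfalso
  obtain ⟨u, rfl⟩ := Multiset.exists_cons_of_mem ha
  have hu : ∃ k : ℕ, u.sum 1 = (k : ℂ) := by
    have : ∀ ψ ∈ u, ψ ∈ irr G := fun ψ hψ => hs ψ (by simp [hψ])
    clear hr ha hs hle hdeg hne h
    induction u using Multiset.induction_on with
    | empty => exact ⟨0, by simp⟩
    | cons b u ih =>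
      obtain ⟨k, hk⟩ := ih fun ψ hψ => this ψ (Multiset.mem_cons_of_mem hψ)
      obtain ⟨l, -, hl⟩ := exists_pos_of_mem_irr (this b (Multiset.mem_cons_self b u))
      exact ⟨l + k, by rw [Multiset.sum_cons, Pi.add_apply, hk, hl]; push_cast; ring⟩
  obtain ⟨k, hk⟩ := hu
  obtain ⟨l, hl0, hl⟩ := exists_pos_of_mem_irr (hs a (by simp))
  rw [Multiset.sum_cons, Pi.add_apply, hk, hl] at hr
  norm_cast at hr
  omega

theorem charInner_finset_sum_left [Finite G] (T : Finset (G → ℂ)) (hT : ∀ χ ∈ T, χ ∈ irr G)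
    {χ : G → ℂ} (hχ : χ ∈ irr G) [Decidable (χ ∈ T)] :
    charInner (∑ ψ ∈ T, ψ) χ = if χ ∈ T then 1 else 0 := by
  classical
  have hT' : ∑ χ ∈ T, χ = T.val.sum := (Finset.sum_val T).symm
  rw [hT', charInner_multiset_sum _ hT hχ]
  split_ifs with h
  · rw [Multiset.count_eq_one_of_mem T.nodup h, Nat.cast_one]
  · rw [Multiset.count_eq_zero_of_notMem h, Nat.cast_zero]

end Orthogonality

/-! ### Linear characters extended by zero, and induction. -/

section Induction

variable {G : Type*} [Group G]

open Classical in
/-- The extension by zero of a linear character of a subgroup. -/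
noncomputable def zeroExt (V : Subgroup G) (l : V →* ℂˣ) : G → ℂ := fun g =>
  if h : g ∈ V then ((l ⟨g, h⟩ : ℂˣ) : ℂ) else 0

theorem zeroExt_of_mem {V : Subgroup G} (l : V →* ℂˣ) {g : G} (h : g ∈ V) :
    zeroExt V l g = l ⟨g, h⟩ := dif_pos h

theorem zeroExt_of_notMem {V : Subgroup G} (l : V →* ℂˣ) {g : G} (h : g ∉ V) :
    zeroExt V l g = 0 := dif_neg h

theorem zeroExt_ne_zero_iff {V : Subgroup G} (l : V →* ℂˣ) {g : G} :
    zeroExt V l g ≠ 0 ↔ g ∈ V := by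
  by_cases h : g ∈ V
  · simp [zeroExt_of_mem l h, h]
  · simp [zeroExt_of_notMem l h, h]

theorem indChar_eq_sum [Fintype G] (V : Subgroup G) (l : V →* ℂˣ) (g : G) :
    indChar V l g = (Nat.card V : ℂ)⁻¹ * ∑ x, zeroExt V l (x⁻¹ * g * x) := by
  rw [indChar, finsum_eq_sum_of_fintype]
  rfl

theorem indChar_one [Finite G] (V : Subgroup G) (l : V →* ℂˣ) : indChar V l 1 = V.index := by
  have := Fintype.ofFinite G
  have h0 : (Nat.card V : ℂ) ≠ 0 := by simp [Nat.card_pos.ne']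
  rw [indChar_eq_sum, inv_mul_eq_iff_eq_mul₀ h0]
  have h1 : zeroExt V l 1 = 1 := by
    rw [zeroExt_of_mem l V.one_mem]
    exact congrArg Units.val (map_one l)
  simp only [mul_one, inv_mul_cancel, h1, Finset.sum_const, Finset.card_univ, nsmul_eq_mul]
  rw [← Nat.card_eq_fintype_card, ← V.card_mul_index]
  push_cast
  rfl

/-- Functions that are the extension by zero of a linear character of a subgroup. -/
structure IsPartialChar (h : G → ℂ) : Prop where
  one : h 1 = 1
  mul : ∀ x y, h x ≠ 0 → h (x * y) = h x * h y

namespace IsPartialChar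

variable {h h' : G → ℂ}

theorem _root_.isPartialChar_zeroExt (V : Subgroup G) (l : V →* ℂˣ) :
    IsPartialChar (zeroExt V l) where
  one := by
    rw [zeroExt_of_mem l V.one_mem]
    exact congrArg Units.val (map_one l)
  mul x y hx := by
    have hx' := (zeroExt_ne_zero_iff l).1 hx
    by_cases hy : y ∈ V
    · rw [zeroExt_of_mem l hx', zeroExt_of_mem l hy, zeroExt_of_mem l (V.mul_mem hx' hy)]
      exact congrArg Units.val (map_mul l ⟨x, hx'⟩ ⟨y, hy⟩)
    · rw [zeroExt_of_notMem l hy, mul_zero,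
        zeroExt_of_notMem l fun hxy => hy ((V.mul_mem_cancel_left hx').1 hxy)]

/-- A product lives on the intersection of the two supports. Extension by zero does this bookkeeping
without naming the intersection. -/
theorem mul' (hh : IsPartialChar h) (hh' : IsPartialChar h') :
    IsPartialChar (fun x => h x * h' x) where
  one := by rw [hh.one, hh'.one, one_mul]
  mul x y hxy := by
    rw [hh.mul x y (left_ne_zero_of_mul hxy), hh'.mul x y (right_ne_zero_of_mul hxy)]
    ring

theorem conjBy (hh : IsPartialChar h) (c : G) : IsPartialChar (fun x => h (c⁻¹ * x * c)) where
  one := by simp [hh.one]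
  mul x y hx := by
    rw [← hh.mul _ _ hx]
    congr 1
    group

theorem star (hh : IsPartialChar h) : IsPartialChar (fun x => conj (h x)) where
  one := by simp [hh.one]
  mul x y hx := by
    rw [hh.mul x y (by simpa using hx), map_mul]

theorem pow (hh : IsPartialChar h) {x : G} (hx : h x ≠ 0) (n : ℕ) : h (x ^ n) = h x ^ n := by
  induction n with
  | zero => simp [hh.one]
  | succ n ih => rw [pow_succ', hh.mul _ _ hx, ih, pow_succ']

theorem mul_conj [Finite G] (hh : IsPartialChar h) {x : G} (hx : h x ≠ 0) :
    h x * conj (h x) = 1 := by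
  have : h x ^ Nat.card G = 1 := by rw [← hh.pow hx, pow_card_eq_one', hh.one]
  rw [conj_eq_inv_of_pow_eq_one Nat.card_pos.ne' this, mul_inv_cancel₀ hx]

/-- Translation by a point x of the support multiplies the sum by h x. So either the sum is 0, or h
is 1 on its support and the sum counts the support. -/
theorem exists_sum_eq [Fintype G] (hh : IsPartialChar h) : ∃ k : ℕ, ∑ x, h x = k := by
  classical
  by_cases hs : ∑ x, h x = 0
  · exact ⟨0, by simpa using hs⟩
  have key : ∀ x, h x ≠ 0 → h x = 1 := by
    intro x hx
    have e : ∑ y, h (x * y) = ∑ y, h y := Equiv.sum_comp (Equiv.mulLeft x) h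
    simp only [hh.mul x _ hx, ← Finset.mul_sum] at e
    exact mul_right_cancel₀ hs (by rw [e, one_mul])
  refine ⟨(Finset.univ.filter fun x => h x ≠ 0).card, ?_⟩
  rw [Finset.card_filter]
  push_cast
  refine Finset.sum_congr rfl fun x _ => ?_
  by_cases hx : h x = 0
  · simp [hx]
  · simp [key x hx]

theorem sum_ne_zero [Fintype G] (hh : IsPartialChar h) (h1 : ∀ x, h x ≠ 0 → h x = 1) :
    ∑ x, h x ≠ 0 := by
  classical
  have e : ∑ x, h x = ((Finset.univ.filter fun x => h x ≠ 0).card : ℂ) := by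
    rw [Finset.card_filter]
    push_cast
    refine Finset.sum_congr rfl fun x _ => ?_
    by_cases hx : h x = 0
    · simp [hx]
    · simp [h1 x hx]
  rw [e]
  have : (1 : G) ∈ Finset.univ.filter fun x => h x ≠ 0 := by simp [hh.one]
  exact_mod_cast (Finset.card_pos.2 ⟨1, this⟩).ne'

end IsPartialChar

/-- The induced representation is realized on a space p of functions on G. Composing translation
with the averaging projection P onto p turns the trace on p into a trace on all functions, computed
in the basis of delta functions. -/
theorem isRepChar_indChar [Finite G] (V : Subgroup G) (l : V →* ℂˣ) : IsRepChar (indChar V l) := by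
  classical
  have := Fintype.ofFinite G
  set h := zeroExt V l with hh
  have hP : IsPartialChar h := isPartialChar_zeroExt V l
  have hne : ∀ {v}, v ∈ V → h v ≠ 0 := fun hv => (zeroExt_ne_zero_iff l).2 hv
  have h0 : (Nat.card V : ℂ) ≠ 0 := by simp
  -- functions `f` on `G` with `f (x v) = f x / l v` for `v ∈ V`, under left translation
  let p : Submodule ℂ (G → ℂ) :=
    { carrier := {f | ∀ x, ∀ v ∈ V, f (x * v) * h v = f x}
      add_mem' := fun {f f'} hf hf' x v hv => by
        rw [Pi.add_apply, Pi.add_apply, add_mul, hf x v hv, hf' x v hv]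
      zero_mem' := fun x v _ => by simp
      smul_mem' := fun c f hf x v hv => by
        rw [Pi.smul_apply, Pi.smul_apply, smul_eq_mul, smul_eq_mul, mul_assoc, hf x v hv] }
  let T : G →* ((G → ℂ) →ₗ[ℂ] (G → ℂ)) :=
    { toFun := fun g => LinearMap.funLeft ℂ ℂ fun x => g⁻¹ * x
      map_one' := by ext f x; simp [LinearMap.funLeft]
      map_mul' := fun g g' => by
        ext f x; simp [LinearMap.funLeft, mul_assoc] }
  have hT : ∀ g f x, T g f x = f (g⁻¹ * x) := fun g f x => rfl
  have hTp : ∀ g, ∀ f ∈ p, T g f ∈ p := by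
    intro g f hf x v hv
    rw [hT, hT, ← mul_assoc]
    exact hf _ v hv
  let ρ : Representation ℂ G p :=
    { toFun := fun g => (T g).restrict (hTp g)
      map_one' := by ext f; simp
      map_mul' := fun g g' => by ext f; simp }
  let P : (G → ℂ) →ₗ[ℂ] (G → ℂ) :=
    { toFun := fun f x => (Nat.card V : ℂ)⁻¹ * ∑ v, f (x * v) * h v
      map_add' := fun f f' => by
        ext x; simp [add_mul, Finset.sum_add_distrib, mul_add]
      map_smul' := fun c f => by
        ext x
        simp only [Pi.smul_apply, smul_eq_mul, RingHom.id_apply, mul_assoc, ← Finset.mul_sum]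
        ring }
  have hP' : ∀ f x, P f x = (Nat.card V : ℂ)⁻¹ * ∑ v, f (x * v) * h v := fun f x => rfl
  have hPp : ∀ f, P f ∈ p := by
    intro f x w hw
    rw [hP', hP', mul_assoc, Finset.sum_mul]
    congr 1
    rw [← Equiv.sum_comp (Equiv.mulLeft w) fun v => f (x * v) * h v]
    refine Finset.sum_congr rfl fun v _ => ?_
    simp only [Equiv.coe_mulLeft]
    rw [hP.mul w v (hne hw), mul_assoc x]
    ring
  have hPid : ∀ f ∈ p, P f = f := by
    intro f hf
    ext x
    rw [hP', inv_mul_eq_iff_eq_mul₀ h0]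
    have : ∀ v, f (x * v) * h v = if v ∈ V then f x else 0 := by
      intro v
      split_ifs with hv
      · exact hf x v hv
      · rw [hh, zeroExt_of_notMem l hv, mul_zero]
    simp only [this]
    rw [← Finset.sum_filter, Finset.sum_const, nsmul_eq_mul]
    congr 2
    rw [Nat.card_eq_fintype_card, Fintype.card_subtype]
  have hchar : ρ.character = indChar V l := by
    ext g
    have e1 : LinearMap.trace ℂ p (ρ g) = LinearMap.trace ℂ (G → ℂ) (T g ∘ₗ P) := by
      have hmem : ∀ f, (T g ∘ₗ P) f ∈ p := fun f => hTp g _ (hPp f)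
      rw [← LinearMap.trace_restrict_eq_of_forall_mem p (T g ∘ₗ P) hmem]
      congr 1
      ext f x
      change T g f.1 x = T g (P f.1) x
      rw [hPid f.1 f.2]
    change LinearMap.trace ℂ p (ρ g) = _
    rw [e1, LinearMap.trace_eq_matrix_trace ℂ (Pi.basisFun ℂ G), Matrix.trace, indChar_eq_sum,
      Finset.mul_sum]
    refine Finset.sum_congr rfl fun x _ => ?_
    rw [Matrix.diag_apply, LinearMap.toMatrix_apply]
    change P (Pi.basisFun ℂ G x) (g⁻¹ * x) = _
    rw [hP']
    congr 1
    -- The delta function at x, evaluated at g⁻¹xv, is nonzero only for v = x⁻¹gx.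
    rw [Finset.sum_eq_single (x⁻¹ * g * x)]
    · simp [hh, mul_assoc]
    · intro v _ hv
      rw [Pi.basisFun_apply, Pi.single_eq_of_ne, zero_mul]
      rintro h1
      exact hv (by rw [← mul_right_inj (g⁻¹ * x), h1]; group)
    · simp
  rw [← hchar]
  exact isRepChar_character ρ

end Induction

/-! ### Inner products of induced characters. -/

section Mackey

variable {G : Type*} [Group G]

/-- Replacing g by ygy⁻¹ and x by yx shows that the summand belonging to y does not depend on y.
This is Mackey's formula without double cosets. -/
theorem sum_ind_mul_conj_ind [Fintype G] (h h' : G → ℂ) :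
    ∑ g, (∑ x, h (x⁻¹ * g * x)) * conj (∑ y, h' (y⁻¹ * g * y)) =
      Nat.card G * ∑ x, ∑ g, h (x⁻¹ * g * x) * conj (h' g) := by
  have e : ∀ y : G, ∑ g, (∑ x, h (x⁻¹ * g * x)) * conj (h' (y⁻¹ * g * y)) =
      ∑ x, ∑ g, h (x⁻¹ * g * x) * conj (h' g) := by
    intro y
    rw [← Equiv.sum_comp (MulAut.conj y).toEquiv, Finset.sum_comm]
    refine Finset.sum_congr rfl fun g _ => ?_
    have e1 : y⁻¹ * (MulAut.conj y).toEquiv g * y = g := by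
      simp [MulAut.conj_apply, mul_assoc]
    rw [e1, Finset.sum_mul, ← Equiv.sum_comp (Equiv.mulLeft y)]
    refine Finset.sum_congr rfl fun x _ => ?_
    congr 2
    simp [MulAut.conj_apply, mul_assoc]
  simp only [map_sum, Finset.mul_sum]
  rw [Finset.sum_comm]
  simp only [← Finset.mul_sum, e]
  rw [Finset.sum_const, Finset.card_univ, nsmul_eq_mul, Nat.card_eq_fintype_card]

theorem charInner_ind [Fintype G] (h h' : G → ℂ) (c c' : ℂ) :
    charInner (fun g => c * ∑ x, h (x⁻¹ * g * x)) (fun g => c' * ∑ x, h' (x⁻¹ * g * x)) =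
      c * conj c' * ∑ x, ∑ g, h (x⁻¹ * g * x) * conj (h' g) := by
  have h0 : (Nat.card G : ℂ) ≠ 0 := by simp
  rw [charInner_eq_sum, inv_mul_eq_iff_eq_mul₀ h0]
  have := sum_ind_mul_conj_ind h h'
  rw [mul_left_comm, ← this, Finset.mul_sum]
  refine Finset.sum_congr rfl fun g _ => ?_
  rw [map_mul]
  ring

theorem indChar_mul_eq [Fintype G] (V : Subgroup G) (l : V →* ℂˣ) {θ : G → ℂ}
    (hθ : ∀ x g, θ (x⁻¹ * g * x) = θ g) :
    indChar V l * θ = fun g => (Nat.card V : ℂ)⁻¹ *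
      ∑ x, (fun y => zeroExt V l y * θ y) (x⁻¹ * g * x) := by
  ext g
  rw [Pi.mul_apply, indChar_eq_sum, mul_assoc, Finset.sum_mul]
  simp only [hθ]

/-- The substitution g ↦ ag multiplies the sum by z · conj w, which is not 1. -/
theorem sum_conj_mul_eq_zero [Fintype G] {h h' : G → ℂ} {x a : G} {z w : ℂ}
    (hz : ∀ g, h (x⁻¹ * a * x * g) = z * h g) (hw : ∀ g, h' (a * g) = w * h' g)
    (hne : z * conj w ≠ 1) : ∑ g, h (x⁻¹ * g * x) * conj (h' g) = 0 := by
  have e : ∑ g, h (x⁻¹ * g * x) * conj (h' g) =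
      (z * conj w) * ∑ g, h (x⁻¹ * g * x) * conj (h' g) := by
    refine (Equiv.sum_comp (Equiv.mulLeft a) _).symm.trans ?_
    rw [Finset.mul_sum]
    refine Finset.sum_congr rfl fun g _ => ?_
    have e1 : x⁻¹ * (a * g) * x = x⁻¹ * a * x * (x⁻¹ * g * x) := by group
    rw [Equiv.coe_mulLeft, e1, hz, hw, map_mul]
    ring
  by_contra h0
  exact hne (mul_right_cancel₀ h0 (by rw [one_mul]; exact e.symm))

/-- Translating by an element at which the two linear characters differ kills the sum. -/
theorem sum_zeroExt_conj_eq_zero [Fintype G] {V V' : Subgroup G} (l : V →* ℂˣ) (l' : V' →* ℂˣ)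
    {θ θ' : G → ℂ} {x a : G} (ha' : x⁻¹ * a * x ∈ V) (ha : a ∈ V')
    (hθ : ∀ g, θ (x⁻¹ * a * x * g) = θ g) (hθ' : ∀ g, θ' (a * g) = θ' g)
    (hne : zeroExt V l (x⁻¹ * a * x) ≠ zeroExt V' l' a) :
    ∑ g, (fun y => zeroExt V l y * θ y) (x⁻¹ * g * x) *
      conj ((fun y => zeroExt V' l' y * θ' y) g) = 0 := by
  have h1 := isPartialChar_zeroExt V l
  have h2 := isPartialChar_zeroExt V' l'
  have n1 := (zeroExt_ne_zero_iff l).2 ha'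
  have n2 := (zeroExt_ne_zero_iff l').2 ha
  refine sum_conj_mul_eq_zero (h := fun y => zeroExt V l y * θ y)
    (h' := fun y => zeroExt V' l' y * θ' y) (a := a) (z := zeroExt V l (x⁻¹ * a * x))
    (w := zeroExt V' l' a) (fun g => ?_) (fun g => ?_) fun h => hne ?_
  · rw [h1.mul _ _ n1, hθ, mul_assoc]
  · rw [h2.mul _ _ n2, hθ', mul_assoc]
  · have h3 := h2.mul_conj n2
    have h4 : conj (zeroExt V' l' a) ≠ 0 := by simpa using n2
    exact mul_right_cancel₀ h4 (h.trans h3.symm)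

theorem charInner_indChar_mul_eq_zero [Finite G] {V V' : Subgroup G} (l : V →* ℂˣ)
    (l' : V' →* ℂˣ) {θ θ' : G → ℂ} (hθ : ∀ x g, θ (x⁻¹ * g * x) = θ g)
    (hθ' : ∀ x g, θ' (x⁻¹ * g * x) = θ' g)
    (hx : ∀ x, ∃ a, x⁻¹ * a * x ∈ V ∧ a ∈ V' ∧ (∀ g, θ (x⁻¹ * a * x * g) = θ g) ∧
      (∀ g, θ' (a * g) = θ' g) ∧ zeroExt V l (x⁻¹ * a * x) ≠ zeroExt V' l' a) :
    charInner (indChar V l * θ) (indChar V' l' * θ') = 0 := by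
  have := Fintype.ofFinite G
  rw [indChar_mul_eq V l hθ, indChar_mul_eq V' l' hθ']
  refine (charInner_ind (fun y => zeroExt V l y * θ y) (fun y => zeroExt V' l' y * θ' y) _ _).trans ?_
  rw [Finset.sum_eq_zero, mul_zero]
  intro x _
  obtain ⟨a, h1, h2, h3, h4, h5⟩ := hx x
  exact sum_zeroExt_conj_eq_zero l l' h1 h2 h3 h4 h5

/-- Both sides equal the sum of f (π w · y) over all pairs (w, y). This avoids counting fibres. -/
theorem sum_comp_surjective {W Q : Type*} [Group W] [Group Q] [Fintype W] [Fintype Q]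
    (π : W →* Q) (hπ : Function.Surjective π) (f : Q → ℂ) :
    (Nat.card Q : ℂ) * ∑ w, f (π w) = Nat.card W * ∑ y, f y := by
  have h1 : ∑ y : Q, ∑ w : W, f (π w * y) = Nat.card Q * ∑ w, f (π w) := by
    rw [Nat.card_eq_fintype_card, ← nsmul_eq_mul, ← Finset.card_univ, ← Finset.sum_const]
    refine Finset.sum_congr rfl fun y _ => ?_
    obtain ⟨v, rfl⟩ := hπ y
    simp only [← map_mul]
    exact Equiv.sum_comp (Equiv.mulRight v) fun w => f (π w)
  have h2 : ∑ w : W, ∑ y : Q, f (π w * y) = Nat.card W * ∑ y, f y := by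
    rw [Nat.card_eq_fintype_card, ← nsmul_eq_mul, ← Finset.card_univ, ← Finset.sum_const]
    refine Finset.sum_congr rfl fun w _ => ?_
    exact Equiv.sum_comp (Equiv.mulLeft (π w)) f
  rw [← h1, ← h2, Finset.sum_comm]

/-- The inner product of two characters induced from the stabilizer `V` of a linear character of
a normal subgroup, computed on a quotient `Q` of `V`. -/
theorem charInner_indChar_mul [Finite G] {V : Subgroup G} (l l' : V →* ℂˣ) {θ θ' : G → ℂ}
    (hθ : ∀ x g, θ (x⁻¹ * g * x) = θ g) (hθ' : ∀ x g, θ' (x⁻¹ * g * x) = θ' g)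
    (hx : ∀ x, x ∉ V → ∃ a, x⁻¹ * a * x ∈ V ∧ a ∈ V ∧ (∀ g, θ (x⁻¹ * a * x * g) = θ g) ∧
      (∀ g, θ' (a * g) = θ' g) ∧ zeroExt V l (x⁻¹ * a * x) ≠ zeroExt V l' a)
    {Q : Type*} [Group Q] [Fintype Q] (π : V →* Q) (hπ : Function.Surjective π) (f : Q → ℂ)
    (hf : ∀ v : V, (l v : ℂ) * θ v * conj ((l' v : ℂ) * θ' v) = f (π v)) :
    charInner (indChar V l * θ) (indChar V l' * θ') = (Nat.card Q : ℂ)⁻¹ * ∑ y, f y := by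
  classical
  have := Fintype.ofFinite G
  have hV0 : (Nat.card V : ℂ) ≠ 0 := by simp
  have hQ0 : (Nat.card Q : ℂ) ≠ 0 := by simp
  rw [indChar_mul_eq V l hθ, indChar_mul_eq V l' hθ']
  refine (charInner_ind (fun y => zeroExt V l y * θ y) (fun y => zeroExt V l' y * θ' y) _ _).trans ?_
  -- For x in V, conjugation by x changes neither l nor θ. For x outside V, the element a of the
  -- hypothesis kills the sum.
  have e1 : ∀ x, ∑ g, (fun y => zeroExt V l y * θ y) (x⁻¹ * g * x) *
      conj ((fun y => zeroExt V l' y * θ' y) g) = if x ∈ V then ∑ v, f (π v) else 0 := by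
    intro x
    split_ifs with hxV
    · rw [← Finset.sum_subset (Finset.subset_univ (Finset.univ.filter fun g => g ∈ V))]
      · rw [Finset.sum_subtype (p := fun g => g ∈ V) _ (by simp)]
        refine Finset.sum_congr rfl fun v _ => ?_
        have hmem : x⁻¹ * (v : G) * x ∈ V := V.mul_mem (V.mul_mem (V.inv_mem hxV) v.2) hxV
        have hl : l ⟨x⁻¹ * (v : G) * x, hmem⟩ = l v := by
          have : (⟨x⁻¹ * (v : G) * x, hmem⟩ : V) = (⟨x, hxV⟩ : V)⁻¹ * v * ⟨x, hxV⟩ := rfl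
          rw [this, map_mul, map_mul, map_inv, mul_comm, mul_inv_cancel_left]
        simp only [hθ]
        rw [zeroExt_of_mem l hmem, zeroExt_of_mem l' v.2, hl]
        exact hf v
      · intro g _ hg
        have hg' : g ∉ V := by simpa using hg
        simp [zeroExt_of_notMem l' hg']
    · obtain ⟨a, h1, h2, h3, h4, h5⟩ := hx x hxV
      exact sum_zeroExt_conj_eq_zero l l' h1 h2 h3 h4 h5
  rw [Finset.sum_congr rfl fun x _ => e1 x, ← Finset.sum_filter, Finset.sum_const, nsmul_eq_mul]
  have e2 : ((Finset.univ.filter fun g => g ∈ V).card : ℂ) = Nat.card V := by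
    rw [Nat.card_eq_fintype_card, Fintype.card_subtype]
  have e3 := sum_comp_surjective π hπ f
  have e4 : ∑ v, f (π v) = (Nat.card Q : ℂ)⁻¹ * (Nat.card V * ∑ y, f y) := by
    rw [← e3, inv_mul_cancel_left₀ hQ0]
  rw [e2, e4, map_inv₀, Complex.conj_natCast]
  field_simp

/-- A product of induced linear characters has a common constituent with an induced linear
character agreeing with them on the intersection of the subgroups. -/
theorem charInner_indChar_mul_mul_ne_zero [Finite G] {V₁ V₂ V₃ W : Subgroup G} (l₁ : V₁ →* ℂˣ)
    (l₂ : V₂ →* ℂˣ) (l₃ : V₃ →* ℂˣ) (l : W →* ℂˣ)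
    (h : ∀ (g : G) (h₁ : g ∈ V₁) (h₂ : g ∈ V₂) (h₃ : g ∈ V₃) (hW : g ∈ W),
      l₁ ⟨g, h₁⟩ * l₂ ⟨g, h₂⟩ * l₃ ⟨g, h₃⟩ = l ⟨g, hW⟩) :
    charInner (indChar V₁ l₁ * indChar V₂ l₂ * indChar V₃ l₃) (indChar W l) ≠ 0 := by
  have := Fintype.ofFinite G
  have h0 : (Nat.card G : ℂ) ≠ 0 := by simp
  have hn : ∀ V : Subgroup G, (Nat.card V : ℂ) ≠ 0 := fun V => by simp [Nat.card_pos.ne']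
  set F : G → G → G → G → G → ℂ := fun x y z w g =>
    zeroExt V₁ l₁ (x⁻¹ * g * x) * zeroExt V₂ l₂ (y⁻¹ * g * y) * zeroExt V₃ l₃ (z⁻¹ * g * z) *
      conj (zeroExt W l (w⁻¹ * g * w)) with hF
  have hP : ∀ x y z w, IsPartialChar (F x y z w) := fun x y z w =>
    ((((isPartialChar_zeroExt V₁ l₁).conjBy x).mul'
      ((isPartialChar_zeroExt V₂ l₂).conjBy y)).mul'
      ((isPartialChar_zeroExt V₃ l₃).conjBy z)).mul'
      (((isPartialChar_zeroExt W l).conjBy w).star)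
  have e : charInner (indChar V₁ l₁ * indChar V₂ l₂ * indChar V₃ l₃) (indChar W l) =
      (Nat.card G : ℂ)⁻¹ * ((Nat.card V₁ : ℂ)⁻¹ * (Nat.card V₂ : ℂ)⁻¹ * (Nat.card V₃ : ℂ)⁻¹ *
        (Nat.card W : ℂ)⁻¹ * ∑ x, ∑ y, ∑ z, ∑ w, ∑ g, F x y z w g) := by
    rw [charInner_eq_sum]
    congr 1
    have e1 : ∑ x, ∑ y, ∑ z, ∑ w, ∑ g, F x y z w g =
        ∑ g, ∑ x, ∑ y, ∑ z, ∑ w, F x y z w g := by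
      symm
      rw [Finset.sum_comm]
      refine Finset.sum_congr rfl fun x _ => ?_
      rw [Finset.sum_comm]
      refine Finset.sum_congr rfl fun y _ => ?_
      rw [Finset.sum_comm]
      refine Finset.sum_congr rfl fun z _ => ?_
      exact Finset.sum_comm
    rw [e1, Finset.mul_sum]
    refine Finset.sum_congr rfl fun g _ => ?_
    simp only [hF, Pi.mul_apply, indChar_eq_sum, map_mul, map_sum, map_inv₀,
      Complex.conj_natCast, ← Finset.mul_sum, ← Finset.sum_mul]
    ring
  rw [e]
  refine mul_ne_zero (inv_ne_zero h0) (mul_ne_zero (mul_ne_zero (mul_ne_zero (mul_ne_zero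
    (inv_ne_zero (hn _)) (inv_ne_zero (hn _))) (inv_ne_zero (hn _))) (inv_ne_zero (hn _))) ?_)
  -- The inner product is a positive multiple of a sum of natural numbers, so one nonzero term
  -- suffices. The term at x = y = z = w = 1 is nonzero by the agreement hypothesis.
  choose k hk using fun x y z w => (hP x y z w).exists_sum_eq
  simp only [hk]
  have hk1 : k 1 1 1 1 ≠ 0 := by
    have : ∑ g, F 1 1 1 1 g ≠ 0 := by
      refine (hP 1 1 1 1).sum_ne_zero fun g hg => ?_
      simp only [hF, inv_one, one_mul, mul_one] at hg ⊢
      have g1 := (zeroExt_ne_zero_iff l₁).1 (left_ne_zero_of_mul (left_ne_zero_of_mul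
        (left_ne_zero_of_mul hg)))
      have g2 := (zeroExt_ne_zero_iff l₂).1 (right_ne_zero_of_mul (left_ne_zero_of_mul
        (left_ne_zero_of_mul hg)))
      have g3 := (zeroExt_ne_zero_iff l₃).1 (right_ne_zero_of_mul (left_ne_zero_of_mul hg))
      have g4' : zeroExt W l g ≠ 0 := by simpa using right_ne_zero_of_mul hg
      have g4 := (zeroExt_ne_zero_iff l).1 g4'
      have h5 := (isPartialChar_zeroExt W l).mul_conj g4'
      rw [← h5]
      congr 1
      rw [zeroExt_of_mem _ g1, zeroExt_of_mem _ g2, zeroExt_of_mem _ g3, zeroExt_of_mem _ g4,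
        ← h g g1 g2 g3 g4]
      push_cast
      rfl
    rw [hk] at this
    exact_mod_cast this
  have hpos : 0 < ∑ x, ∑ y, ∑ z, ∑ w, k x y z w := by
    refine Finset.sum_pos' (fun _ _ => Nat.zero_le _) ⟨1, Finset.mem_univ _, ?_⟩
    refine Finset.sum_pos' (fun _ _ => Nat.zero_le _) ⟨1, Finset.mem_univ _, ?_⟩
    refine Finset.sum_pos' (fun _ _ => Nat.zero_le _) ⟨1, Finset.mem_univ _, ?_⟩
    refine Finset.sum_pos' (fun _ _ => Nat.zero_le _) ⟨1, Finset.mem_univ _, ?_⟩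
    exact Nat.pos_of_ne_zero hk1
  exact_mod_cast hpos.ne'

end Mackey

/-! ### Bounds on degrees from an abelian normal subgroup. -/

section DegreeBounds

/-- Induction on the dimension of p: if some f in S is not scalar on p, its eigenspaces in p are
S-stable and at least one of them is nonzero and proper. -/
theorem exists_common_eigenvector {V : Type*} [AddCommGroup V] [Module ℂ V]
    [FiniteDimensional ℂ V] (S : Set (Module.End ℂ V)) (hS : ∀ f ∈ S, ∀ g ∈ S, f * g = g * f)
    (p : Submodule ℂ V) (hp : p ≠ ⊥) (hinv : ∀ f ∈ S, ∀ v ∈ p, f v ∈ p) :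
    ∃ v ∈ p, v ≠ 0 ∧ ∀ f ∈ S, ∃ c : ℂ, f v = c • v := by
  induction hn : Module.finrank ℂ p using Nat.strong_induction_on generalizing p with
  | _ n ih =>
    by_cases hall : ∀ f ∈ S, ∃ c : ℂ, ∀ v ∈ p, f v = c • v
    · obtain ⟨v, hv, hv0⟩ := p.exists_mem_ne_zero_of_ne_bot hp
      exact ⟨v, hv, hv0, fun f hf => (hall f hf).imp fun c hc => hc v hv⟩
    · push Not at hall
      obtain ⟨f, hf, hfc⟩ := hall
      have : Nontrivial p := Submodule.nontrivial_iff_ne_bot.2 hp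
      obtain ⟨μ, hμ⟩ := Module.End.exists_eigenvalue (f.restrict (hinv f hf))
      obtain ⟨w, hw⟩ := hμ.exists_hasEigenvector
      let p' : Submodule ℂ V := p ⊓ Module.End.eigenspace f μ
      have hmem : ∀ v, v ∈ p' ↔ v ∈ p ∧ f v = μ • v := fun v => by
        rw [Submodule.mem_inf, Module.End.mem_eigenspace_iff]
      have hlt : p' < p := by
        refine lt_of_le_of_ne inf_le_left fun heq => ?_
        obtain ⟨v, hv, hv'⟩ := hfc μ
        exact hv' ((hmem v).1 (heq ▸ hv)).2
      have hne : p' ≠ ⊥ := by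
        refine (Submodule.ne_bot_iff _).2 ⟨w, (hmem _).2 ⟨w.2, ?_⟩, fun h => hw.2 (Subtype.ext h)⟩
        exact congrArg Subtype.val hw.apply_eq_smul
      obtain ⟨v, hv, hv'⟩ := ih _ (hn ▸ Submodule.finrank_lt_finrank_of_lt hlt) p' hne
        (fun g hg v hv => (hmem _).2 ⟨hinv g hg v ((hmem v).1 hv).1, by
          rw [← Module.End.mul_apply, hS f hf g hg, Module.End.mul_apply, ((hmem v).1 hv).2,
            map_smul]⟩) rfl
      exact ⟨v, hlt.le hv, hv'⟩

variable {G : Type*} [Group G]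

/-- The stabilizer of a linear character of a normal subgroup. -/
def charStabilizer (A : Subgroup G) [A.Normal] (l : A →* ℂ) : Subgroup G where
  carrier := {t | ∀ a, l (MulAut.conjNormal t a) = l a}
  one_mem' := fun a => by simp
  mul_mem' := fun {s t} hs ht a => by
    rw [map_mul, MulAut.mul_apply]
    exact (hs _).trans (ht a)
  inv_mem' := fun {t} ht a => by
    have := ht (MulAut.conjNormal t⁻¹ a)
    rw [← MulAut.mul_apply, ← map_mul, mul_inv_cancel, map_one, MulAut.one_apply] at this
    exact this.symm

/-- The line through v is S-stable, so one translate of v per coset of S spans a nonzero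
subrepresentation, which is everything. -/
theorem finrank_le_index_of_eigenvector [Finite G] {d : ℕ} (ρ : Representation ℂ G (Fin d → ℂ))
    [hρ : ρ.IsIrreducible] (S : Subgroup G) (v : Fin d → ℂ) (hv : v ≠ 0)
    (hS : ∀ s ∈ S, ∃ c : ℂ, ρ s v = c • v) : d ≤ S.index := by
  let f : G ⧸ S → (Fin d → ℂ) := fun x => ρ x.out v
  let p : Submodule ℂ (Fin d → ℂ) := Submodule.span ℂ (Set.range f)
  have hmem : ∀ g, ρ g v ∈ p := by
    intro g
    obtain ⟨s, hs⟩ := QuotientGroup.mk_out_eq_mul S g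
    have hg : g = (QuotientGroup.mk g : G ⧸ S).out * (s : G)⁻¹ := by rw [hs]; group
    obtain ⟨c, hc⟩ := hS _ (S.inv_mem s.2)
    rw [hg, map_mul, Module.End.mul_apply, hc, map_smul]
    exact p.smul_mem _ (Submodule.subset_span ⟨_, rfl⟩)
  let P : Subrepresentation ρ :=
    { toSubmodule := p
      apply_mem_toSubmodule := fun g w hw => by
        have : p ≤ p.comap (ρ g) := by
          refine Submodule.span_le.2 ?_
          rintro _ ⟨x, rfl⟩
          change ρ g (ρ _ v) ∈ p
          rw [← Module.End.mul_apply, ← map_mul]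
          exact hmem _
        exact this hw }
  have hP : P = ⊤ := by
    refine (hρ.eq_bot_or_eq_top P).resolve_left fun h => hv ?_
    have h1 : p = ⊥ := congrArg Subrepresentation.toSubmodule h
    have h2 := hmem 1
    rw [h1, map_one] at h2
    simpa using h2
  have hp : p = ⊤ := congrArg Subrepresentation.toSubmodule hP
  have := Fintype.ofFinite (G ⧸ S)
  have h3 := finrank_range_le_card (R := ℂ) f
  rw [Set.finrank, show Submodule.span ℂ (Set.range f) = ⊤ from hp, finrank_top,
    Module.finrank_fin_fun] at h3
  rwa [Subgroup.index, Nat.card_eq_fintype_card]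

/-- Translates of v by representatives of distinct cosets of the stabilizer are eigenvectors of A
for distinct linear characters. Dedekind's theorem, applied to each coordinate, makes them linearly
independent. -/
theorem index_charStabilizer_le [Finite G] {d : ℕ} (ρ : Representation ℂ G (Fin d → ℂ))
    (A : Subgroup G) [A.Normal] (l : A →* ℂ) (v : Fin d → ℂ) (hv : v ≠ 0)
    (hl : ∀ a : A, ρ a v = l a • v) : (charStabilizer A l).index ≤ d := by
  set T := charStabilizer A l
  have := Fintype.ofFinite (G ⧸ T)
  let L : G → A →* ℂ := fun g => l.comp (MulAut.conjNormal g⁻¹ : A ≃* A).toMonoidHom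
  have hL : ∀ g a, ρ (a : A) (ρ g v) = L g a • ρ g v := by
    intro g a
    have h1 : (a : G) * g = g * (MulAut.conjNormal g⁻¹ a : A) := by
      rw [MulAut.conjNormal_apply]; group
    rw [← Module.End.mul_apply, ← map_mul, h1, map_mul, Module.End.mul_apply, hl, map_smul]
    rfl
  have hinj : Function.Injective fun x : G ⧸ T => L x.out := by
    intro x y hxy
    rw [← QuotientGroup.out_eq' x, ← QuotientGroup.out_eq' y, QuotientGroup.eq]
    intro a
    have h2 := DFunLike.congr_fun hxy (MulAut.conjNormal y.out a)
    change l (MulAut.conjNormal _ (MulAut.conjNormal _ a)) =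
      l (MulAut.conjNormal _ (MulAut.conjNormal _ a)) at h2
    rw [← MulAut.mul_apply, ← map_mul, ← MulAut.mul_apply, ← map_mul, inv_mul_cancel, map_one,
      MulAut.one_apply] at h2
    exact h2
  have hind : LinearIndependent ℂ fun x : G ⧸ T => ρ x.out v := by
    rw [Fintype.linearIndependent_iff]
    intro c hc x
    have hchar := (linearIndependent_monoidHom A ℂ).comp _ hinj
    rw [Fintype.linearIndependent_iff] at hchar
    have hcoord : ∀ i, c x * ρ x.out v i = 0 := by
      intro i
      refine hchar (fun y => c y * ρ y.out v i) ?_ x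
      ext a
      have h3 := congrFun (congrArg (ρ (a : A)) hc) i
      rw [map_sum, map_zero, Finset.sum_apply] at h3
      rw [Finset.sum_apply]
      refine Eq.trans (Finset.sum_congr rfl fun y _ => ?_) h3
      rw [map_smul, hL]
      simp only [Pi.smul_apply, smul_eq_mul, Function.comp_apply]
      ring
    by_contra hcx
    refine hv ?_
    have h4 : ρ x.out v = 0 := by
      ext i
      exact (mul_eq_zero.1 (hcoord i)).resolve_left hcx
    have h5 := congrArg (ρ x.out⁻¹) h4
    rwa [← Module.End.mul_apply, ← map_mul, inv_mul_cancel, map_one, map_zero] at h5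
  have := hind.fintype_card_le_finrank
  rwa [Module.finrank_fin_fun, ← Nat.card_eq_fintype_card] at this

/-- The degree of an irreducible character lies between the index of the stabilizer of a linear
character of an abelian normal subgroup below it, and the index of the product of that subgroup
and an abelian subgroup of the stabilizer. -/
theorem exists_charStabilizer_index_le [Finite G] {χ : G → ℂ} (hχ : χ ∈ irr G) {d : ℕ}
    (hd : χ 1 = d) (A : Subgroup G) [A.Normal] (hA : ∀ a ∈ A, ∀ b ∈ A, a * b = b * a) :
    ∃ l : A →* ℂ, (charStabilizer A l).index ≤ d ∧
      ∀ B ≤ charStabilizer A l, (∀ a ∈ B, ∀ b ∈ B, a * b = b * a) → d ≤ (A ⊔ B).index := by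
  obtain ⟨e, ρ, hρ, rfl⟩ := hχ
  have hde : e = d := by
    rw [Representation.char_one, Module.finrank_fin_fun] at hd
    exact_mod_cast hd
  subst hde
  have htop : (⊤ : Submodule ℂ (Fin e → ℂ)) ≠ ⊥ := by
    intro h
    have : Nontrivial (Subrepresentation ρ) := hρ.toNontrivial
    obtain ⟨p, q, hpq⟩ := this
    have hsub : Subsingleton (Submodule ℂ (Fin e → ℂ)) :=
      subsingleton_of_bot_eq_top h.symm
    exact hpq (Subrepresentation.toSubmodule_injective (Subsingleton.elim _ _))
  have hcomm : ∀ B : Subgroup G, (∀ a ∈ B, ∀ b ∈ B, a * b = b * a) →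
      ∀ f ∈ ρ '' B, ∀ g ∈ ρ '' B, f * g = g * f := by
    rintro B hB _ ⟨a, ha, rfl⟩ _ ⟨b, hb, rfl⟩
    rw [← map_mul, ← map_mul, hB a ha b hb]
  obtain ⟨v, -, hv0, hv⟩ := exists_common_eigenvector (ρ '' (A : Set G)) (hcomm A hA) ⊤ htop
    fun _ _ _ _ => Submodule.mem_top
  choose c hc using fun a : A => hv (ρ a) ⟨a, a.2, rfl⟩
  let l : A →* ℂ :=
    { toFun := c
      map_one' := by
        have := hc 1
        rw [Subgroup.coe_one, map_one, Module.End.one_apply] at this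
        exact smul_left_injective ℂ hv0 (by simpa using this.symm)
      map_mul' := fun a b => by
        refine smul_left_injective ℂ hv0 ?_
        change c (a * b) • v = (c a * c b) • v
        rw [← hc, Subgroup.coe_mul, map_mul, Module.End.mul_apply, hc, map_smul, hc, smul_smul,
          mul_comm] }
  refine ⟨l, index_charStabilizer_le ρ A l v hv0 hc, fun B hB hBc => ?_⟩
  -- This is the l-eigenspace of A. It is stable under B because B fixes l, so it contains an
  -- eigenvector common to A and B.
  let p : Submodule ℂ (Fin e → ℂ) :=
    { carrier := {w | ∀ a : A, ρ a w = l a • w}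
      add_mem' := fun hx hy a => by rw [map_add, hx a, hy a, smul_add]
      zero_mem' := fun a => by simp
      smul_mem' := fun r x hx a => by rw [map_smul, hx a, smul_comm] }
  have hp : p ≠ ⊥ := (Submodule.ne_bot_iff _).2 ⟨v, hc, hv0⟩
  have hinv : ∀ f ∈ ρ '' (B : Set G), ∀ w ∈ p, f w ∈ p := by
    rintro _ ⟨b, hb, rfl⟩ w hw a
    have h1 : (a : G) * b = b * (MulAut.conjNormal b⁻¹ a : A) := by
      rw [MulAut.conjNormal_apply]; group
    rw [← Module.End.mul_apply, ← map_mul, h1, map_mul, Module.End.mul_apply, hw, map_smul,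
      (charStabilizer A l).inv_mem (hB hb) a]
  obtain ⟨w, hwp, hw0, hw⟩ := exists_common_eigenvector (ρ '' (B : Set G)) (hcomm B hBc) p hp hinv
  let S : Subgroup G :=
    { carrier := {s | ∃ c : ℂ, ρ s w = c • w}
      one_mem' := ⟨1, by simp⟩
      mul_mem' := by
        rintro s t ⟨c, hc⟩ ⟨c', hc'⟩
        exact ⟨c' * c, by rw [map_mul, Module.End.mul_apply, hc', map_smul, hc, smul_smul]⟩
      inv_mem' := by
        rintro s ⟨c, hc⟩
        have hs : ρ s⁻¹ (ρ s w) = w := by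
          rw [← Module.End.mul_apply, ← map_mul, inv_mul_cancel, map_one, Module.End.one_apply]
        have hc0 : c ≠ 0 := by
          rintro rfl
          rw [hc, zero_smul, map_zero] at hs
          exact hw0 hs.symm
        refine ⟨c⁻¹, ?_⟩
        rw [hc, map_smul] at hs
        rw [eq_inv_smul_iff₀ hc0, hs] }
  have hAB : A ⊔ B ≤ S := sup_le (fun a ha => ⟨l ⟨a, ha⟩, hwp ⟨a, ha⟩⟩)
    fun b hb => hw (ρ b) ⟨b, hb, rfl⟩
  exact finrank_le_index_of_eigenvector ρ (A ⊔ B) w hw0 fun s hs => hAB hs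

end DegreeBounds

/-! ### Unitriangular matrices, base groups and elementary characters. -/

section Unitriangular

variable {n : ℕ} {F : Type*} [Field F]

/-- The matrix underlying an element of `unitri n F`. -/
def unitri.mat (g : unitri n F) : Matrix (Fin n) (Fin n) F := ((g : GL (Fin n) F) : Matrix _ _ F)

namespace unitri

@[simp] theorem mat_one : mat (1 : unitri n F) = 1 := rfl

@[simp] theorem mat_mul (g h : unitri n F) : mat (g * h) = mat g * mat h := rfl

theorem mat_injective : Function.Injective (mat : unitri n F → _) := fun _ _ h =>
  Subtype.ext (Units.ext h)

theorem mat_of_lt (g : unitri n F) {i j : Fin n} (h : j < i) : mat g i j = 0 := g.2.1 i j h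

@[simp] theorem mat_diag (g : unitri n F) (i : Fin n) : mat g i i = 1 := g.2.2 i

theorem mat_inv_mul (g : unitri n F) : mat g⁻¹ * mat g = 1 := by
  rw [← mat_mul, inv_mul_cancel, mat_one]

theorem mat_mul_inv (g : unitri n F) : mat g * mat g⁻¹ = 1 := by
  rw [← mat_mul, mul_inv_cancel, mat_one]

instance [Finite F] : Finite (unitri n F) := by
  have : Finite (Matrix (Fin n) (Fin n) F) := inferInstanceAs (Finite (Fin n → Fin n → F))
  exact Finite.of_injective _ (mat_injective (n := n) (F := F))

/-- The element of `unitri n F` with a given matrix. -/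
def ofMat (M : Matrix (Fin n) (Fin n) F) (h0 : ∀ i j, j < i → M i j = 0) (h1 : ∀ i, M i i = 1) :
    unitri n F :=
  ⟨Matrix.GeneralLinearGroup.mkOfDetNeZero M (by
    rw [Matrix.det_of_isUpperTriangular fun i j h => h0 i j h]
    simp [h1]), h0, h1⟩

@[simp] theorem mat_ofMat (M : Matrix (Fin n) (Fin n) F) (h0 : ∀ i j, j < i → M i j = 0)
    (h1 : ∀ i, M i i = 1) : mat (ofMat M h0 h1) = M := rfl

variable (n F) in
/-- The strictly upper triangular matrices. -/
def strictUpper : Submodule F (Matrix (Fin n) (Fin n) F) where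
  carrier := {M | ∀ i j, j ≤ i → M i j = 0}
  add_mem' := fun hM hN i j h => by rw [Matrix.add_apply, hM i j h, hN i j h, add_zero]
  zero_mem' := fun _ _ _ => rfl
  smul_mem' := fun c M hM i j h => by rw [Matrix.smul_apply, hM i j h, smul_zero]

theorem mat_sub_one_mem (g : unitri n F) : mat g - 1 ∈ strictUpper n F := by
  intro i j h
  rcases h.lt_or_eq with h | rfl
  · rw [Matrix.sub_apply, mat_of_lt g h, Matrix.one_apply_ne h.ne', sub_zero]
  · simp

/-- `1 + X` for a strictly upper triangular matrix `X`. -/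
def oneAdd (X : Matrix (Fin n) (Fin n) F) (hX : X ∈ strictUpper n F) : unitri n F :=
  ofMat (1 + X) (fun i j h => by rw [Matrix.add_apply, hX i j h.le, Matrix.one_apply_ne h.ne',
    add_zero]) fun i => by rw [Matrix.add_apply, hX i i le_rfl, Matrix.one_apply_eq, add_zero]

@[simp] theorem mat_oneAdd (X : Matrix (Fin n) (Fin n) F) (hX : X ∈ strictUpper n F) :
    mat (oneAdd X hX) = 1 + X := rfl

/-- A subgroup `1 + J` has as many elements as the subspace `J`. -/
theorem card_eq_card_submodule (S : Subgroup (unitri n F))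
    (J : Submodule F (Matrix (Fin n) (Fin n) F)) (hJ : J ≤ strictUpper n F)
    (hS : ∀ g, g ∈ S ↔ mat g - 1 ∈ J) : Nat.card S = Nat.card J := by
  refine Nat.card_congr
    { toFun := fun g => ⟨mat g.1 - 1, (hS _).1 g.2⟩
      invFun := fun X => ⟨oneAdd X.1 (hJ X.2), (hS _).2 (by simp)⟩
      left_inv := fun g => Subtype.ext (mat_injective (by simp))
      right_inv := fun X => Subtype.ext (by simp) }

/-- Rank and nullity for L on the strictly upper triangular matrices: the index of 1 + ker L is the
number of values of L. -/
theorem index_eq_pow [Finite F] (S : Subgroup (unitri n F)) {ι : Type*} [Finite ι]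
    (L : Matrix (Fin n) (Fin n) F →ₗ[F] (ι → F)) (hS : ∀ g, g ∈ S ↔ L (mat g - 1) = 0)
    (hL : ∀ y, ∃ M ∈ strictUpper n F, L M = y) : S.index = Nat.card F ^ Nat.card ι := by
  let L' : strictUpper n F →ₗ[F] (ι → F) := L.domRestrict (strictUpper n F)
  have hsurj : Function.Surjective L' := fun y => by
    obtain ⟨M, hM, rfl⟩ := hL y
    exact ⟨⟨M, hM⟩, rfl⟩
  have e1 : Nat.card (unitri n F) = Nat.card (strictUpper n F) := by
    rw [← card_eq_card_submodule ⊤ (strictUpper n F) le_rfl fun g => by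
      simp [mat_sub_one_mem g], Subgroup.card_top]
  have e2 : Nat.card S = Nat.card (LinearMap.ker L') := by
    rw [card_eq_card_submodule S ((LinearMap.ker L').map (strictUpper n F).subtype)
      (Submodule.map_subtype_le _ _) fun g => ?_]
    · exact (Nat.card_congr ((LinearMap.ker L').equivMapOfInjective _
        (Submodule.injective_subtype _)).toEquiv).symm
    · rw [hS]
      simp only [Submodule.mem_map, LinearMap.mem_ker]
      constructor
      · intro h
        exact ⟨⟨mat g - 1, mat_sub_one_mem g⟩, h, rfl⟩
      · rintro ⟨X, hX, hXg⟩
        rw [← hXg]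
        exact hX
  have e3 : Nat.card (strictUpper n F) = Nat.card (LinearMap.ker L') * Nat.card F ^ Nat.card ι := by
    have e4 := (LinearMap.ker L').card_eq_card_quotient_mul_card
    rw [e4, Nat.card_congr (L'.quotKerEquivOfSurjective hsurj).toEquiv, Nat.card_fun, mul_comm]
  have hpos : 0 < Nat.card S := Nat.card_pos
  have e5 := S.card_mul_index
  rw [e1, e3, ← e2] at e5
  exact Nat.eq_of_mul_eq_mul_left hpos e5

/-- The linear character `v ↦ φ (f v)` of a subgroup on which `f` is additive. -/
def linChar (S : Subgroup (unitri n F)) (f : unitri n F → F)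
    (hf : ∀ g ∈ S, ∀ h ∈ S, f (g * h) = f g + f h) (φ : AddChar F ℂ) : S →* ℂˣ :=
  MonoidHom.toHomUnits
    { toFun := fun v => φ (f v)
      map_one' := by
        have := hf 1 S.one_mem 1 S.one_mem
        rw [mul_one, left_eq_add] at this
        rw [Subgroup.coe_one, this, AddChar.map_zero_eq_one]
      map_mul' := fun v w => by
        rw [Subgroup.coe_mul, hf _ v.2 _ w.2, AddChar.map_add_eq_mul] }

@[simp] theorem linChar_apply (S : Subgroup (unitri n F)) (f : unitri n F → F)
    (hf : ∀ g ∈ S, ∀ h ∈ S, f (g * h) = f g + f h) (φ : AddChar F ℂ) (v : S) :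
    (linChar S f hf φ v : ℂ) = φ (f v) := rfl

theorem zeroExt_linChar (S : Subgroup (unitri n F)) (f : unitri n F → F)
    (hf : ∀ g ∈ S, ∀ h ∈ S, f (g * h) = f g + f h) (φ : AddChar F ℂ) {g : unitri n F}
    (hg : g ∈ S) : zeroExt S (linChar S f hf φ) g = φ (f g) := by
  rw [zeroExt_of_mem _ hg, linChar_apply]

end unitri

namespace PosRoot

open unitri

variable (α : PosRoot n)

theorem row_lt_col : α.row < α.col := by
  have h1 := α.one_le
  have h2 := α.le
  simp only [row, col, Fin.lt_def]
  omega

theorem single_mem_strictUpper (c : F) : Matrix.single α.row α.col c ∈ strictUpper n F := by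
  intro i j h
  refine Matrix.single_apply_of_ne _ _ _ _ _ (fun hij => ?_)
  have := α.row_lt_col
  rw [hij.1, hij.2] at this
  exact absurd h (not_le.2 this)

/-- The element of the root subgroup with a given entry. -/
def rootElt (c : F) : unitri n F := oneAdd (Matrix.single α.row α.col c) (α.single_mem_strictUpper c)

theorem mat_rootElt (c : F) : mat (α.rootElt c) = Matrix.transvection α.row α.col c := rfl

theorem rootElt_mem (c : F) : α.rootElt c ∈ α.rootSubgroup F := ⟨c, rfl⟩

theorem mat_rootElt_apply (c : F) : mat (α.rootElt c) α.row α.col = c := by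
  rw [mat_rootElt, Matrix.transvection, Matrix.add_apply, Matrix.one_apply_ne α.row_ne_col]
  simp

/-- The root at a given entry above the diagonal. -/
def ofEntry (i j : Fin n) (h : i < j) : PosRoot n :=
  ⟨i + 1, j, by omega, by rw [Fin.lt_def] at h; omega, j.2⟩

theorem mem_arm_iff {β : PosRoot n} : β ∈ α.arm ↔ β.row = α.row ∧ β.col < α.col := by
  have h1 := α.one_le
  have h2 := β.one_le
  simp only [arm, Set.mem_ofPred_eq, row, col, Fin.mk.injEq, Fin.lt_def]
  omega

variable (F) in
/-- The group of unitriangular matrices vanishing on the arm of a root. -/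
def patternGroup : Subgroup (unitri n F) where
  carrier := {g | ∀ k, α.row < k → k < α.col → mat g α.row k = 0}
  one_mem' := fun k h _ => Matrix.one_apply_ne h.ne
  mul_mem' := by
    intro g h hg hh k hk hk'
    rw [mat_mul, Matrix.mul_apply]
    refine Finset.sum_eq_zero fun l _ => ?_
    rcases lt_trichotomy l α.row with hl | rfl | hl
    · rw [mat_of_lt g hl, zero_mul]
    · rw [hh k hk hk', mul_zero]
    · rcases lt_or_ge l α.col with hl' | hl'
      · rw [hg l hl hl', zero_mul]
      · rw [mat_of_lt h (hk'.trans_le hl'), mul_zero]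
  inv_mem' := by
    intro g hg k hk hk'
    have h1 := congrFun (congrFun (mat_mul_inv g) α.row) k
    rw [Matrix.mul_apply, Matrix.one_apply_ne hk.ne, Finset.sum_eq_single α.row] at h1
    · rwa [mat_diag, one_mul] at h1
    · intro l _ hl
      rcases lt_or_gt_of_ne hl with hl | hl
      · rw [mat_of_lt g hl, zero_mul]
      · rcases lt_or_ge l α.col with hl' | hl'
        · rw [hg l hl hl', zero_mul]
        · rw [mat_of_lt _ (hk'.trans_le hl'), mul_zero]
    · simp

theorem mem_patternGroup {g : unitri n F} : g ∈ α.patternGroup F ↔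
    ∀ k, α.row < k → k < α.col → mat g α.row k = 0 := Iff.rfl

theorem rootSubgroup_le_patternGroup {β : PosRoot n} (hβ : β ∉ α.arm) :
    β.rootSubgroup F ≤ α.patternGroup F := by
  rintro g ⟨c, hc⟩ k hk hk'
  change mat g = _ at hc
  rw [hc, Matrix.transvection, Matrix.add_apply, Matrix.one_apply_ne hk.ne, zero_add]
  refine Matrix.single_apply_of_ne _ _ _ _ _ (fun h => hβ ?_)
  rw [mem_arm_iff]
  exact ⟨h.1, h.2 ▸ hk'⟩

/-- Gaussian elimination, with induction on the number of nonzero entries above the diagonal. A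
nonzero entry (i, j) is chosen in the lowest nontrivial row. Row j is then a row of the identity, so
the row operation clearing (i, j) changes no other entry. -/
theorem mem_baseGroup_of_mem_patternGroup {g : unitri n F} (hg : g ∈ α.patternGroup F) :
    g ∈ α.baseGroup F := by
  classical
  have hroot : ∀ β : PosRoot n, β ∉ α.arm → β.rootSubgroup F ≤ α.baseGroup F := fun β hβ =>
    le_iSup₂_of_le (f := fun (β : PosRoot n) (_ : β ∈ α.armᶜ) => β.rootSubgroup F) β hβ le_rfl
  induction hN : (Finset.univ.filter fun p : Fin n × Fin n => p.1 < p.2 ∧ mat g p.1 p.2 ≠ 0).card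
    using Nat.strong_induction_on generalizing g with
  | _ N ih =>
    by_cases hne : (Finset.univ.filter fun p : Fin n × Fin n =>
        p.1 < p.2 ∧ mat g p.1 p.2 ≠ 0).Nonempty
    · obtain ⟨p, hp, hmax⟩ := Finset.exists_max_image _ (fun p : Fin n × Fin n => p.1) hne
      obtain ⟨i, j⟩ := p
      simp only [Finset.mem_filter, Finset.mem_univ, true_and] at hp hmax
      have hrow : ∀ k l, i < k → mat g k l = (1 : Matrix (Fin n) (Fin n) F) k l := by
        intro k l hk
        rcases lt_trichotomy k l with h | rfl | h
        · rw [Matrix.one_apply_ne h.ne]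
          by_contra h0
          exact absurd (hmax (k, l) ⟨h, h0⟩) (not_le.2 hk)
        · simp
        · rw [mat_of_lt g h, Matrix.one_apply_ne h.ne']
      set β := ofEntry i j hp.1
      have hβ : β ∉ α.arm := by
        rw [mem_arm_iff]
        rintro ⟨h1, h2⟩
        change i = _ at h1
        change j < _ at h2
        exact hp.2 (by rw [h1]; exact hg j (h1 ▸ hp.1) h2)
      set t : unitri n F := β.rootElt (-mat g i j) with ht
      have htb : t ∈ α.baseGroup F := hroot β hβ (β.rootElt_mem _)
      have hentry : ∀ k l, mat (t * g) k l = if k = i ∧ l = j then 0 else mat g k l := by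
        intro k l
        have : mat t = Matrix.transvection i j (-mat g i j) := rfl
        rw [mat_mul, this]
        by_cases hk : k = i
        · subst hk
          rw [Matrix.transvection_mul_apply_same, hrow j l hp.1]
          by_cases hl : l = j
          · subst hl; simp
          · simp [hl, Matrix.one_apply_ne (Ne.symm hl)]
        · rw [Matrix.transvection_mul_apply_of_ne _ _ _ _ hk]
          simp [hk]
      have hmem : t * g ∈ α.patternGroup F :=
        (α.patternGroup F).mul_mem (rootSubgroup_le_patternGroup α hβ (β.rootElt_mem _)) hg
      have hlt : (Finset.univ.filter fun p : Fin n × Fin n =>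
          p.1 < p.2 ∧ mat (t * g) p.1 p.2 ≠ 0).card < N := by
        rw [← hN]
        refine Finset.card_lt_card (Finset.ssubset_iff_of_subset (fun p h => ?_) |>.2
          ⟨(i, j), by simpa using hp, by simp [hentry]⟩)
        simp only [Finset.mem_filter, Finset.mem_univ, true_and, hentry] at h ⊢
        refine ⟨h.1, fun h0 => h.2 ?_⟩
        split_ifs
        exacts [rfl, h0]
      have := ih _ hlt hmem rfl
      exact ((α.baseGroup F).mul_mem_cancel_left htb).1 this
    · rw [Finset.not_nonempty_iff_eq_empty, Finset.filter_eq_empty_iff] at hne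
      have : g = 1 := by
        apply mat_injective
        ext k l
        rcases lt_trichotomy k l with h | rfl | h
        · rw [mat_one, Matrix.one_apply_ne h.ne]
          by_contra h0
          exact hne (Finset.mem_univ (k, l)) ⟨h, h0⟩
        · simp
        · rw [mat_of_lt g h, mat_one, Matrix.one_apply_ne h.ne']
      rw [this]
      exact Subgroup.one_mem _

theorem baseGroup_eq : α.baseGroup F = α.patternGroup F :=
  le_antisymm (iSup₂_le fun _ hβ => rootSubgroup_le_patternGroup α hβ)
    fun _ hg => mem_baseGroup_of_mem_patternGroup α hg

theorem mem_baseGroup {g : unitri n F} : g ∈ α.baseGroup F ↔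
    ∀ k, α.row < k → k < α.col → mat g α.row k = 0 := by
  rw [baseGroup_eq, mem_patternGroup]

/-- The row of g vanishes on the arm, so only the two diagonal terms of the matrix product survive.
-/
theorem mat_mul_row_col {g h : unitri n F} (hg : g ∈ α.baseGroup F) :
    mat (g * h) α.row α.col = mat g α.row α.col + mat h α.row α.col := by
  rw [mem_baseGroup] at hg
  rw [mat_mul, Matrix.mul_apply, Finset.sum_eq_add α.row α.col α.row_ne_col]
  · rw [mat_diag, mat_diag, one_mul, mul_one, add_comm]
  · rintro l - ⟨h1, h2⟩
    rcases lt_or_gt_of_ne h1 with h1 | h1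
    · rw [mat_of_lt g h1, zero_mul]
    · rcases lt_or_gt_of_ne h2 with h2 | h2
      · rw [hg l h1 h2, zero_mul]
      · rw [mat_of_lt h h2, mul_zero]
  · simp
  · simp

/-- The linear character `v ↦ φ (v_{row, col})` of the base group. -/
def elemChar (φ : AddChar F ℂ) : α.baseGroup F →* ℂˣ :=
  linChar (α.baseGroup F) (fun g => mat g α.row α.col) (fun _ hg _ _ => mat_mul_row_col α hg) φ

theorem mat_eq_zero_of_mem_rootSubgroup {β : PosRoot n} (hne : β ≠ α) {g : unitri n F}
    (hg : g ∈ β.rootSubgroup F) : mat g α.row α.col = 0 := by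
  obtain ⟨c, hc⟩ := hg
  change mat g = _ at hc
  rw [hc, Matrix.transvection, Matrix.add_apply, Matrix.one_apply_ne α.row_ne_col, zero_add]
  refine Matrix.single_apply_of_ne _ _ _ _ _ (fun h => hne ?_)
  have h1 := α.one_le
  have h2 := β.one_le
  obtain ⟨h3, h4⟩ := h
  simp only [row, col, Fin.mk.injEq] at h3 h4
  exact PosRoot.ext (by omega) h4

theorem isElementary_indChar {φ : AddChar F ℂ} (hφ : φ ≠ 1) :
    α.IsElementary (indChar (α.baseGroup F) (α.elemChar φ)) := by
  obtain ⟨c, hc⟩ := AddChar.ne_one_iff.1 hφ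
  have hα : α ∉ α.arm := fun h => lt_irrefl _ h.2
  refine ⟨α.elemChar φ, ⟨⟨α.rootElt c, ?_⟩, α.rootElt_mem c, fun h => hc ?_⟩, ?_, rfl⟩
  · rw [baseGroup_eq]
    exact rootSubgroup_le_patternGroup α hα (α.rootElt_mem c)
  · have := congrArg Units.val h
    rw [elemChar, linChar_apply, mat_rootElt_apply] at this
    exact this
  · rintro β hβ hne v hv
    apply Units.ext
    rw [elemChar, linChar_apply, mat_eq_zero_of_mem_rootSubgroup α hne hv,
      AddChar.map_zero_eq_one, Units.val_one]

/-- The base group is generated by root subgroups, so a linear character trivial on all of them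
except that of α is determined by its restriction φ to that one. -/
theorem isElementary_iff {ξ : unitri n F → ℂ} : α.IsElementary ξ ↔
    ∃ φ : AddChar F ℂ, φ ≠ 1 ∧ ξ = indChar (α.baseGroup F) (α.elemChar φ) := by
  refine ⟨?_, fun ⟨φ, hφ, h⟩ => h ▸ isElementary_indChar α hφ⟩
  rintro ⟨l, ⟨v, hv, hlv⟩, htriv, rfl⟩
  have hα : α ∉ α.arm := fun h => lt_irrefl _ h.2
  have hroot : ∀ β : PosRoot n, β ∉ α.arm → β.rootSubgroup F ≤ α.baseGroup F := fun β hβ =>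
    le_iSup₂_of_le (f := fun (β : PosRoot n) (_ : β ∈ α.armᶜ) => β.rootSubgroup F) β hβ le_rfl
  let r : F → α.baseGroup F := fun c => ⟨α.rootElt c, hroot α hα (α.rootElt_mem c)⟩
  have hr : ∀ c d, r (c + d) = r c * r d := fun c d => by
    refine Subtype.ext (mat_injective ?_)
    change Matrix.transvection _ _ _ = Matrix.transvection _ _ _ * Matrix.transvection _ _ _
    rw [Matrix.transvection_mul_transvection_same _ _ α.row_ne_col]
  have hr0 : r 0 = 1 := Subtype.ext (mat_injective (by
    change Matrix.transvection _ _ _ = _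
    simp))
  let φ : AddChar F ℂ :=
    { toFun := fun c => (l (r c) : ℂ)
      map_zero_eq_one' := by rw [hr0, map_one, Units.val_one]
      map_add_eq_mul' := fun c d => by rw [hr, map_mul, Units.val_mul] }
  have hrv : ∀ w : α.baseGroup F, (w : unitri n F) ∈ α.rootSubgroup F →
      r (mat w.1 α.row α.col) = w := by
    rintro w ⟨c, hc⟩
    refine Subtype.ext (mat_injective ?_)
    change mat w.1 = _ at hc
    have : mat w.1 α.row α.col = c := by rw [hc]; exact mat_rootElt_apply α c
    rw [this, hc]
    rfl
  have hl : l = α.elemChar φ := by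
    have hle : α.baseGroup F ≤ (l.eqLocus (α.elemChar φ)).map (α.baseGroup F).subtype := by
      refine iSup₂_le fun β hβ g hg => ?_
      refine ⟨⟨g, hroot β hβ hg⟩, ?_, rfl⟩
      change l _ = α.elemChar φ _
      by_cases hβα : β = α
      · subst hβα
        apply Units.ext
        rw [elemChar, linChar_apply]
        change (l _ : ℂ) = l (r _)
        rw [hrv ⟨g, hroot β hβ hg⟩ hg]
      · rw [htriv β hβ hβα _ hg]
        apply Units.ext
        rw [elemChar, linChar_apply, mat_eq_zero_of_mem_rootSubgroup α hβα hg,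
          AddChar.map_zero_eq_one, Units.val_one]
    ext1 w
    obtain ⟨w', hw', hww⟩ := hle w.2
    have : w' = w := Subtype.ext hww
    rw [← this]
    exact hw'
  refine ⟨φ, fun h1 => hlv ?_, by rw [hl]⟩
  have := hrv v hv
  rw [← this]
  apply Units.ext
  exact AddChar.eq_one_iff.1 h1 (mat v.1 α.row α.col)

theorem index_baseGroup [Finite F] : (α.baseGroup F).index = Nat.card F ^ (α.j - α.i) := by
  classical
  rw [index_eq_pow (α.baseGroup F) (ι := {k : Fin n // α.row < k ∧ k < α.col})
    { toFun := fun M k => M α.row k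
      map_add' := fun _ _ => rfl
      map_smul' := fun _ _ => rfl }]
  · congr 1
    have h1 := α.one_le
    have h2 := α.le
    rw [Nat.card_eq_fintype_card, Fintype.card_subtype]
    have : (Finset.univ.filter fun k => α.row < k ∧ k < α.col) = Finset.Ioo α.row α.col := by
      ext; simp
    rw [this, Fin.card_Ioo]
    simp only [row, col]
    omega
  · intro g
    rw [mem_baseGroup]
    constructor
    · intro h
      ext ⟨k, hk⟩
      change (mat g - 1) α.row k = 0
      rw [Matrix.sub_apply, h k hk.1 hk.2, Matrix.one_apply_ne hk.1.ne, sub_zero]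
    · intro h k hk hk'
      have := congrFun h ⟨k, hk, hk'⟩
      change (mat g - 1) α.row k = 0 at this
      rwa [Matrix.sub_apply, Matrix.one_apply_ne hk.ne, sub_zero] at this
  · intro y
    refine ⟨Matrix.of fun i k => if h : i = α.row ∧ α.row < k ∧ k < α.col then y ⟨k, h.2⟩ else 0,
      fun i j hij => ?_, ?_⟩
    · rw [Matrix.of_apply, dif_neg]
      rintro ⟨rfl, h, -⟩
      exact absurd hij (not_le.2 h)
    · ext ⟨k, hk⟩
      change Matrix.of _ α.row k = _
      rw [Matrix.of_apply, dif_pos ⟨rfl, hk⟩]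

end PosRoot

end Unitriangular

/-! ### Corner subgroups and the trichotomy of degrees. -/

section Corner

variable {n : ℕ} {F : Type*} [Field F]

namespace unitri

/-- The block diagonal part of a unitriangular matrix, with blocks of sizes `a` and `n - a`. -/
def blockDiag (a : ℕ) : unitri n F →* unitri n F where
  toFun g := ofMat (Matrix.of fun i j => if (i : ℕ) < a ∧ a ≤ j then 0 else mat g i j)
    (fun i j h => by rw [Matrix.of_apply, mat_of_lt g h, ite_self])
    (fun i => by rw [Matrix.of_apply, if_neg (by omega), mat_diag])
  map_one' := by
    apply mat_injective
    ext i j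
    rw [mat_ofMat, Matrix.of_apply, mat_one]
    split_ifs with h
    · rw [Matrix.one_apply_ne]
      rintro rfl
      omega
    · rfl
  map_mul' g h := by
    apply mat_injective
    ext i j
    rw [mat_ofMat, Matrix.of_apply, mat_mul, mat_mul, mat_ofMat, mat_ofMat, Matrix.mul_apply,
      Matrix.mul_apply]
    simp only [Matrix.of_apply]
    split_ifs with hij
    · refine (Finset.sum_eq_zero fun k _ => ?_).symm
      rcases lt_or_ge (k : ℕ) a with hk | hk
      · rw [if_pos (show (k : ℕ) < a ∧ a ≤ j from ⟨hk, hij.2⟩), mul_zero]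
      · rw [if_pos (show (i : ℕ) < a ∧ a ≤ k from ⟨hij.1, hk⟩), zero_mul]
    · refine Finset.sum_congr rfl fun k _ => ?_
      by_cases h1 : (i : ℕ) < a ∧ a ≤ k
      · rw [mat_of_lt h (show j < k by rw [Fin.lt_def]; omega), ite_self, mul_zero, mul_zero]
      · by_cases h2 : (k : ℕ) < a ∧ a ≤ j
        · rw [mat_of_lt g (show k < i by rw [Fin.lt_def]; omega), ite_self, zero_mul, zero_mul]
        · rw [if_neg h1, if_neg h2]

theorem mat_blockDiag_apply (a : ℕ) (g : unitri n F) (i j : Fin n) :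
    mat (blockDiag a g) i j = if (i : ℕ) < a ∧ a ≤ j then 0 else mat g i j := rfl

theorem blockDiag_blockDiag (a : ℕ) (g : unitri n F) :
    blockDiag a (blockDiag a g) = blockDiag a g := by
  apply mat_injective
  ext i j
  rw [mat_blockDiag_apply, mat_blockDiag_apply]
  split_ifs <;> rfl

variable (n F) in
/-- The subgroup of matrices that differ from `1` only in the upper right corner block. -/
def corner (a : ℕ) : Subgroup (unitri n F) := (blockDiag a).ker

instance (a : ℕ) : (corner n F a).Normal := inferInstanceAs (blockDiag a).ker.Normal

variable (n F) in
/-- The matrices supported in the upper right corner block. -/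
def cornerSpace (a : ℕ) : Submodule F (Matrix (Fin n) (Fin n) F) where
  carrier := {M | ∀ i j : Fin n, ¬((i : ℕ) < a ∧ a ≤ j) → M i j = 0}
  add_mem' := fun hM hN i j h => by rw [Matrix.add_apply, hM i j h, hN i j h, add_zero]
  zero_mem' := fun _ _ _ => rfl
  smul_mem' := fun c M hM i j h => by rw [Matrix.smul_apply, hM i j h, smul_zero]

theorem mem_cornerSpace {a : ℕ} {M : Matrix (Fin n) (Fin n) F} : M ∈ cornerSpace n F a ↔
    ∀ i j : Fin n, ¬((i : ℕ) < a ∧ a ≤ j) → M i j = 0 := Iff.rfl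

theorem cornerSpace_le_strictUpper (a : ℕ) : cornerSpace n F a ≤ strictUpper n F := by
  intro M hM i j h
  refine hM i j ?_
  rw [Fin.le_def] at h
  omega

theorem mem_corner {a : ℕ} {g : unitri n F} :
    g ∈ corner n F a ↔ mat g - 1 ∈ cornerSpace n F a := by
  rw [corner, MonoidHom.mem_ker, mem_cornerSpace, ← mat_injective.eq_iff, ← Matrix.ext_iff]
  refine forall₂_congr fun i j => ?_
  rw [mat_blockDiag_apply, mat_one, Matrix.sub_apply, sub_eq_zero]
  split_ifs with h
  · rw [Matrix.one_apply_ne]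
    · simp [h]
    · rintro rfl
      omega
  · simp [h]

theorem cornerSpace_mul_eq_zero {a : ℕ} {X Y : Matrix (Fin n) (Fin n) F}
    (hX : X ∈ cornerSpace n F a) (hY : Y ∈ cornerSpace n F a) : X * Y = 0 := by
  ext i j
  rw [Matrix.mul_apply]
  refine Finset.sum_eq_zero fun k _ => ?_
  rcases lt_or_ge (k : ℕ) a with hk | hk
  · rw [hX i k (by omega), zero_mul]
  · rw [hY k j (by omega), mul_zero]

theorem mul_mem_cornerSpace {a : ℕ} {X M : Matrix (Fin n) (Fin n) F}
    (hX : ∀ i j, j < i → X i j = 0) (hM : M ∈ cornerSpace n F a) : X * M ∈ cornerSpace n F a := by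
  intro i j h
  rw [Matrix.mul_apply]
  refine Finset.sum_eq_zero fun k _ => ?_
  rcases lt_or_ge k i with hk | hk
  · rw [hX i k hk, zero_mul]
  · rw [hM k j (by rw [Fin.le_def] at hk; omega), mul_zero]

theorem mul_mem_cornerSpace' {a : ℕ} {X M : Matrix (Fin n) (Fin n) F}
    (hX : ∀ i j, j < i → X i j = 0) (hM : M ∈ cornerSpace n F a) : M * X ∈ cornerSpace n F a := by
  intro i j h
  rw [Matrix.mul_apply]
  refine Finset.sum_eq_zero fun k _ => ?_
  rcases lt_or_ge j k with hk | hk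
  · rw [hX k j hk, mul_zero]
  · rw [hM i k (by rw [Fin.le_def] at hk; omega), zero_mul]

/-- The element `1 + E` of the corner subgroup. -/
def cornerElt {a : ℕ} (E : Matrix (Fin n) (Fin n) F) (hE : E ∈ cornerSpace n F a) : corner n F a :=
  ⟨oneAdd E (cornerSpace_le_strictUpper a hE), mem_corner.2 (by simpa using hE)⟩

theorem mat_cornerElt {a : ℕ} (E : Matrix (Fin n) (Fin n) F) (hE : E ∈ cornerSpace n F a) :
    mat (cornerElt E hE : unitri n F) = 1 + E := rfl

theorem exists_eq_cornerElt {a : ℕ} (g : corner n F a) :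
    ∃ (E : Matrix (Fin n) (Fin n) F) (hE : E ∈ cornerSpace n F a), g = cornerElt E hE :=
  ⟨mat g.1 - 1, mem_corner.1 g.2, Subtype.ext (mat_injective (by rw [mat_cornerElt]; simp))⟩

theorem cornerElt_add {a : ℕ} {E E' : Matrix (Fin n) (Fin n) F} (hE : E ∈ cornerSpace n F a)
    (hE' : E' ∈ cornerSpace n F a) (h : E + E' ∈ cornerSpace n F a) :
    cornerElt (E + E') h = cornerElt E hE * cornerElt E' hE' := by
  refine Subtype.ext (mat_injective ?_)
  rw [Subgroup.coe_mul, mat_mul, mat_cornerElt, mat_cornerElt, mat_cornerElt, add_mul, mul_add,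
    mul_add, cornerSpace_mul_eq_zero hE hE', one_mul, one_mul, mul_one, add_zero, add_assoc,
    add_comm E E']

theorem corner_mul_comm {a : ℕ} : ∀ g ∈ corner n F a, ∀ h ∈ corner n F a, g * h = h * g := by
  intro g hg h hh
  apply mat_injective
  have h1 := cornerSpace_mul_eq_zero (mem_corner.1 hg) (mem_corner.1 hh)
  have h2 := cornerSpace_mul_eq_zero (mem_corner.1 hh) (mem_corner.1 hg)
  rw [mat_mul, mat_mul]
  have h3 : mat g * mat h = (mat g - 1) * (mat h - 1) + mat g + mat h - 1 := by noncomm_ring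
  have h4 : mat h * mat g = (mat h - 1) * (mat g - 1) + mat g + mat h - 1 := by noncomm_ring
  rw [h3, h4, h1, h2]

/-- Writing a corner element as 1 + xE makes its conjugate 1 + Ex, so the entries of x⁻¹ never
appear. -/
theorem conj_cornerElt {a : ℕ} (x : unitri n F) {E : Matrix (Fin n) (Fin n) F}
    (hl : mat x * E ∈ cornerSpace n F a) (hr : E * mat x ∈ cornerSpace n F a) :
    x⁻¹ * (cornerElt (mat x * E) hl : unitri n F) * x = cornerElt (E * mat x) hr := by
  have : (cornerElt (mat x * E) hl : unitri n F) * x = x * cornerElt (E * mat x) hr := by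
    apply mat_injective
    rw [mat_mul, mat_mul, mat_cornerElt, mat_cornerElt, add_mul, mul_add, one_mul, mul_one,
      mul_assoc]
  rw [mul_assoc, this, inv_mul_cancel_left]

theorem card_eq_card_corner_mul [Finite F] {a : ℕ} (S : Subgroup (unitri n F))
    (hS : corner n F a ≤ S) :
    Nat.card S = Nat.card (corner n F a) * Nat.card (S.map (blockDiag a)) := by
  have h1 := ((blockDiag a).subgroupMap S).ker.card_mul_index
  rw [Subgroup.index_ker, MonoidHom.range_eq_top.2 ((blockDiag a).subgroupMap_surjective S),
    Subgroup.card_top] at h1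
  rw [← h1]
  congr 1
  have h2 : ((blockDiag a).subgroupMap S).ker = (corner n F a).subgroupOf S := by
    ext g
    rw [MonoidHom.mem_ker, Subgroup.mem_subgroupOf, corner, MonoidHom.mem_ker]
    exact Subtype.ext_iff
  rw [h2]
  exact Nat.card_congr (Subgroup.subgroupOfEquivOfLe hS).toEquiv

theorem index_mul_card_map [Finite F] {a : ℕ} (S : Subgroup (unitri n F))
    (hS : corner n F a ≤ S) :
    S.index * Nat.card (S.map (blockDiag a)) = (corner n F a).index := by
  have h1 := card_eq_card_corner_mul S hS
  have h2 := S.card_mul_index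
  have h3 := (corner n F a).card_mul_index
  have h4 : 0 < Nat.card (corner n F a) := Nat.card_pos
  refine Nat.eq_of_mul_eq_mul_left h4 ?_
  rw [h3, ← h2, h1]
  ring

theorem index_sup_mul_card [Finite F] {a : ℕ} (B : Subgroup (unitri n F))
    (hB : ∀ g ∈ B, blockDiag a g = g) :
    (corner n F a ⊔ B).index * Nat.card B = (corner n F a).index := by
  rw [← index_mul_card_map (corner n F a ⊔ B) le_sup_left, Subgroup.map_sup, corner,
    (Subgroup.map_eq_bot_iff _).2 le_rfl, bot_sup_eq]
  congr 2
  have : B.map (blockDiag a) = B := by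
    ext g
    constructor
    · rintro ⟨b, hb, rfl⟩
      rwa [hB b hb]
    · exact fun hg => ⟨g, hg, hB g hg⟩
  rw [this]

/-- The subspace `J` such that `1 + J` is the intersection of the block diagonal subgroup with the
stabilizer of a linear character of the corner subgroup. -/
def stabSpace (a : ℕ) (l : corner n F a →* ℂ) : Submodule F (Matrix (Fin n) (Fin n) F) where
  carrier := {X | X ∈ strictUpper n F ∧ (∀ i j : Fin n, (i : ℕ) < a → a ≤ j → X i j = 0) ∧
    ∀ E, E ∈ cornerSpace n F a → ∀ (h : X * E ∈ cornerSpace n F a)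
      (h' : E * X ∈ cornerSpace n F a), l (cornerElt _ h) = l (cornerElt _ h')}
  add_mem' := by
    rintro X Y ⟨hX, hX', hX''⟩ ⟨hY, hY', hY''⟩
    refine ⟨add_mem hX hY, fun i j h h' => by rw [Matrix.add_apply, hX' i j h h', hY' i j h h',
      add_zero], fun E hE => ?_⟩
    have x1 := mul_mem_cornerSpace (fun i j h => hX i j h.le) hE
    have x2 := mul_mem_cornerSpace' (fun i j h => hX i j h.le) hE
    have y1 := mul_mem_cornerSpace (fun i j h => hY i j h.le) hE
    have y2 := mul_mem_cornerSpace' (fun i j h => hY i j h.le) hE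
    rw [add_mul, mul_add]
    intro h h'
    rw [cornerElt_add x1 y1, cornerElt_add x2 y2, map_mul, map_mul, hX'' E hE x1 x2,
      hY'' E hE y1 y2]
  zero_mem' := by
    refine ⟨zero_mem _, fun _ _ _ _ => rfl, fun E hE => ?_⟩
    rw [zero_mul, mul_zero]
    exact fun _ _ => rfl
  smul_mem' := by
    rintro c X ⟨hX, hX', hX''⟩
    refine ⟨Submodule.smul_mem _ c hX, fun i j h h' => by rw [Matrix.smul_apply, hX' i j h h',
      smul_zero], fun E hE => ?_⟩
    -- The character l need not respect scalars, so c is moved into the test matrix E, which ranges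
    -- over a vector space.
    rw [smul_mul_assoc, mul_smul_comm, ← mul_smul_comm, ← smul_mul_assoc]
    exact hX'' _ (Submodule.smul_mem _ c hE)

/-- Fixing l means l(1 + gE) = l(1 + Eg) for all E. Dividing by l(1 + E) replaces g by g - 1, and in
this form the condition is additive in g - 1. -/
theorem mem_charStabilizer_corner {a : ℕ} {l : corner n F a →* ℂ} {g : unitri n F} :
    g ∈ charStabilizer (corner n F a) l ↔
      ∀ E, E ∈ cornerSpace n F a → ∀ (h : (mat g - 1) * E ∈ cornerSpace n F a)
      (h' : E * (mat g - 1) ∈ cornerSpace n F a), l (cornerElt _ h) = l (cornerElt _ h') := by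
  have hlow : ∀ (x : unitri n F) (i j : Fin n), j < i → mat x i j = 0 := fun x i j h =>
    mat_of_lt x h
  have key : ∀ E (hE : E ∈ cornerSpace n F a) (h : (mat g - 1) * E ∈ cornerSpace n F a)
      (h' : E * (mat g - 1) ∈ cornerSpace n F a),
      (l (MulAut.conjNormal g (cornerElt (E * mat g) (mul_mem_cornerSpace' (hlow g) hE))) =
        l (cornerElt (E * mat g) (mul_mem_cornerSpace' (hlow g) hE)) ↔
        l (cornerElt _ h) = l (cornerElt _ h')) := by
    intro E hE h h'
    have e1 : MulAut.conjNormal g (cornerElt (E * mat g) (mul_mem_cornerSpace' (hlow g) hE)) =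
        cornerElt E hE * cornerElt _ h := by
      rw [← cornerElt_add hE h (add_mem hE h)]
      refine Subtype.ext ?_
      rw [MulAut.conjNormal_apply, ← conj_cornerElt g (mul_mem_cornerSpace (hlow g) hE)]
      apply mat_injective
      have : g * (g⁻¹ * (cornerElt _ (mul_mem_cornerSpace (hlow g) hE) : unitri n F) * g) * g⁻¹ =
        cornerElt _ (mul_mem_cornerSpace (hlow g) hE) := by group
      rw [this, mat_cornerElt, mat_cornerElt]
      noncomm_ring
    have e2 : cornerElt (E * mat g) (mul_mem_cornerSpace' (hlow g) hE) =
        cornerElt E hE * cornerElt _ h' := by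
      rw [← cornerElt_add hE h' (add_mem hE h')]
      refine Subtype.ext (mat_injective ?_)
      rw [mat_cornerElt, mat_cornerElt]
      noncomm_ring
    have hne : l (cornerElt E hE) ≠ 0 := fun h0 => by
      have := congrArg l (mul_inv_cancel (cornerElt E hE))
      rw [map_mul, h0, zero_mul, map_one] at this
      exact zero_ne_one this
    rw [e1, e2, map_mul, map_mul, mul_right_inj' hne]
  constructor
  · intro hg E hE h h'
    exact (key E hE h h').1 (hg _)
  · intro hg y
    obtain ⟨E, hE, rfl⟩ := exists_eq_cornerElt y
    have hE' : E * mat g⁻¹ ∈ cornerSpace n F a := mul_mem_cornerSpace' (hlow g⁻¹) hE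
    have hlow' : ∀ i j : Fin n, j < i → (mat g - 1) i j = 0 := fun i j h =>
      mat_sub_one_mem g i j h.le
    have := (key _ hE' (mul_mem_cornerSpace hlow' hE') (mul_mem_cornerSpace' hlow' hE')).2
      (hg _ hE' _ _)
    have e : E * mat g⁻¹ * mat g = E := by rw [mul_assoc, mat_inv_mul, mul_one]
    simpa only [e] using this

theorem mem_stabSpace_iff {a : ℕ} {l : corner n F a →* ℂ} {g : unitri n F} :
    mat g - 1 ∈ stabSpace a l ↔ g ∈ charStabilizer (corner n F a) l ∧ blockDiag a g = g := by
  rw [mem_charStabilizer_corner, ← mat_injective.eq_iff, ← Matrix.ext_iff]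
  constructor
  · rintro ⟨-, h1, h2⟩
    refine ⟨h2, fun i j => ?_⟩
    rw [mat_blockDiag_apply]
    split_ifs with h
    · have := h1 i j h.1 h.2
      rw [Matrix.sub_apply, Matrix.one_apply_ne (by rintro rfl; omega), sub_zero] at this
      exact this.symm
    · rfl
  · rintro ⟨h1, h2⟩
    refine ⟨mat_sub_one_mem g, fun i j hi hj => ?_, h1⟩
    have := h2 i j
    rw [mat_blockDiag_apply, if_pos ⟨hi, hj⟩] at this
    rw [Matrix.sub_apply, ← this, Matrix.one_apply_ne (by rintro rfl; omega), sub_zero]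

variable (n F) in
/-- The block diagonal part of the stabilizer of a linear character of the corner subgroup. -/
def diagStabilizer (a : ℕ) (l : corner n F a →* ℂ) : Subgroup (unitri n F) :=
  charStabilizer (corner n F a) l ⊓ (blockDiag a).eqLocus (MonoidHom.id _)

theorem mem_diagStabilizer {a : ℕ} {l : corner n F a →* ℂ} {g : unitri n F} :
    g ∈ diagStabilizer n F a l ↔ mat g - 1 ∈ stabSpace a l := mem_stabSpace_iff.symm

theorem stabSpace_le_strictUpper (a : ℕ) (l : corner n F a →* ℂ) :
    stabSpace a l ≤ strictUpper n F := fun _ h => h.1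

theorem card_diagStabilizer [Finite F] (a : ℕ) (l : corner n F a →* ℂ) :
    Nat.card (diagStabilizer n F a l) = Nat.card F ^ Module.finrank F (stabSpace a l) := by
  rw [card_eq_card_submodule _ (stabSpace a l) (stabSpace_le_strictUpper a l)
    fun _ => mem_diagStabilizer, Module.natCard_eq_pow_finrank (K := F)]

theorem corner_le_charStabilizer (a : ℕ) (l : corner n F a →* ℂ) :
    corner n F a ≤ charStabilizer (corner n F a) l := by
  intro g hg y
  congr 1
  refine Subtype.ext ?_
  rw [MulAut.conjNormal_apply, corner_mul_comm g hg y y.2, mul_inv_cancel_right]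

theorem index_charStabilizer_mul_card [Finite F] (a : ℕ) (l : corner n F a →* ℂ) :
    (charStabilizer (corner n F a) l).index * Nat.card (diagStabilizer n F a l) =
      (corner n F a).index := by
  rw [← index_mul_card_map _ (corner_le_charStabilizer a l)]
  congr 2
  have : (charStabilizer (corner n F a) l).map (blockDiag a) = diagStabilizer n F a l := by
    ext g
    constructor
    · rintro ⟨t, ht, rfl⟩
      refine ⟨?_, blockDiag_blockDiag a t⟩
      have h1 : t * (blockDiag a t)⁻¹ ∈ corner n F a := by
        rw [corner, MonoidHom.mem_ker, map_mul, map_inv, blockDiag_blockDiag, mul_inv_cancel]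
      have h2 := corner_le_charStabilizer a l h1
      have h3 := ((charStabilizer (corner n F a) l).mul_mem_cancel_left ht).1 h2
      simpa using h3
    · exact fun hg => ⟨g, hg.1, hg.2⟩
  rw [this]

/-- If the subspace has dimension at least two, then the block diagonal stabilizer contains an
abelian subgroup of order at least `q²`. -/
theorem exists_abelian_of_two_le_finrank [Finite F] {a : ℕ} (l : corner n F a →* ℂ)
    (h2 : 2 ≤ Module.finrank F (stabSpace a l)) :
    ∃ B ≤ diagStabilizer n F a l, (∀ g ∈ B, ∀ h ∈ B, g * h = h * g) ∧
      Nat.card F ^ 2 ≤ Nat.card B := by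
  set T := diagStabilizer n F a l
  have hcard := card_diagStabilizer a l
  have hF1 : 1 < Nat.card F := Finite.one_lt_card
  -- The group 1 + J is a nontrivial p-group. A nontrivial central element 1 + Z gives a Z commuting
  -- with all of J, and any X in J off the line of Z spans with it a commuting plane.
  obtain ⟨Z, hZ, hZ0, hZc⟩ : ∃ Z ∈ stabSpace a l, Z ≠ 0 ∧ ∀ X ∈ stabSpace a l, X * Z = Z * X := by
    have := Fintype.ofFinite F
    obtain ⟨p, hp⟩ := CharP.exists F
    obtain ⟨m, hpp, hm⟩ := FiniteField.card F p
    have : Fact p.Prime := ⟨hpp⟩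
    have hpg : IsPGroup p T := IsPGroup.of_card (n := m * Module.finrank F (stabSpace a l)) (by
      rw [hcard, Nat.card_eq_fintype_card, hm, pow_mul])
    have hnt : Nontrivial T := by
      rw [← Finite.one_lt_card_iff_nontrivial, hcard]
      exact Nat.one_lt_pow (by omega) hF1
    have := hpg.center_nontrivial
    obtain ⟨z, hz⟩ := exists_ne (1 : Subgroup.center T)
    refine ⟨mat (z : T).1 - 1, mem_diagStabilizer.1 (z : T).2, fun h0 => hz ?_, fun X hX => ?_⟩
    · refine Subtype.ext (Subtype.ext (mat_injective ?_))
      exact sub_eq_zero.1 h0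
    · have hXT : oneAdd X (stabSpace_le_strictUpper a l hX) ∈ T :=
        mem_diagStabilizer.2 (by simpa using hX)
      have h1 := Subgroup.mem_center_iff.1 z.2 ⟨_, hXT⟩
      have h3 := congrArg (fun t : T => mat t.1) h1
      simp only [Subgroup.coe_mul, mat_mul, mat_oneAdd] at h3
      rw [add_mul, mul_add, one_mul, mul_one, add_right_inj] at h3
      rw [mul_sub, sub_mul, h3, mul_one, one_mul]
  obtain ⟨X, hX, hXZ⟩ : ∃ X ∈ stabSpace a l, ∀ c : F, c • Z ≠ X := by
    by_contra! hcon
    have := finrank_le_one (R := F) (⟨Z, hZ⟩ : stabSpace a l) fun w => by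
      obtain ⟨c, hc⟩ := hcon w w.2
      exact ⟨c, Subtype.ext hc⟩
    omega
  have hmem : ∀ y : F × F, y.1 • X + y.2 • Z ∈ stabSpace a l := fun y =>
    add_mem (Submodule.smul_mem _ _ hX) (Submodule.smul_mem _ _ hZ)
  let e : F × F → unitri n F := fun y =>
    oneAdd (y.1 • X + y.2 • Z) (stabSpace_le_strictUpper a l (hmem y))
  have heT : ∀ y, e y ∈ T := fun y => mem_diagStabilizer.2 (by simpa [e] using hmem y)
  have hcomm : ∀ x ∈ Set.range e, ∀ y ∈ Set.range e, x * y = y * x := by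
    rintro _ ⟨x, rfl⟩ _ ⟨y, rfl⟩
    apply mat_injective
    have h1 : (x.1 • X + x.2 • Z) * (y.1 • X + y.2 • Z) =
        (y.1 • X + y.2 • Z) * (x.1 • X + x.2 • Z) := by
      simp only [mul_add, add_mul, smul_mul_smul_comm, hZc X hX, mul_comm x.1, mul_comm x.2]
      abel
    exact ((Commute.one_left _).add_left ((Commute.one_right _).add_right h1)).eq
  refine ⟨Subgroup.closure (Set.range e), (Subgroup.closure_le _).2 ?_, ?_, ?_⟩
  · rintro _ ⟨y, rfl⟩
    exact heT y
  · intro g hg h hh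
    have h1 : Subgroup.closure (Set.range e) ≤ Subgroup.centralizer (Set.range e) :=
      (Subgroup.closure_le _).2 fun x hx y hy => hcomm y hy x hx
    have h3 : Subgroup.closure (Set.range e) ≤
        Subgroup.centralizer (Subgroup.closure (Set.range e)) := by
      rw [Subgroup.centralizer_closure]
      exact h1
    exact (h3 hh g hg)
  · have hinj : Function.Injective e := by
      intro x y hxy
      have h1 := congrArg mat hxy
      simp only [e, mat_oneAdd, add_right_inj] at h1
      have h3 : (x.1 - y.1) • X = (y.2 - x.2) • Z := by
        rw [sub_smul, sub_smul, sub_eq_sub_iff_add_eq_add, h1, add_comm]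
      have h4 : x.1 = y.1 := by
        by_contra hne
        have hne' := sub_ne_zero.2 hne
        exact hXZ ((x.1 - y.1)⁻¹ * (y.2 - x.2)) (by rw [mul_smul, ← h3, inv_smul_smul₀ hne'])
      rw [h4, sub_self, zero_smul] at h3
      have h5 := (smul_eq_zero.1 h3.symm).resolve_right hZ0
      exact Prod.ext h4 (sub_eq_zero.1 h5).symm
    have := Nat.card_le_card_of_injective
      (fun y => (⟨e y, Subgroup.subset_closure ⟨y, rfl⟩⟩ : Subgroup.closure (Set.range e)))
      fun x y h => hinj (congrArg Subtype.val h)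
    rwa [Nat.card_prod, ← pow_two] at this

/-- All elements have the form 1 + cv with one fixed matrix v. -/
theorem diagStabilizer_comm_of_finrank_le_one {a : ℕ} [Finite F] (l : corner n F a →* ℂ)
    (h1 : Module.finrank F (stabSpace a l) ≤ 1) :
    ∀ g ∈ diagStabilizer n F a l, ∀ h ∈ diagStabilizer n F a l, g * h = h * g := by
  intro g hg h hh
  obtain ⟨v, hv⟩ := finrank_le_one_iff.1 h1
  obtain ⟨c, hc⟩ := hv ⟨_, mem_diagStabilizer.1 hg⟩
  obtain ⟨d, hd⟩ := hv ⟨_, mem_diagStabilizer.1 hh⟩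
  have hc' : mat g = 1 + c • (v : Matrix (Fin n) (Fin n) F) := by
    rw [← Submodule.coe_smul, hc]; simp
  have hd' : mat h = 1 + d • (v : Matrix (Fin n) (Fin n) F) := by
    rw [← Submodule.coe_smul, hd]; simp
  apply mat_injective
  have hcomm : Commute (c • (v : Matrix (Fin n) (Fin n) F)) (d • (v : Matrix (Fin n) (Fin n) F)) :=
    ((Commute.refl _).smul_left c).smul_right d
  rw [mat_mul, mat_mul, hc', hd']
  exact ((Commute.one_left _).add_left ((Commute.one_right _).add_right hcomm)).eq

/-- The degrees of the irreducible characters of the unitriangular group near the index of a corner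
subgroup. -/
theorem degree_trichotomy [Finite F] (a : ℕ) {χ : unitri n F → ℂ} (hχ : χ ∈ irr (unitri n F))
    {d : ℕ} (hd : χ 1 = d) : d = (corner n F a).index ∨ d * Nat.card F = (corner n F a).index ∨
      d * Nat.card F ^ 2 ≤ (corner n F a).index := by
  obtain ⟨l, h1, h2⟩ := exists_charStabilizer_index_le hχ hd (corner n F a) corner_mul_comm
  by_cases hJ : 2 ≤ Module.finrank F (stabSpace a l)
  · obtain ⟨B, hB, hBc, hBcard⟩ := exists_abelian_of_two_le_finrank l hJ
    have h3 := h2 B (hB.trans inf_le_left) hBc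
    rw [← index_sup_mul_card B fun g hg => (hB hg).2]
    exact Or.inr (Or.inr (Nat.mul_le_mul h3 hBcard))
  -- Here the whole diagonal part of the stabilizer can serve as the abelian subgroup, so the upper
  -- and lower bounds for d coincide.
  · have h3 := h2 _ inf_le_left (diagStabilizer_comm_of_finrank_le_one l (by omega))
    have h4 := index_sup_mul_card (a := a) (diagStabilizer n F a l) fun g hg => hg.2
    have h5 := index_charStabilizer_mul_card a l
    have hpos : 0 < Nat.card (diagStabilizer n F a l) := Nat.card_pos
    have h6 : (corner n F a ⊔ diagStabilizer n F a l).index =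
        (charStabilizer (corner n F a) l).index :=
      Nat.eq_of_mul_eq_mul_right hpos (h4.trans h5.symm)
    have h7 : d = (charStabilizer (corner n F a) l).index := le_antisymm (h3.trans h6.le) h1
    rw [← h7, card_diagStabilizer] at h5
    have h8 : Module.finrank F (stabSpace a l) = 0 ∨ Module.finrank F (stabSpace a l) = 1 := by
      omega
    rcases h8 with h8 | h8
    · left
      rwa [h8, pow_zero, mul_one] at h5
    · right; left
      rwa [h8, pow_one] at h5

end unitri

end Corner

/-! ### The three highest degrees of the unitriangular group. -/

section Degrees

variable {n : ℕ} {F : Type*} [Field F]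

theorem card_filter_lt_not_corner {n a : ℕ} (ha : a ≤ n) :
    (Finset.univ.filter fun p : Fin n × Fin n =>
      p.1 < p.2 ∧ ¬((p.1 : ℕ) < a ∧ a ≤ p.2)).card =
      ∑ j ∈ Finset.range a, j + ∑ j ∈ Finset.range (n - a), j := by
  rw [Finset.card_filter, ← Finset.univ_product_univ, Finset.sum_product_right]
  have h1 : ∀ j : Fin n, (∑ i : Fin n, if i < j ∧ ¬((i : ℕ) < a ∧ a ≤ j) then 1 else 0) =
      if (j : ℕ) < a then (j : ℕ) else j - a := by
    intro j
    rw [← Finset.card_filter]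
    split_ifs with hj
    · have : (Finset.univ.filter fun i : Fin n => i < j ∧ ¬((i : ℕ) < a ∧ a ≤ j)) =
          Finset.Iio j := by
        ext i
        simp only [Finset.mem_filter, Finset.mem_univ, true_and, Finset.mem_Iio]
        omega
      rw [this, Fin.card_Iio]
    · have : (Finset.univ.filter fun i : Fin n => i < j ∧ ¬((i : ℕ) < a ∧ a ≤ j)) =
          Finset.Ico ⟨a, by omega⟩ j := by
        ext i
        simp only [Finset.mem_filter, Finset.mem_univ, true_and, Finset.mem_Ico, Fin.le_def,
          Fin.lt_def]
        omega
      rw [this, Fin.card_Ico]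
  simp only [h1]
  rw [Fin.sum_univ_eq_sum_range fun j => if j < a then j else j - a]
  obtain ⟨b, rfl⟩ := Nat.exists_eq_add_of_le ha
  rw [Finset.sum_range_add, Nat.add_sub_cancel_left]
  congr 1
  · exact Finset.sum_congr rfl fun j hj => if_pos (Finset.mem_range.1 hj)
  · exact Finset.sum_congr rfl fun j _ => by rw [if_neg (by omega), Nat.add_sub_cancel_left]

theorem muExp_eq_sum (n : ℕ) : muExp n =
    ∑ j ∈ Finset.range (n / 2), j + ∑ j ∈ Finset.range (n - n / 2), j := by
  have h1 := Finset.sum_range_id_mul_two (n / 2)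
  have h2 := Finset.sum_range_id_mul_two (n - n / 2)
  rw [muExp]
  rcases Nat.even_or_odd' n with ⟨m, rfl | rfl⟩
  · rw [if_pos (even_two_mul m)]
    have e : 2 * m / 2 = m := by omega
    have e' : 2 * m - m = m := by omega
    rw [e] at h1 h2 ⊢
    rw [e'] at h2 ⊢
    omega
  · rw [if_neg (by simp)]
    have e : (2 * m + 1) / 2 = m := by omega
    have e' : 2 * m + 1 - m = m + 1 := by omega
    rw [e] at h1 h2 ⊢
    rw [e'] at h2 ⊢
    rw [Nat.add_sub_cancel] at h2
    rcases m with _ | m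
    · simp
    · rw [Nat.add_sub_cancel] at h1
      nlinarith

theorem muExp_add_two (n : ℕ) : muExp (n + 2) = n + muExp n := by
  rw [muExp, muExp]
  rcases Nat.even_or_odd' n with ⟨m, rfl | rfl⟩
  · have e : (2 * m + 2) / 2 = m + 1 := by omega
    have e' : 2 * m / 2 = m := by omega
    rw [if_pos (by simp [Nat.even_add]), if_pos (even_two_mul m), e, e', Nat.add_sub_cancel]
    rcases m with _ | m
    · rfl
    · rw [Nat.add_sub_cancel]; ring
  · have e : (2 * m + 1 + 2) / 2 = m + 1 := by omega
    have e' : (2 * m + 1) / 2 = m := by omega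
    rw [if_neg (by simp [Nat.even_add]), if_neg (by simp), e, e']
    ring

namespace unitri

theorem index_corner [Finite F] {a : ℕ} (ha : a ≤ n) : (corner n F a).index =
    Nat.card F ^ (∑ j ∈ Finset.range a, j + ∑ j ∈ Finset.range (n - a), j) := by
  classical
  rw [index_eq_pow (corner n F a)
    (ι := {p : Fin n × Fin n // p.1 < p.2 ∧ ¬((p.1 : ℕ) < a ∧ a ≤ p.2)})
    { toFun := fun M p => M p.1.1 p.1.2
      map_add' := fun _ _ => rfl
      map_smul' := fun _ _ => rfl }]
  · rw [Nat.card_eq_fintype_card (α := {p : Fin n × Fin n // _}), Fintype.card_subtype,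
      card_filter_lt_not_corner ha]
  · intro g
    rw [mem_corner]
    constructor
    · intro h
      ext ⟨p, hp⟩
      exact h p.1 p.2 hp.2
    · intro h i j hij
      rcases lt_or_ge i j with hlt | hle
      · exact congrFun h ⟨(i, j), hlt, hij⟩
      · exact mat_sub_one_mem g i j hle
  · intro y
    refine ⟨Matrix.of fun i j => if h : i < j ∧ ¬((i : ℕ) < a ∧ a ≤ j) then y ⟨(i, j), h⟩ else 0,
      fun i j hij => ?_, ?_⟩
    · rw [Matrix.of_apply, dif_neg]
      rintro ⟨h, -⟩
      exact absurd hij (not_le.2 h)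
    · ext ⟨p, hp⟩
      change Matrix.of _ p.1 p.2 = _
      rw [Matrix.of_apply, dif_pos hp]

theorem degree_trichotomy_muExp [Finite F] {χ : unitri n F → ℂ} (hχ : χ ∈ irr (unitri n F))
    {d : ℕ} (hd : χ 1 = d) : d = Nat.card F ^ muExp n ∨ d * Nat.card F = Nat.card F ^ muExp n ∨
      d * Nat.card F ^ 2 ≤ Nat.card F ^ muExp n := by
  rw [muExp_eq_sum, ← index_corner (n := n) (F := F) (Nat.div_le_self n 2)]
  exact degree_trichotomy (n / 2) hχ hd

theorem mat_blockHom_apply {k m : ℕ} (h : k + m ≤ n) (g : unitri n F) (i j : Fin m) :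
    mat (blockHom k m n h F g) i j = mat g ⟨k + i, by omega⟩ ⟨k + j, by omega⟩ := rfl

/-- The block diagonal matrix with `u` as its block in rows and columns `k, …, k + m - 1`, and `1`
elsewhere. -/
def blockEmb (k m n : ℕ) (u : unitri m F) : unitri n F :=
  ofMat (Matrix.of fun i j => if h : (k ≤ i ∧ (i : ℕ) < k + m) ∧ (k ≤ j ∧ (j : ℕ) < k + m) then
      mat u ⟨i - k, by omega⟩ ⟨j - k, by omega⟩ else (1 : Matrix (Fin n) (Fin n) F) i j)
    (fun i j hij => by
      rw [Matrix.of_apply]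
      split_ifs with h
      · exact mat_of_lt u (by simp only [Fin.lt_def] at hij ⊢; omega)
      · exact Matrix.one_apply_ne hij.ne')
    (fun i => by
      rw [Matrix.of_apply]
      split_ifs with h
      · exact mat_diag u _
      · exact Matrix.one_apply_eq i)

theorem mat_blockEmb_of_not {k m : ℕ} (u : unitri m F) {i j : Fin n}
    (h : ¬((k ≤ i ∧ (i : ℕ) < k + m) ∧ (k ≤ j ∧ (j : ℕ) < k + m))) :
    mat (blockEmb k m n u) i j = (1 : Matrix (Fin n) (Fin n) F) i j := dif_neg h

theorem blockHom_blockEmb {k m : ℕ} (h : k + m ≤ n) (u : unitri m F) :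
    blockHom k m n h F (blockEmb k m n u) = u := by
  apply mat_injective
  ext i j
  rw [mat_blockHom_apply]
  refine (dif_pos (by simp)).trans ?_
  congr 1 <;> simp

theorem blockHom_surjective {k m : ℕ} (h : k + m ≤ n) :
    Function.Surjective (blockHom k m n h F) := fun u => ⟨_, blockHom_blockEmb h u⟩

end unitri

open unitri

theorem isRepChar_inflate {k m : ℕ} (h : k + m ≤ n) {θ : unitri m F → ℂ} (hθ : IsRepChar θ) :
    IsRepChar (inflate k m n h F θ) := hθ.comp (blockHom k m n h F)

theorem inflate_mul_of_mem_corner {k m a : ℕ} (h : k + m ≤ n) (ha : k + m ≤ a)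
    (θ : unitri m F → ℂ) {x : unitri n F} (hx : x ∈ corner n F a) (g : unitri n F) :
    inflate k m n h F θ (x * g) = inflate k m n h F θ g := by
  have h1 : blockHom k m n h F x = 1 := by
    apply mat_injective
    ext i j
    rw [mem_corner] at hx
    have h2 := hx ⟨k + i, by omega⟩ ⟨k + j, by omega⟩ (by simp only; omega)
    rw [Matrix.sub_apply, sub_eq_zero] at h2
    rw [mat_blockHom_apply, h2, mat_one, Matrix.one_apply, Matrix.one_apply]
    simp [Fin.ext_iff]
  change θ _ = θ _
  rw [map_mul, h1, one_mul]

theorem one_mem_irr (G : Type*) [Group G] [Finite G] : (fun _ => 1 : G → ℂ) ∈ irr G := by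
  have := Fintype.ofFinite G
  refine IsRepChar.mem_irr_of_charInner_self ⟨1, 1, ?_⟩ ?_
  · ext g
    simp [Representation.character]
  · simp [charInner_eq_sum]

theorem inflate_mem_irr [Finite F] {k m : ℕ} (h : k + m ≤ n) {θ : unitri m F → ℂ}
    (hθ : θ ∈ irr (unitri m F)) : inflate k m n h F θ ∈ irr (unitri n F) := by
  classical
  have := Fintype.ofFinite (unitri n F)
  have := Fintype.ofFinite (unitri m F)
  refine (isRepChar_inflate h (isRepChar_of_mem_irr hθ)).mem_irr_of_charInner_self ?_
  have h1 := sum_comp_surjective (blockHom k m n h F) (blockHom_surjective h)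
    fun y => θ y * conj (θ y)
  have h2 := charInner_irr hθ hθ
  rw [if_pos rfl, charInner_eq_sum, inv_mul_eq_iff_eq_mul₀ (by simp), mul_one] at h2
  rw [h2, mul_comm] at h1
  rw [charInner_eq_sum, inv_mul_eq_iff_eq_mul₀ (by simp), mul_one]
  exact mul_right_cancel₀ (by simp) h1

theorem exists_addChar_ne_one [Finite F] : ∃ φ : AddChar F ℂ, φ ≠ 1 := by
  obtain ⟨φ, hφ⟩ := AddChar.exists_apply_ne_zero.2 (one_ne_zero (α := F))
  exact ⟨φ, fun h => hφ (by rw [h]; rfl)⟩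

/-- Multiplying by an elementary character at the highest root raises degrees from
`unitri m F` to `unitri (m + 2) F` by the factor `q ^ m`. -/
theorem exists_irr_add_two [Finite F] {m : ℕ} {θ : unitri m F → ℂ} (hθ : θ ∈ irr (unitri m F)) :
    ∃ ψ ∈ irr (unitri (m + 2) F), ψ 1 = (Nat.card F : ℂ) ^ m * θ 1 := by
  classical
  have := Fintype.ofFinite (unitri m F)
  have hm : 1 + m ≤ m + 2 := by omega
  obtain ⟨φ, hφ⟩ := exists_addChar_ne_one (F := F)
  let α : PosRoot (m + 2) := ⟨1, m + 1, le_rfl, by omega, by omega⟩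
  have hrow : (α.row : ℕ) = 0 := rfl
  have hcol : (α.col : ℕ) = m + 1 := rfl
  set θ' := inflate 1 m (m + 2) hm F θ with hθ'
  have hR : IsRepChar (indChar (α.baseGroup F) (α.elemChar φ) * θ') :=
    (isRepChar_indChar _ _).mul (isRepChar_inflate hm (isRepChar_of_mem_irr hθ))
  have hcl : ∀ x g, θ' (x⁻¹ * g * x) = θ' g :=
    (isRepChar_inflate hm (isRepChar_of_mem_irr hθ)).conj_eq
  have hcorner : corner (m + 2) F (m + 1) ≤ α.baseGroup F := by
    intro g hg
    rw [PosRoot.mem_baseGroup]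
    intro k hk hk'
    rw [mem_corner] at hg
    have := hg α.row k (by rw [Fin.lt_def, hcol] at hk'; omega)
    rwa [Matrix.sub_apply, Matrix.one_apply_ne hk.ne, sub_zero] at this
  have hinv : ∀ a ∈ corner (m + 2) F (m + 1), ∀ g, θ' (a * g) = θ' g := fun a ha =>
    inflate_mul_of_mem_corner hm (by omega) θ ha
  refine ⟨_, hR.mem_irr_of_charInner_self ?_, ?_⟩
  · rw [charInner_indChar_mul (α.elemChar φ) (α.elemChar φ) hcl hcl ?_
      ((blockHom 1 m (m + 2) hm F).comp (α.baseGroup F).subtype) ?_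
      (fun y => θ y * conj (θ y)) ?_]
    · rw [← charInner_eq_sum, charInner_irr hθ hθ, if_pos rfl]
    · intro x hx
      rw [PosRoot.mem_baseGroup] at hx
      push Not at hx
      obtain ⟨k, hk, hk', hxk⟩ := hx
      obtain ⟨c, hc⟩ := AddChar.ne_one_iff.1 hφ
      have hkc : (k : ℕ) < m + 1 := by rw [Fin.lt_def, hcol] at hk'; exact hk'
      -- The test matrix E is supported at row k of the last column and scaled so that xE has the
      -- entry c in the upper right corner. Ex has the entry 0 there because k is not the first row.
      have hE : Matrix.single k α.col ((mat x α.row k)⁻¹ * c) ∈ cornerSpace (m + 2) F (m + 1) := by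
        intro i j hij
        refine Matrix.single_apply_of_ne _ _ _ _ _ fun h => hij ?_
        rw [← h.1, ← h.2]
        exact ⟨hkc, le_rfl⟩
      have hl := mul_mem_cornerSpace (X := mat x) (fun _ _ h => mat_of_lt x h) hE
      have hr := mul_mem_cornerSpace' (X := mat x) (fun _ _ h => mat_of_lt x h) hE
      have hconj := conj_cornerElt x hl hr
      refine ⟨cornerElt _ hl, ?_, hcorner (cornerElt _ hl).2, ?_, hinv _ (cornerElt _ hl).2, ?_⟩
      · rw [hconj]; exact hcorner (cornerElt _ hr).2
      · rw [hconj]; exact hinv _ (cornerElt _ hr).2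
      · rw [hconj, PosRoot.elemChar, zeroExt_linChar _ _ _ _ (hcorner (cornerElt _ hr).2),
          zeroExt_linChar _ _ _ _ (hcorner (cornerElt _ hl).2), mat_cornerElt, mat_cornerElt,
          Matrix.add_apply, Matrix.add_apply, Matrix.one_apply_ne α.row_ne_col, zero_add, zero_add,
          Matrix.single_mul_apply_of_ne _ _ _ _ _ hk.ne, Matrix.mul_single_apply_same,
          mul_inv_cancel_left₀ hxk, AddChar.map_zero_eq_one]
        exact fun h => hc h.symm
    · intro u
      refine ⟨⟨blockEmb 1 m (m + 2) u, ?_⟩, blockHom_blockEmb hm u⟩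
      rw [PosRoot.mem_baseGroup]
      intro k hk _
      rw [mat_blockEmb_of_not _ (by rw [hrow]; omega), Matrix.one_apply_ne hk.ne]
    · intro v
      have h1 := (isPartialChar_zeroExt _ (α.elemChar φ)).mul_conj
        ((zeroExt_ne_zero_iff (α.elemChar φ)).2 v.2)
      rw [zeroExt_of_mem _ v.2] at h1
      rw [map_mul, mul_mul_mul_comm]
      refine (congrArg (· * _) h1).trans (one_mul _)
  · rw [Pi.mul_apply, indChar_one, PosRoot.index_baseGroup]
    have : θ' 1 = θ 1 := congrArg θ (map_one _)
    rw [this]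
    push_cast
    rfl

theorem exists_irr_max_degree (F : Type*) [Field F] [Finite F] (n : ℕ) :
    ∃ χ ∈ irr (unitri n F), χ 1 = (Nat.card F : ℂ) ^ muExp n := by
  induction n using Nat.twoStepInduction with
  | zero => exact ⟨_, one_mem_irr _, by simp [muExp]⟩
  | one => exact ⟨_, one_mem_irr _, by simp [muExp]⟩
  | more n ih _ =>
    obtain ⟨χ, hχ, h1⟩ := ih
    obtain ⟨ψ, hψ, h2⟩ := exists_irr_add_two hχ
    exact ⟨ψ, hψ, by rw [h2, h1, muExp_add_two, pow_add]⟩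

/-- The recursion starts at size 3, where the trivial character has degree q^{1-1}, and at size 4,
where a character of degree q of `unitri 3 F` is inflated and μ(4) = 2. -/
theorem exists_irr_second_degree (F : Type*) [Field F] [Finite F] (n : ℕ) :
    ∃ χ ∈ irr (unitri (n + 3) F), χ 1 = (Nat.card F : ℂ) ^ (muExp (n + 3) - 1) := by
  induction n using Nat.twoStepInduction with
  | zero => exact ⟨_, one_mem_irr _, by simp [muExp, Nat.even_iff]⟩
  | one =>
    obtain ⟨χ, hχ, h1⟩ := exists_irr_max_degree F 3
    refine ⟨_, inflate_mem_irr (n := 4) (k := 0) (by omega) hχ, ?_⟩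
    have : inflate 0 3 4 (by omega) F χ 1 = χ 1 := congrArg χ (map_one _)
    rw [this, h1]
    simp [muExp, Nat.even_iff]
  | more n ih _ =>
    obtain ⟨χ, hχ, h1⟩ := ih
    obtain ⟨ψ, hψ, h2⟩ := exists_irr_add_two hχ
    refine ⟨ψ, hψ, ?_⟩
    have h3 : 1 ≤ muExp (n + 3) := by
      have : muExp (n + 3) = n + 1 + muExp (n + 1) := muExp_add_two (n + 1)
      omega
    have h4 := muExp_add_two (n + 3)
    rw [h2, h1, ← pow_add]
    congr 1
    rw [show n + 2 + 3 = n + 3 + 2 by ring, h4]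
    omega

theorem irrDegrees_le [Finite F] {e : ℕ} (he : e ∈ irrDegrees (unitri n F)) :
    e ≤ Nat.card F ^ muExp n := by
  obtain ⟨χ, hχ, h1⟩ := he
  have hF : 1 ≤ Nat.card F := Finite.one_lt_card.le
  rcases degree_trichotomy_muExp hχ h1 with h | h | h
  · exact h.le
  · rw [← h]; exact Nat.le_mul_of_pos_right _ hF
  · exact (Nat.le_mul_of_pos_right _ (Nat.pow_pos hF)).trans h

theorem isKthHighestDegree_one_iff [Finite F] {θ : unitri n F → ℂ} : IsKthHighestDegree 1 θ ↔
    θ ∈ irr (unitri n F) ∧ θ 1 = (Nat.card F : ℂ) ^ muExp n := by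
  -- Finiteness matters because `ncard` is also 0 on infinite sets.
  have hfin : ∀ d, {e | e ∈ irrDegrees (unitri n F) ∧ d < e}.Finite := fun d =>
    (Set.finite_Iic (Nat.card F ^ muExp n)).subset fun e he => irrDegrees_le he.1
  obtain ⟨χ, hχ, h1⟩ := exists_irr_max_degree F n
  have hmem : Nat.card F ^ muExp n ∈ irrDegrees (unitri n F) := ⟨χ, hχ, by rw [h1]; push_cast; rfl⟩
  refine and_congr_right fun hθ => ⟨?_, ?_⟩
  · rintro ⟨d, hd, hcard⟩
    have h2 : {e | e ∈ irrDegrees (unitri n F) ∧ d < e} = ∅ :=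
      (Set.ncard_eq_zero (hfin d)).1 (by omega)
    have h3 : Nat.card F ^ muExp n ≤ d := by
      by_contra hlt
      have : Nat.card F ^ muExp n ∈ {e | e ∈ irrDegrees (unitri n F) ∧ d < e} :=
        ⟨hmem, not_le.1 hlt⟩
      rw [h2] at this
      exact this
    rw [hd, le_antisymm (irrDegrees_le ⟨θ, hθ, hd⟩) h3]
    push_cast
    rfl
  · intro h2
    refine ⟨Nat.card F ^ muExp n, by rw [h2]; push_cast; rfl, ?_⟩
    have : {e | e ∈ irrDegrees (unitri n F) ∧ Nat.card F ^ muExp n < e} = ∅ :=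
      Set.eq_empty_of_forall_notMem fun e he => absurd (irrDegrees_le he.1) (not_le.2 he.2)
    rw [this, Set.ncard_empty]

theorem isKthHighestDegree_three [Finite F] (hn : 4 ≤ n) {ψ : unitri n F → ℂ}
    (hψ : ψ ∈ irr (unitri n F)) (h : ψ 1 = (Nat.card F : ℂ) ^ (muExp n - 2)) :
    IsKthHighestDegree 3 ψ := by
  have hF : 1 < Nat.card F := Finite.one_lt_card
  obtain ⟨m, rfl⟩ : ∃ m, n = m + 3 := ⟨n - 3, by omega⟩
  -- This makes the subtraction of 2 in the exponent a genuine one.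
  have hmu : 2 ≤ muExp (m + 3) := by
    have : muExp (m + 3) = m + 1 + muExp (m + 1) := muExp_add_two (m + 1)
    omega
  obtain ⟨χ₁, hχ₁, h1⟩ := exists_irr_max_degree F (m + 3)
  obtain ⟨χ₂, hχ₂, h2⟩ := exists_irr_second_degree F m
  obtain ⟨k, hk⟩ := Nat.exists_eq_add_of_le hmu
  rw [hk] at h h1 h2
  rw [Nat.add_sub_cancel_left] at h
  rw [show 2 + k - 1 = k + 1 by omega] at h2
  refine ⟨hψ, Nat.card F ^ k, by rw [h]; push_cast; rfl, ?_⟩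
  have hset : {e | e ∈ irrDegrees (unitri (m + 3) F) ∧ Nat.card F ^ k < e} =
      {Nat.card F ^ (k + 1), Nat.card F ^ (2 + k)} := by
    ext e
    simp only [Set.mem_ofPred_eq, Set.mem_insert_iff, Set.mem_singleton_iff]
    constructor
    · rintro ⟨⟨χ, hχ, he⟩, hlt⟩
      have hpos : 0 < Nat.card F ^ 2 := Nat.pow_pos (by omega)
      rcases degree_trichotomy_muExp hχ he with h3 | h3 | h3
      · right; rw [h3, hk]
      · left
        rw [hk] at h3
        refine Nat.eq_of_mul_eq_mul_right (show 0 < Nat.card F by omega) (h3.trans ?_)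
        ring
      · rw [hk, pow_add, mul_comm] at h3
        exact absurd (Nat.le_of_mul_le_mul_left h3 hpos) (not_le.2 hlt)
    · rintro (rfl | rfl)
      · exact ⟨⟨χ₂, hχ₂, by rw [h2]; push_cast; rfl⟩, Nat.pow_lt_pow_right hF (by omega)⟩
      · exact ⟨⟨χ₁, hχ₁, by rw [h1]; push_cast; rfl⟩, Nat.pow_lt_pow_right hF (by omega)⟩
  rw [hset, Set.ncard_pair (Nat.pow_lt_pow_right hF (by omega)).ne]

end Degrees

/-! ### The stabilizer of the three-root character and its linear extensions. -/

section ThreeRoots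

open unitri

variable {n : ℕ} {F : Type*} [Field F]

/-- The first three indices. -/
def topIdx (hn : 6 ≤ n) (i : Fin 3) : Fin n := ⟨i, by omega⟩

/-- The last three indices. -/
def botIdx (hn : 6 ≤ n) (i : Fin 3) : Fin n := ⟨n - 3 + i, by omega⟩

section Indices

variable (hn : 6 ≤ n)

theorem topIdx_inj {i j : Fin 3} : topIdx hn i = topIdx hn j ↔ i = j := by
  simp only [topIdx, Fin.ext_iff]

theorem botIdx_inj {i j : Fin 3} : botIdx hn i = botIdx hn j ↔ i = j := by
  simp only [botIdx, Fin.ext_iff]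
  omega

theorem topIdx_lt_botIdx (i j : Fin 3) : topIdx hn i < botIdx hn j := by
  simp only [topIdx, botIdx, Fin.lt_def]
  omega

theorem topIdx_ne_botIdx (i j : Fin 3) : topIdx hn i ≠ botIdx hn j := (topIdx_lt_botIdx hn i j).ne

theorem topIdx_lt_topIdx {i j : Fin 3} : topIdx hn i < topIdx hn j ↔ i < j := by
  simp only [topIdx, Fin.lt_def]

theorem botIdx_lt_botIdx {i j : Fin 3} : botIdx hn i < botIdx hn j ↔ i < j := by
  simp only [botIdx, Fin.lt_def]
  omega

theorem sum_eq_top_add_bot (f : Fin n → F)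
    (hf : ∀ k : Fin n, 3 ≤ (k : ℕ) → (k : ℕ) < n - 3 → f k = 0) :
    ∑ k, f k = f (topIdx hn 0) + f (topIdx hn 1) + f (topIdx hn 2) +
      (f (botIdx hn 0) + f (botIdx hn 1) + f (botIdx hn 2)) := by
  classical
  have h1 : ∑ k ∈ Finset.univ.image (Sum.elim (topIdx hn) (botIdx hn)), f k = ∑ k, f k := by
    refine Finset.sum_subset (Finset.subset_univ _) fun k _ hk => hf k ?_ ?_
    · by_contra hlt
      exact hk (Finset.mem_image.2 ⟨Sum.inl ⟨k, by omega⟩, Finset.mem_univ _, rfl⟩)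
    · by_contra hlt
      refine hk (Finset.mem_image.2 ⟨Sum.inr ⟨k - (n - 3), by omega⟩, Finset.mem_univ _, ?_⟩)
      simp only [Sum.elim_inr, botIdx, Fin.ext_iff]
      omega
  rw [← h1, Finset.sum_image, Fintype.sum_sum_type, Fin.sum_univ_three, Fin.sum_univ_three]
  · rfl
  · rintro (i | i) - (j | j) - hij
    · exact congrArg Sum.inl ((topIdx_inj hn).1 hij)
    · exact absurd hij (topIdx_ne_botIdx hn i j)
    · exact absurd hij.symm (topIdx_ne_botIdx hn j i)
    · exact congrArg Sum.inr ((botIdx_inj hn).1 hij)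

theorem mat_bot_top (g : unitri n F) (i j : Fin 3) : mat g (botIdx hn i) (topIdx hn j) = 0 :=
  mat_of_lt g (topIdx_lt_botIdx hn j i)

theorem mat_top_of_lt (g : unitri n F) {i j : Fin 3} (h : j < i) :
    mat g (topIdx hn i) (topIdx hn j) = 0 :=
  mat_of_lt g ((topIdx_lt_topIdx hn).2 h)

theorem mat_bot_of_lt (g : unitri n F) {i j : Fin 3} (h : j < i) :
    mat g (botIdx hn i) (botIdx hn j) = 0 :=
  mat_of_lt g ((botIdx_lt_botIdx hn).2 h)

end Indices

/-- The conditions on a matrix to stabilize the linear character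
`1 + E ↦ φ (a E_{2,n-2} + b E_{1,n-1} + c E_{3,n})` of a corner subgroup. -/
structure IsStabMat (hn : 6 ≤ n) (a b c : F) (M : Matrix (Fin n) (Fin n) F) : Prop where
  mid : ∀ i : Fin 3, ∀ k : Fin n, 3 ≤ (k : ℕ) → (k : ℕ) < n - 3 → M (topIdx hn i) k = 0
  top : M (topIdx hn 0) (topIdx hn 1) = 0
  bot : M (botIdx hn 0) (botIdx hn 1) = 0
  rel₀ : a * M (topIdx hn 1) (topIdx hn 2) = c * M (botIdx hn 0) (botIdx hn 2)
  rel₁ : b * M (topIdx hn 0) (topIdx hn 2) = c * M (botIdx hn 1) (botIdx hn 2)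

namespace IsStabMat

variable {hn : 6 ≤ n} {a b c : F} {g h : unitri n F}

/-- The first three rows of g vanish on the middle columns, so only the six extreme indices
contribute to the product. -/
theorem mat_mul_top (hg : IsStabMat hn a b c (mat g)) (i : Fin 3) (k : Fin n) :
    mat (g * h) (topIdx hn i) k =
      mat g (topIdx hn i) (topIdx hn 0) * mat h (topIdx hn 0) k +
      mat g (topIdx hn i) (topIdx hn 1) * mat h (topIdx hn 1) k +
      mat g (topIdx hn i) (topIdx hn 2) * mat h (topIdx hn 2) k +
      (mat g (topIdx hn i) (botIdx hn 0) * mat h (botIdx hn 0) k +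
      mat g (topIdx hn i) (botIdx hn 1) * mat h (botIdx hn 1) k +
      mat g (topIdx hn i) (botIdx hn 2) * mat h (botIdx hn 2) k) := by
  rw [mat_mul, Matrix.mul_apply, sum_eq_top_add_bot hn]
  intro l h1 h2
  rw [hg.mid i l h1 h2, zero_mul]

theorem _root_.unitri.mat_mul_bot (hn : 6 ≤ n) (g h : unitri n F) (i j : Fin 3) :
    mat (g * h) (botIdx hn i) (botIdx hn j) =
      mat g (botIdx hn i) (botIdx hn 0) * mat h (botIdx hn 0) (botIdx hn j) +
      mat g (botIdx hn i) (botIdx hn 1) * mat h (botIdx hn 1) (botIdx hn j) +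
      mat g (botIdx hn i) (botIdx hn 2) * mat h (botIdx hn 2) (botIdx hn j) := by
  rw [mat_mul, Matrix.mul_apply, sum_eq_top_add_bot hn]
  · simp only [mat_bot_top, zero_mul, zero_add, add_zero]
  · intro l h1 h2
    rw [mat_of_lt g (show l < botIdx hn i by simp only [botIdx, Fin.lt_def]; omega), zero_mul]

theorem top₁₂_mul (hg : IsStabMat hn a b c (mat g)) :
    mat (g * h) (topIdx hn 1) (topIdx hn 2) =
      mat g (topIdx hn 1) (topIdx hn 2) + mat h (topIdx hn 1) (topIdx hn 2) := by
  rw [hg.mat_mul_top]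
  simp only [mat_bot_top, mat_diag, mat_top_of_lt hn _ (show (0 : Fin 3) < 1 by decide)]
  ring

theorem top₀₂_mul (hg : IsStabMat hn a b c (mat g)) :
    mat (g * h) (topIdx hn 0) (topIdx hn 2) =
      mat g (topIdx hn 0) (topIdx hn 2) + mat h (topIdx hn 0) (topIdx hn 2) := by
  rw [hg.mat_mul_top]
  simp only [mat_bot_top, mat_diag, hg.top]
  ring

theorem bot₀₂_mul (hg : IsStabMat hn a b c (mat g)) :
    mat (g * h) (botIdx hn 0) (botIdx hn 2) =
      mat g (botIdx hn 0) (botIdx hn 2) + mat h (botIdx hn 0) (botIdx hn 2) := by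
  rw [mat_mul_bot]
  simp only [mat_diag, hg.bot]
  ring

theorem _root_.unitri.bot₁₂_mul (hn : 6 ≤ n) (g h : unitri n F) :
    mat (g * h) (botIdx hn 1) (botIdx hn 2) =
      mat g (botIdx hn 1) (botIdx hn 2) + mat h (botIdx hn 1) (botIdx hn 2) := by
  rw [mat_mul_bot]
  simp only [mat_diag, mat_bot_of_lt hn _ (show (0 : Fin 3) < 1 by decide)]
  ring

theorem one : IsStabMat hn a b c (mat (1 : unitri n F)) where
  mid i k h1 h2 := Matrix.one_apply_ne (by
    rintro rfl
    simp only [topIdx] at h1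
    omega)
  top := Matrix.one_apply_ne ((topIdx_inj hn).not.2 (by decide))
  bot := Matrix.one_apply_ne ((botIdx_inj hn).not.2 (by decide))
  rel₀ := by
    rw [mat_one, Matrix.one_apply_ne ((topIdx_inj hn).not.2 (by decide)),
      Matrix.one_apply_ne ((botIdx_inj hn).not.2 (by decide)), mul_zero, mul_zero]
  rel₁ := by
    rw [mat_one, Matrix.one_apply_ne ((topIdx_inj hn).not.2 (by decide)),
      Matrix.one_apply_ne ((botIdx_inj hn).not.2 (by decide)), mul_zero, mul_zero]

theorem mul (hg : IsStabMat hn a b c (mat g)) (hh : IsStabMat hn a b c (mat h)) :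
    IsStabMat hn a b c (mat (g * h)) where
  mid i k h1 h2 := by
    have hb : ∀ j, mat h (botIdx hn j) k = 0 := fun j =>
      mat_of_lt h (by simp only [botIdx, Fin.lt_def]; omega)
    rw [hg.mat_mul_top]
    simp only [hh.mid _ k h1 h2, hb, mul_zero, add_zero]
  top := by
    rw [hg.mat_mul_top]
    simp only [mat_bot_top, mat_diag, hg.top, hh.top,
      mat_top_of_lt hn _ (show (1 : Fin 3) < 2 by decide)]
    ring
  bot := by
    rw [mat_mul_bot]
    simp only [mat_diag, hg.bot, hh.bot, mat_bot_of_lt hn _ (show (1 : Fin 3) < 2 by decide)]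
    ring
  rel₀ := by rw [hg.top₁₂_mul, hg.bot₀₂_mul, mul_add, mul_add, hg.rel₀, hh.rel₀]
  rel₁ := by rw [hg.top₀₂_mul, bot₁₂_mul, mul_add, mul_add, hg.rel₁, hh.rel₁]

end IsStabMat

/-- The stabilizer of the linear character `1 + E ↦ φ (a E_{2,n-2} + b E_{1,n-1} + c E_{3,n})` of
a corner subgroup. -/
def stabGroup [Finite F] (hn : 6 ≤ n) (a b c : F) : Subgroup (unitri n F) where
  carrier := {g | IsStabMat hn a b c (mat g)}
  one_mem' := IsStabMat.one
  mul_mem' := IsStabMat.mul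
  inv_mem' := by
    intro g hg
    have hpow : ∀ k : ℕ, IsStabMat hn a b c (mat (g ^ k)) := by
      intro k
      induction k with
      | zero => rw [pow_zero]; exact IsStabMat.one
      | succ k ih => rw [pow_succ]; exact ih.mul hg
    -- In a finite group inverses are powers, so closure under products suffices.
    have : g⁻¹ = g ^ (Nat.card (unitri n F) - 1) := by
      rw [inv_eq_iff_mul_eq_one, ← pow_succ', Nat.sub_add_cancel Nat.card_pos, pow_card_eq_one']
    rw [this]
    exact hpow _

theorem mem_stabGroup [Finite F] {hn : 6 ≤ n} {a b c : F} {g : unitri n F} :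
    g ∈ stabGroup hn a b c ↔ IsStabMat hn a b c (mat g) := Iff.rfl

/-- The linear form `a M_{2,n-2} + b M_{1,n-1} + c M_{3,n}`. -/
def threeForm (hn : 6 ≤ n) (a b c : F) (M : Matrix (Fin n) (Fin n) F) : F :=
  a * M (topIdx hn 1) (botIdx hn 0) + b * M (topIdx hn 0) (botIdx hn 1) +
    c * M (topIdx hn 2) (botIdx hn 2)

/-- The additive functions on the stabilizer that extend `threeForm`. -/
def stabForm (hn : 6 ≤ n) (a b c : F) (β : F × F) (g : unitri n F) : F :=
  threeForm hn a b c (mat g) -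
    c * (mat g (botIdx hn 0) (botIdx hn 2) * mat g (topIdx hn 2) (botIdx hn 0) +
      mat g (botIdx hn 1) (botIdx hn 2) * mat g (topIdx hn 2) (botIdx hn 1)) +
    (β.1 * mat g (botIdx hn 0) (botIdx hn 2) + β.2 * mat g (botIdx hn 1) (botIdx hn 2))

/-- By the two relations, the cross terms of `threeForm` on gh become symmetric in g and h, and they
are the polarization of the quadratic expression that `stabForm` subtracts. The β-terms are additive
on their own. -/
theorem stabForm_mul [Finite F] {hn : 6 ≤ n} {a b c : F} (β : F × F) :
    ∀ g ∈ stabGroup hn a b c, ∀ h ∈ stabGroup hn a b c,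
      stabForm hn a b c β (g * h) = stabForm hn a b c β g + stabForm hn a b c β h := by
  intro g hg h hh
  rw [mem_stabGroup] at hg hh
  simp only [stabForm, threeForm, hg.mat_mul_top, hg.bot₀₂_mul, bot₁₂_mul]
  simp only [mat_diag, hg.top, hh.bot,
    mat_bot_of_lt hn _ (show (0 : Fin 3) < 1 by decide),
    mat_bot_of_lt hn _ (show (0 : Fin 3) < 2 by decide),
    mat_bot_of_lt hn _ (show (1 : Fin 3) < 2 by decide),
    mat_top_of_lt hn _ (show (0 : Fin 3) < 1 by decide),
    mat_top_of_lt hn _ (show (0 : Fin 3) < 2 by decide),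
    mat_top_of_lt hn _ (show (1 : Fin 3) < 2 by decide)]
  linear_combination mat h (topIdx hn 2) (botIdx hn 0) * hg.rel₀ +
    mat h (topIdx hn 2) (botIdx hn 1) * hg.rel₁

/-- The linear characters of the stabilizer that extend a given one of the corner subgroup. -/
def stabChar [Finite F] (hn : 6 ≤ n) (φ : AddChar F ℂ) (a b c : F) (β : F × F) :
    stabGroup hn a b c →* ℂˣ :=
  linChar _ (stabForm hn a b c β) (stabForm_mul β) φ

theorem corner_le_stabGroup [Finite F] (hn : 6 ≤ n) (a b c : F) :
    corner n F (n - 3) ≤ stabGroup hn a b c := by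
  intro g hg
  rw [mem_corner] at hg
  have h0 : ∀ i j : Fin n, i ≠ j → ¬((i : ℕ) < n - 3 ∧ n - 3 ≤ j) → mat g i j = 0 := by
    intro i j hij h
    have := hg i j h
    rwa [Matrix.sub_apply, Matrix.one_apply_ne hij, sub_zero] at this
  have htt : ∀ i j, i ≠ j → mat g (topIdx hn i) (topIdx hn j) = 0 := fun i j hij =>
    h0 _ _ ((topIdx_inj hn).not.2 hij) (by simp only [topIdx]; omega)
  have hbb : ∀ i j, i ≠ j → mat g (botIdx hn i) (botIdx hn j) = 0 := fun i j hij =>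
    h0 _ _ ((botIdx_inj hn).not.2 hij) (by simp only [botIdx]; omega)
  refine ⟨fun i k h1 h2 => h0 _ _ ?_ ?_, htt _ _ (by decide), hbb _ _ (by decide), ?_, ?_⟩
  · rintro rfl
    simp only [topIdx] at h1
    omega
  · omega
  · rw [htt _ _ (by decide), hbb _ _ (by decide), mul_zero, mul_zero]
  · rw [htt _ _ (by decide), hbb _ _ (by decide), mul_zero, mul_zero]

theorem stabForm_cornerElt (hn : 6 ≤ n) (a b c : F) (β : F × F) {E : Matrix (Fin n) (Fin n) F}
    (hE : E ∈ cornerSpace n F (n - 3)) :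
    stabForm hn a b c β (cornerElt E hE) = threeForm hn a b c E := by
  have hbb : ∀ i j, i ≠ j → mat (cornerElt E hE).1 (botIdx hn i) (botIdx hn j) = 0 := by
    intro i j hij
    rw [mat_cornerElt, Matrix.add_apply, Matrix.one_apply_ne ((botIdx_inj hn).not.2 hij),
      hE _ _ (by simp only [botIdx]; omega), add_zero]
  have htb : ∀ i j, mat (cornerElt E hE).1 (topIdx hn i) (botIdx hn j) =
      E (topIdx hn i) (botIdx hn j) := by
    intro i j
    rw [mat_cornerElt, Matrix.add_apply, Matrix.one_apply_ne (topIdx_ne_botIdx hn i j), zero_add]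
  rw [stabForm, hbb 0 2 (by decide), hbb 1 2 (by decide), threeForm, threeForm]
  simp only [htb]
  ring

/-- The hypothesis says that x carries one corner character to the other. So different parameters
give non-conjugate characters, and the conjugating x lies in the stabilizer. -/
theorem eq_and_isStabMat [Finite F] (hn : 6 ≤ n) {φ : AddChar F ℂ} (hφ : φ ≠ 1) {a b c a' b' c' : F}
    (ha : a' ≠ 0) (hb : b ≠ 0) (hb' : b' ≠ 0) (hc : c' ≠ 0) (x : unitri n F)
    (h : ∀ E ∈ cornerSpace n F (n - 3),
      φ (threeForm hn a' b' c' (mat x * E)) = φ (threeForm hn a b c (E * mat x))) :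
    (a' = a ∧ b' = b ∧ c' = c) ∧ IsStabMat hn a' b' c' (mat x) := by
  -- Testing with E = t·e supported at row i of the j-th of the last three columns gives two
  -- characters t ↦ φ(ut) and t ↦ φ(u't). Primitivity of φ gives u = u'.
  have key : ∀ (i : Fin n) (j : Fin 3), (i : ℕ) < n - 3 →
      (if 0 = j then a' * mat x (topIdx hn 1) i else 0) +
      (if 1 = j then b' * mat x (topIdx hn 0) i else 0) +
      (if 2 = j then c' * mat x (topIdx hn 2) i else 0) =
      (if topIdx hn 1 = i then a * mat x (botIdx hn j) (botIdx hn 0) else 0) +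
      (if topIdx hn 0 = i then b * mat x (botIdx hn j) (botIdx hn 1) else 0) +
      (if topIdx hn 2 = i then c * mat x (botIdx hn j) (botIdx hn 2) else 0) := by
    intro i j hi
    refine AddChar.to_mulShift_inj_of_isPrimitive (AddChar.IsPrimitive.of_ne_one hφ) ?_
    ext t
    have hE : Matrix.single i (botIdx hn j) t ∈ cornerSpace n F (n - 3) := by
      intro k l hkl
      refine Matrix.single_apply_of_ne _ _ _ _ _ fun h => hkl ?_
      rw [← h.1, ← h.2]
      exact ⟨hi, by simp [botIdx]⟩
    have h1 := h _ hE
    have e1 : ∀ k l, (mat x * Matrix.single i (botIdx hn j) t) k (botIdx hn l) =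
        if l = j then mat x k i * t else 0 := by
      intro k l
      split_ifs with hl
      · rw [hl, Matrix.mul_single_apply_same]
      · rw [Matrix.mul_single_apply_of_ne _ _ _ _ _ ((botIdx_inj hn).not.2 hl)]
    have e2 : ∀ k l, (Matrix.single i (botIdx hn j) t * mat x) k l =
        if k = i then t * mat x (botIdx hn j) l else 0 := by
      intro k l
      split_ifs with hk
      · rw [hk, Matrix.single_mul_apply_same]
      · rw [Matrix.single_mul_apply_of_ne _ _ _ _ _ hk]
    simp only [threeForm, e1, e2] at h1
    rw [AddChar.mulShift_apply, AddChar.mulShift_apply]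
    convert h1 using 2
    · split_ifs <;> ring
    · split_ifs <;> ring
  have ht : ∀ i : Fin 3, ((topIdx hn i : Fin n) : ℕ) < n - 3 := fun i => by
    simp only [topIdx]; omega
  have hmid : ∀ (i : Fin 3) (k : Fin n), 3 ≤ (k : ℕ) → topIdx hn i ≠ k := by
    rintro i k hk rfl
    simp only [topIdx] at hk
    omega
  have k10 := key _ 0 (ht 1)
  have k00 := key _ 0 (ht 0)
  have k20 := key _ 0 (ht 2)
  have k01 := key _ 1 (ht 0)
  have k11 := key _ 1 (ht 1)
  have k21 := key _ 1 (ht 2)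
  have k22 := key _ 2 (ht 2)
  have b10 := mat_bot_of_lt hn x (show (0 : Fin 3) < 1 by decide)
  have t10 := mat_top_of_lt hn x (show (0 : Fin 3) < 1 by decide)
  simp [topIdx_inj, b10, t10, hb, hb'] at k10 k00 k20 k01 k11 k21 k22
  refine ⟨⟨k10, k01, k22⟩, fun i k h1 h2 => ?_, k11, k00, by rw [k20, k22], by rw [k21, k22]⟩
  have m0 := key k 0 h2
  have m1 := key k 1 h2
  have m2 := key k 2 h2
  simp [hmid _ k h1, ha, hb', hc] at m0 m1 m2
  fin_cases i
  exacts [m1, m0, m2]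

/-- There are 3(n-6) + 4 = 3n - 14 linear conditions. They are independent because a and b are
invertible: the two relations can be given any values through the entries in the upper left block
alone. -/
theorem index_stabGroup [Finite F] (hn : 6 ≤ n) {a b : F} (ha : a ≠ 0) (hb : b ≠ 0) (c : F) :
    (stabGroup (n := n) hn a b c).index = Nat.card F ^ (3 * n - 14) := by
  let mi : Fin (n - 6) → Fin n := fun k => ⟨3 + k, by omega⟩
  rw [index_eq_pow (stabGroup hn a b c) (ι := (Fin 3 × Fin (n - 6)) ⊕ Fin 4)
    { toFun := fun M => Sum.elim (fun p => M (topIdx hn p.1) (mi p.2))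
        ![M (topIdx hn 0) (topIdx hn 1), M (botIdx hn 0) (botIdx hn 1),
          a * M (topIdx hn 1) (topIdx hn 2) - c * M (botIdx hn 0) (botIdx hn 2),
          b * M (topIdx hn 0) (topIdx hn 2) - c * M (botIdx hn 1) (botIdx hn 2)]
      map_add' := fun M N => by
        ext (p | i)
        · rfl
        · fin_cases i <;> simp <;> ring
      map_smul' := fun r M => by
        ext (p | i)
        · rfl
        · fin_cases i <;> simp <;> ring }]
  · congr 1
    rw [Nat.card_sum, Nat.card_prod, Nat.card_fin, Nat.card_fin, Nat.card_fin]
    omega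
  · intro g
    have htt : ∀ i j, i ≠ j → (mat g - 1) (topIdx hn i) (topIdx hn j) =
        mat g (topIdx hn i) (topIdx hn j) := fun i j hij => by
      rw [Matrix.sub_apply, Matrix.one_apply_ne ((topIdx_inj hn).not.2 hij), sub_zero]
    have hbb : ∀ i j, i ≠ j → (mat g - 1) (botIdx hn i) (botIdx hn j) =
        mat g (botIdx hn i) (botIdx hn j) := fun i j hij => by
      rw [Matrix.sub_apply, Matrix.one_apply_ne ((botIdx_inj hn).not.2 hij), sub_zero]
    have hmid : ∀ (i : Fin 3) (k : Fin n), 3 ≤ (k : ℕ) → (mat g - 1) (topIdx hn i) k =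
        mat g (topIdx hn i) k := fun i k hk => by
      rw [Matrix.sub_apply, Matrix.one_apply_ne, sub_zero]
      rintro rfl
      simp only [topIdx] at hk
      omega
    rw [mem_stabGroup]
    constructor
    · intro h
      ext (p | i)
      · change (mat g - 1) (topIdx hn p.1) (mi p.2) = 0
        have h3 : 3 ≤ ((mi p.2 : Fin n) : ℕ) := by simp [mi]
        rw [hmid _ _ h3, h.mid _ _ h3 (by simp only [mi]; omega)]
      · fin_cases i
        · exact (htt 0 1 (by decide)).trans h.top
        · exact (hbb 0 1 (by decide)).trans h.bot
        · change a * (mat g - 1) _ _ - c * (mat g - 1) _ _ = 0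
          rw [htt 1 2 (by decide), hbb 0 2 (by decide), h.rel₀, sub_self]
        · change b * (mat g - 1) _ _ - c * (mat g - 1) _ _ = 0
          rw [htt 0 2 (by decide), hbb 1 2 (by decide), h.rel₁, sub_self]
    · intro h
      have h0 := congrFun h (Sum.inr 0)
      have h1 := congrFun h (Sum.inr 1)
      have h2 := congrFun h (Sum.inr 2)
      have h3 := congrFun h (Sum.inr 3)
      change (mat g - 1) _ _ = 0 at h0
      change (mat g - 1) _ _ = 0 at h1
      change a * (mat g - 1) _ _ - c * (mat g - 1) _ _ = 0 at h2
      change b * (mat g - 1) _ _ - c * (mat g - 1) _ _ = 0 at h3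
      rw [htt _ _ (by decide)] at h0
      rw [hbb _ _ (by decide)] at h1
      rw [htt _ _ (by decide), hbb _ _ (by decide), sub_eq_zero] at h2 h3
      refine ⟨fun i k hk hk' => ?_, h0, h1, h2, h3⟩
      have h4 := congrFun h (Sum.inl (i, ⟨k - 3, by omega⟩))
      change (mat g - 1) (topIdx hn i) (mi _) = 0 at h4
      have h5 : mi ⟨k - 3, by omega⟩ = k := by
        simp only [mi, Fin.ext_iff]
        omega
      rwa [h5, hmid i k hk] at h4
  · intro y
    let S : Matrix (Fin n) (Fin n) F := Matrix.of fun i j =>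
      if h : (i : ℕ) < 3 ∧ 3 ≤ (j : ℕ) ∧ (j : ℕ) < n - 3 then
        y (Sum.inl (⟨i, h.1⟩, ⟨j - 3, by omega⟩))
      else if i = topIdx hn 0 ∧ j = topIdx hn 1 then y (Sum.inr 0)
      else if i = botIdx hn 0 ∧ j = botIdx hn 1 then y (Sum.inr 1)
      else if i = topIdx hn 1 ∧ j = topIdx hn 2 then a⁻¹ * y (Sum.inr 2)
      else if i = topIdx hn 0 ∧ j = topIdx hn 2 then b⁻¹ * y (Sum.inr 3) else 0
    refine ⟨S, fun i j hij => ?_, ?_⟩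
    · simp only [S, Matrix.of_apply]
      simp only [topIdx, botIdx, Fin.ext_iff, Fin.le_def] at hij ⊢
      rw [dif_neg (by omega), if_neg (by simp; omega), if_neg (by simp; omega),
        if_neg (by simp; omega), if_neg (by simp; omega)]
    · have ht : ∀ i j : Fin 3, S (topIdx hn i) (topIdx hn j) =
          if i = 0 ∧ j = 1 then y (Sum.inr 0) else if i = 1 ∧ j = 2 then a⁻¹ * y (Sum.inr 2)
            else if i = 0 ∧ j = 2 then b⁻¹ * y (Sum.inr 3) else 0 := by
        intro i j
        simp only [S, Matrix.of_apply]
        rw [dif_neg (by simp only [topIdx]; omega)]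
        simp only [topIdx_inj, topIdx_ne_botIdx, false_and, if_false]
      have hbt : ∀ i j : Fin 3, S (botIdx hn i) (botIdx hn j) =
          if i = 0 ∧ j = 1 then y (Sum.inr 1) else 0 := by
        intro i j
        simp only [S, Matrix.of_apply]
        rw [dif_neg (by simp only [botIdx]; omega)]
        simp only [botIdx_inj, (topIdx_ne_botIdx hn _ _).symm, false_and, if_false]
      ext (p | i)
      · change S (topIdx hn p.1) (mi p.2) = _
        simp only [S, Matrix.of_apply]
        rw [dif_pos (by simp only [topIdx, mi]; omega)]
        congr 2
        ext <;> simp [topIdx, mi]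
      · fin_cases i
        · change S _ _ = _
          rw [ht]; simp
        · change S _ _ = _
          rw [hbt]; simp
        · change a * S _ _ - c * S _ _ = _
          rw [ht, hbt]; simp [ha]
        · change b * S _ _ - c * S _ _ = _
          rw [ht, hbt]; simp [hb]

end ThreeRoots

/-! ### The induced characters and their orthonormality. -/

section TripleChar

open unitri

variable {n : ℕ} {F : Type*} [Field F]

theorem sum_addChar_mul_prod [Fintype F] [DecidableEq F] {φ : AddChar F ℂ} (hφ : φ ≠ 1)
    (δ : F × F) :
    ∑ t : F × F, φ (δ.1 * t.1 + δ.2 * t.2) = if δ = 0 then (Nat.card F : ℂ) ^ 2 else 0 := by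
  have h1 : ∀ b : F, ∑ t : F, φ (b * t) = if b = 0 then (Nat.card F : ℂ) else 0 := by
    intro b
    have := AddChar.sum_mulShift b (AddChar.IsPrimitive.of_ne_one hφ)
    simp only [mul_comm b]
    rw [this, Nat.card_eq_fintype_card]
    push_cast
    rfl
  simp only [AddChar.map_add_eq_mul]
  rw [Fintype.sum_prod_type]
  change ∑ x, ∑ y, φ (δ.1 * x) * φ (δ.2 * y) = _
  rw [← Finset.sum_mul_sum, h1, h1, sq, ite_zero_mul_ite_zero]
  exact if_congr (Prod.ext_iff (x := δ) (y := 0)).symm rfl rfl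

theorem card_inv_mul_sum_addChar_mul [Fintype F] [DecidableEq F] {φ : AddChar F ℂ} (hφ : φ ≠ 1)
    (δ : F × F) {Q : Type*} [Fintype Q] (f : Q → ℂ) :
    (Nat.card (Multiplicative (F × F) × Q) : ℂ)⁻¹ *
      ∑ y : Multiplicative (F × F) × Q, φ (δ.1 * y.1.toAdd.1 + δ.2 * y.1.toAdd.2) * f y.2 =
      if δ = 0 then (Nat.card Q : ℂ)⁻¹ * ∑ y, f y else 0 := by
  have h1 : Nat.card (Multiplicative (F × F)) = Nat.card F ^ 2 := by
    rw [Nat.card_congr Multiplicative.toAdd, Nat.card_prod, sq]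
  have h2 := (Multiplicative.toAdd (α := F × F)).sum_comp fun t => φ (δ.1 * t.1 + δ.2 * t.2)
  rw [sum_addChar_mul_prod hφ] at h2
  have h3 : (Nat.card F : ℂ) ^ 2 ≠ 0 := by simp
  rw [Fintype.sum_prod_type]
  dsimp only
  simp only [← Finset.mul_sum, ← Finset.sum_mul, h2]
  rw [Nat.card_prod, h1, Nat.cast_mul, Nat.cast_pow]
  split_ifs
  · rw [mul_inv_rev, mul_assoc, inv_mul_cancel_left₀ h3]
  · rw [zero_mul, mul_zero]

variable [Finite F]

/-- The character induced from a linear character of the stabilizer `stabGroup hn a b c`. -/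
noncomputable def tripleChar (hn : 6 ≤ n) (φ : AddChar F ℂ) (p : Fˣ × Fˣ × Fˣ) (β : F × F) :
    unitri n F → ℂ :=
  indChar (stabGroup hn (p.1 : F) p.2.1 p.2.2) (stabChar hn φ p.1 p.2.1 p.2.2 β)

theorem tripleChar_one (hn : 6 ≤ n) (φ : AddChar F ℂ) (p : Fˣ × Fˣ × Fˣ) (β : F × F) :
    tripleChar hn φ p β 1 = (Nat.card F : ℂ) ^ (3 * n - 14) := by
  rw [tripleChar, indChar_one, index_stabGroup hn p.1.ne_zero p.2.1.ne_zero]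
  push_cast
  rfl

/-- This is the vanishing hypothesis of the Mackey lemmas. The witness is a corner element 1 + xE,
on which the values do not depend on β and which the inflated characters do not see. -/
theorem exists_zeroExt_stabChar_ne (hn : 6 ≤ n) {φ : AddChar F ℂ} (hφ : φ ≠ 1) {a b c a' b' c' : F}
    (ha : a' ≠ 0) (hb : b ≠ 0) (hb' : b' ≠ 0) (hc : c' ≠ 0) (β β' : F × F)
    {m : ℕ} (hm : 3 + m ≤ n - 3) (hmn : 3 + m ≤ n) (θ θ' : unitri m F → ℂ) (x : unitri n F)
    (h : ¬((a' = a ∧ b' = b ∧ c' = c) ∧ IsStabMat hn a' b' c' (mat x))) :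
    ∃ y, x⁻¹ * y * x ∈ stabGroup hn a b c ∧ y ∈ stabGroup hn a' b' c' ∧
      (∀ g, inflate 3 m n hmn F θ (x⁻¹ * y * x * g) = inflate 3 m n hmn F θ g) ∧
      (∀ g, inflate 3 m n hmn F θ' (y * g) = inflate 3 m n hmn F θ' g) ∧
      zeroExt _ (stabChar hn φ a b c β) (x⁻¹ * y * x) ≠
        zeroExt _ (stabChar hn φ a' b' c' β') y := by
  have h1 := mt (eq_and_isStabMat hn hφ ha hb hb' hc x) h
  push Not at h1
  obtain ⟨E, hE, hne⟩ := h1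
  have hl := mul_mem_cornerSpace (X := mat x) (fun _ _ h => mat_of_lt x h) hE
  have hr := mul_mem_cornerSpace' (X := mat x) (fun _ _ h => mat_of_lt x h) hE
  have hr' := corner_le_stabGroup hn a b c (cornerElt _ hr).2
  have hl' := corner_le_stabGroup hn a' b' c' (cornerElt _ hl).2
  refine ⟨cornerElt _ hl, ?_, hl', ?_, inflate_mul_of_mem_corner hmn hm θ' (cornerElt _ hl).2, ?_⟩
  all_goals rw [conj_cornerElt x hl hr]
  · exact hr'
  · exact inflate_mul_of_mem_corner hmn hm θ (cornerElt _ hr).2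
  · rw [stabChar, stabChar, zeroExt_linChar _ _ _ _ hr', zeroExt_linChar _ _ _ _ hl',
      stabForm_cornerElt, stabForm_cornerElt]
    exact hne.symm

/-- The projection of the stabilizer onto the middle diagonal block and the entries
`(n - 2, n)` and `(n - 1, n)`. -/
def stabProj (hn : 6 ≤ n) (a b c : F) :
    stabGroup (n := n) hn a b c →* Multiplicative (F × F) × unitri (n - 6) F :=
  MonoidHom.prod
    { toFun := fun g => Multiplicative.ofAdd
        (mat g.1 (botIdx hn 0) (botIdx hn 2), mat g.1 (botIdx hn 1) (botIdx hn 2))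
      map_one' := by
        rw [Subgroup.coe_one, mat_one, Matrix.one_apply_ne ((botIdx_inj hn).not.2 (by decide)),
          Matrix.one_apply_ne ((botIdx_inj hn).not.2 (by decide))]
        rfl
      map_mul' := fun g h => by
        rw [Subgroup.coe_mul, IsStabMat.bot₀₂_mul (mem_stabGroup.1 g.2), bot₁₂_mul]
        rfl }
    ((blockHom 3 (n - 6) n (by omega) F).comp (stabGroup hn a b c).subtype)

theorem stabProj_surjective (hn : 6 ≤ n) {a b : F} (ha : a ≠ 0) (hb : b ≠ 0) (c : F) :
    Function.Surjective (stabProj (n := n) hn a b c) := by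
  rintro ⟨t, u⟩
  obtain ⟨⟨t₀, t₁⟩, rfl⟩ := Multiplicative.ofAdd.surjective t
  -- The two prescribed entries in the last column force, through the two relations, two entries of
  -- the upper left block.
  let S : Matrix (Fin n) (Fin n) F :=
    Matrix.single (botIdx hn 0) (botIdx hn 2) t₀ + Matrix.single (botIdx hn 1) (botIdx hn 2) t₁ +
      Matrix.single (topIdx hn 1) (topIdx hn 2) (a⁻¹ * (c * t₀)) +
      Matrix.single (topIdx hn 0) (topIdx hn 2) (b⁻¹ * (c * t₁))
  have hS : ∀ i j : Fin n, (i < j → ¬((i : ℕ) < 3 ∧ (j : ℕ) < 3 ∨ n - 3 ≤ i)) → S i j = 0 := by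
    intro i j h
    have h' : ∀ k l : Fin 3, k < l → ¬(topIdx hn k = i ∧ topIdx hn l = j) ∧
        ¬(botIdx hn k = i ∧ botIdx hn l = j) := by
      refine fun k l hkl => ⟨?_, ?_⟩
      · rintro ⟨rfl, rfl⟩
        exact h ((topIdx_lt_topIdx hn).2 hkl) (by simp only [topIdx]; omega)
      · rintro ⟨rfl, rfl⟩
        exact h ((botIdx_lt_botIdx hn).2 hkl) (by simp only [botIdx]; omega)
    simp only [S, Matrix.add_apply]
    rw [Matrix.single_apply_of_ne _ _ _ _ _ (h' 0 2 (by decide)).2,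
      Matrix.single_apply_of_ne _ _ _ _ _ (h' 1 2 (by decide)).2,
      Matrix.single_apply_of_ne _ _ _ _ _ (h' 1 2 (by decide)).1,
      Matrix.single_apply_of_ne _ _ _ _ _ (h' 0 2 (by decide)).1]
    simp
  have hSt : ∀ i j : Fin 3, S (topIdx hn i) (topIdx hn j) =
      (if 1 = i ∧ 2 = j then a⁻¹ * (c * t₀) else 0) +
        if 0 = i ∧ 2 = j then b⁻¹ * (c * t₁) else 0 := by
    intro i j
    simp only [S, Matrix.add_apply, Matrix.single_apply, topIdx_inj,
      (topIdx_ne_botIdx hn _ _).symm, false_and, if_false, zero_add]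
  have hSb : ∀ i j : Fin 3, S (botIdx hn i) (botIdx hn j) =
      (if 0 = i ∧ 2 = j then t₀ else 0) + if 1 = i ∧ 2 = j then t₁ else 0 := by
    intro i j
    simp only [S, Matrix.add_apply, Matrix.single_apply, botIdx_inj,
      topIdx_ne_botIdx hn _ _, false_and, if_false, add_zero]
  let B : unitri n F := blockEmb 3 (n - 6) n u
  let g : unitri n F := ofMat (mat B + S)
    (fun i j h => by rw [Matrix.add_apply, mat_of_lt B h, hS i j (fun h' => absurd h' h.not_gt),
      add_zero])
    (fun i => by rw [Matrix.add_apply, mat_diag, hS i i (fun h' => absurd h' (lt_irrefl i)),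
      add_zero])
  have hg : ∀ i j, mat g i j = mat B i j + S i j := fun i j => rfl
  have hBt : ∀ i j, mat B (topIdx hn i) j = (1 : Matrix (Fin n) (Fin n) F) (topIdx hn i) j :=
    fun i j => mat_blockEmb_of_not u (by simp only [topIdx]; omega)
  have hBb : ∀ i j, mat B (botIdx hn i) j = (1 : Matrix (Fin n) (Fin n) F) (botIdx hn i) j :=
    fun i j => mat_blockEmb_of_not u (by simp only [botIdx]; omega)
  have hgt : ∀ i j, i ≠ j → mat g (topIdx hn i) (topIdx hn j) = S (topIdx hn i) (topIdx hn j) :=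
    fun i j hij => by
      rw [hg, hBt, Matrix.one_apply_ne ((topIdx_inj hn).not.2 hij), zero_add]
  have hgb : ∀ i j, i ≠ j → mat g (botIdx hn i) (botIdx hn j) = S (botIdx hn i) (botIdx hn j) :=
    fun i j hij => by
      rw [hg, hBb, Matrix.one_apply_ne ((botIdx_inj hn).not.2 hij), zero_add]
  have hmem : IsStabMat hn a b c (mat g) := by
    refine ⟨fun i k h1 h2 => ?_, ?_, ?_, ?_, ?_⟩
    · rw [hg, hBt, Matrix.one_apply_ne, hS, zero_add]
      · simp only [topIdx]; omega
      · rintro rfl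
        simp only [topIdx] at h1
        omega
    · rw [hgt _ _ (by decide), hSt]; simp
    · rw [hgb _ _ (by decide), hSb]; simp
    · rw [hgt _ _ (by decide), hgb _ _ (by decide), hSt, hSb]; simp [ha]
    · rw [hgt _ _ (by decide), hgb _ _ (by decide), hSt, hSb]; simp [hb]
  refine ⟨⟨g, hmem⟩, Prod.ext ?_ ?_⟩
  · change Multiplicative.ofAdd (mat g _ _, mat g _ _) = _
    rw [hgb _ _ (by decide), hgb _ _ (by decide), hSb, hSb]
    simp
  · refine Eq.trans ?_ (blockHom_blockEmb (show 3 + (n - 6) ≤ n by omega) u)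
    apply mat_injective
    ext i j
    change mat (blockHom 3 (n - 6) n (by omega) F g) i j = _
    rw [mat_blockHom_apply, mat_blockHom_apply, hg, hS, add_zero]
    exact fun _ => by simp only; omega

/-- Two extensions of the same corner character differ by a linear character that factors through
`stabProj`. This brings the inner product down to F² × U_{n-6}(q). -/
theorem stabChar_mul_conj (hn : 6 ≤ n) (φ : AddChar F ℂ) (a b c : F) (β β' : F × F)
    (v : stabGroup (n := n) hn a b c) :
    (stabChar hn φ a b c β v : ℂ) * conj (stabChar hn φ a b c β' v : ℂ) =
      φ ((β - β').1 * mat v.1 (botIdx hn 0) (botIdx hn 2) +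
        (β - β').2 * mat v.1 (botIdx hn 1) (botIdx hn 2)) := by
  rw [stabChar, stabChar, linChar_apply, linChar_apply, ← AddChar.map_neg_eq_conj,
    ← AddChar.map_add_eq_mul]
  congr 1
  rw [stabForm, stabForm, Prod.fst_sub, Prod.snd_sub]
  ring

open Classical in
theorem charInner_tripleChar_mul (hn : 6 ≤ n) {φ : AddChar F ℂ} (hφ : φ ≠ 1)
    (p p' : Fˣ × Fˣ × Fˣ) (β β' : F × F) {θ θ' : unitri (n - 6) F → ℂ}
    (hθ : θ ∈ irr (unitri (n - 6) F)) (hθ' : θ' ∈ irr (unitri (n - 6) F)) :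
    charInner (tripleChar hn φ p β * inflate 3 (n - 6) n (by omega) F θ)
      (tripleChar hn φ p' β' * inflate 3 (n - 6) n (by omega) F θ') =
      if p = p' ∧ β = β' ∧ θ = θ' then 1 else 0 := by
  have := Fintype.ofFinite F
  have := Fintype.ofFinite (unitri (n - 6) F)
  have hcl : ∀ {θ : unitri (n - 6) F → ℂ}, θ ∈ irr (unitri (n - 6) F) → ∀ x g,
      inflate 3 (n - 6) n (by omega) F θ (x⁻¹ * g * x) = inflate 3 (n - 6) n (by omega) F θ g :=
    fun hθ => (isRepChar_inflate _ (isRepChar_of_mem_irr hθ)).conj_eq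
  have hm : 3 + (n - 6) ≤ n - 3 := by omega
  by_cases hp : p = p'
  · subst hp
    rw [tripleChar, tripleChar, charInner_indChar_mul _ _ (hcl hθ) (hcl hθ') (fun x hx =>
      exists_zeroExt_stabChar_ne hn hφ p.1.ne_zero p.2.1.ne_zero p.2.1.ne_zero p.2.2.ne_zero
        β β' hm _ θ θ' x fun h => hx h.2) (stabProj hn (p.1 : F) p.2.1 p.2.2)
      (stabProj_surjective hn p.1.ne_zero p.2.1.ne_zero _)
      (fun y => φ ((β - β').1 * y.1.toAdd.1 + (β - β').2 * y.1.toAdd.2) * (θ y.2 * conj (θ' y.2)))]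
    · rw [card_inv_mul_sum_addChar_mul hφ (β - β') fun y => θ y * conj (θ' y), ← charInner_eq_sum,
        charInner_irr hθ hθ']
      simp only [sub_eq_zero, true_and, ite_and]
      congr
    · intro v
      rw [map_mul, mul_mul_mul_comm, stabChar_mul_conj]
      rfl
  · rw [if_neg fun h => hp h.1]
    exact charInner_indChar_mul_eq_zero _ _ (hcl hθ) (hcl hθ') fun x =>
      exists_zeroExt_stabChar_ne hn hφ p'.1.ne_zero p.2.1.ne_zero p'.2.1.ne_zero p'.2.2.ne_zero
        β β' hm _ θ θ' x fun h => hp (Prod.ext (Units.ext h.1.1.symm)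
          (Prod.ext (Units.ext h.1.2.1.symm) (Units.ext h.1.2.2.symm)))

end TripleChar

/-! ### Products of elementary characters and the main theorem. -/

section TripleProduct

open unitri

variable {n : ℕ} {F : Type*} [Field F]

/-- Three steps of `muExp_add_two` contribute (n-2) + (n-4) + (n-6) = 3n - 12. -/
theorem muExp_eq_add (hn : 6 ≤ n) : muExp n = 3 * n - 14 + muExp (n - 6) + 2 := by
  obtain ⟨m, rfl⟩ := Nat.exists_eq_add_of_le' hn
  have h1 : muExp (m + 6) = _ := muExp_add_two (m + 4)
  have h2 : muExp (m + 4) = _ := muExp_add_two (m + 2)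
  have h3 := muExp_add_two m
  rw [Nat.add_sub_cancel]
  omega

theorem mul_inflate_one (χ : unitri n F → ℂ) {k m : ℕ} (h : k + m ≤ n) :
    χ * inflate k m n h F (fun _ => 1) = χ := by
  ext g
  rw [Pi.mul_apply]
  exact mul_one _

variable [Finite F]

theorem isRepChar_tripleChar (hn : 6 ≤ n) (φ : AddChar F ℂ) (p : Fˣ × Fˣ × Fˣ) (β : F × F) :
    IsRepChar (tripleChar hn φ p β) := isRepChar_indChar _ _

theorem tripleChar_mul_inflate_mem_irr (hn : 6 ≤ n) {φ : AddChar F ℂ} (hφ : φ ≠ 1)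
    (p : Fˣ × Fˣ × Fˣ) (β : F × F) {θ : unitri (n - 6) F → ℂ} (hθ : θ ∈ irr (unitri (n - 6) F)) :
    tripleChar hn φ p β * inflate 3 (n - 6) n (by omega) F θ ∈ irr (unitri n F) := by
  refine IsRepChar.mem_irr_of_charInner_self
    ((isRepChar_tripleChar hn φ p β).mul (isRepChar_inflate _ (isRepChar_of_mem_irr hθ))) ?_
  rw [charInner_tripleChar_mul hn hφ p p β β hθ hθ, if_pos ⟨rfl, rfl, rfl⟩]

theorem tripleChar_mul_inflate_injective (hn : 6 ≤ n) {φ : AddChar F ℂ} (hφ : φ ≠ 1)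
    {p p' : Fˣ × Fˣ × Fˣ} {β β' : F × F} {θ θ' : unitri (n - 6) F → ℂ}
    (hθ : θ ∈ irr (unitri (n - 6) F)) (hθ' : θ' ∈ irr (unitri (n - 6) F))
    (h : tripleChar hn φ p β * inflate 3 (n - 6) n (by omega) F θ =
      tripleChar hn φ p' β' * inflate 3 (n - 6) n (by omega) F θ') :
    p = p' ∧ β = β' ∧ θ = θ' := by
  have h1 := charInner_tripleChar_mul hn hφ p p' β β' hθ hθ'
  rw [← h, charInner_tripleChar_mul hn hφ p p β β hθ hθ, if_pos ⟨rfl, rfl, rfl⟩] at h1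
  by_contra hne
  rw [if_neg hne] at h1
  exact one_ne_zero h1

theorem tripleChar_mem_irr (hn : 6 ≤ n) {φ : AddChar F ℂ} (hφ : φ ≠ 1)
    (p : Fˣ × Fˣ × Fˣ) (β : F × F) : tripleChar hn φ p β ∈ irr (unitri n F) := by
  have := tripleChar_mul_inflate_mem_irr hn hφ p β (one_mem_irr _)
  rwa [mul_inflate_one] at this

theorem tripleChar_injective (hn : 6 ≤ n) {φ : AddChar F ℂ} (hφ : φ ≠ 1) (p : Fˣ × Fˣ × Fˣ) :
    Function.Injective (tripleChar hn φ p) := fun β β' h =>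
  (tripleChar_mul_inflate_injective hn hφ (one_mem_irr _) (one_mem_irr _)
    (by rw [mul_inflate_one, mul_inflate_one, h])).2.1

/-- F has as many additive characters as elements, so every one is t ↦ φ(at) for some a. Thus one φ
parametrizes all elementary characters by units. -/
theorem PosRoot.isElementary_iff_mulShift (α : PosRoot n) {φ : AddChar F ℂ} (hφ : φ ≠ 1)
    {ξ : unitri n F → ℂ} : α.IsElementary ξ ↔
      ∃ a : Fˣ, ξ = indChar (α.baseGroup F) (α.elemChar (φ.mulShift a)) := by
  have := Fintype.ofFinite F
  have hinj := AddChar.to_mulShift_inj_of_isPrimitive (AddChar.IsPrimitive.of_ne_one hφ)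
  have hbij := (Fintype.bijective_iff_injective_and_card _).2 ⟨hinj, AddChar.card_eq.symm⟩
  rw [PosRoot.isElementary_iff]
  constructor
  · rintro ⟨ψ, hψ, rfl⟩
    obtain ⟨a, rfl⟩ := hbij.2 ψ
    refine ⟨Units.mk0 a ?_, rfl⟩
    rintro rfl
    exact hψ (AddChar.mulShift_zero φ)
  · rintro ⟨a, rfl⟩
    exact ⟨_, AddChar.IsPrimitive.of_ne_one hφ a.ne_zero, rfl⟩

/-- Products of elementary characters at the roots at the entries `(2, n - 2)`, `(1, n - 1)`
and `(3, n)`. -/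
theorem indChar_mul_mul_eq_sum [Fintype F] (hn : 6 ≤ n) {φ : AddChar F ℂ} (hφ : φ ≠ 1)
    {α₁ α₂ α₃ : PosRoot n} (h₁ : α₁.i = 2 ∧ α₁.j = n - 3) (h₂ : α₂.i = 1 ∧ α₂.j = n - 2)
    (h₃ : α₃.i = 3 ∧ α₃.j = n - 1) (p : Fˣ × Fˣ × Fˣ) [DecidableEq (unitri n F → ℂ)] :
    indChar (α₁.baseGroup F) (α₁.elemChar (φ.mulShift p.1)) *
      indChar (α₂.baseGroup F) (α₂.elemChar (φ.mulShift p.2.1)) *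
      indChar (α₃.baseGroup F) (α₃.elemChar (φ.mulShift p.2.2)) =
      ∑ χ ∈ Finset.univ.image (tripleChar hn φ p), χ := by
  have hr₁ : α₁.row = topIdx hn 1 := Fin.ext (by simp [PosRoot.row, topIdx, h₁])
  have hr₂ : α₂.row = topIdx hn 0 := Fin.ext (by simp [PosRoot.row, topIdx, h₂])
  have hr₃ : α₃.row = topIdx hn 2 := Fin.ext (by simp [PosRoot.row, topIdx, h₃])
  have hc₁ : α₁.col = botIdx hn 0 := Fin.ext (by simp [PosRoot.col, botIdx, h₁])
  have hc₂ : α₂.col = botIdx hn 1 := Fin.ext (by simp [PosRoot.col, botIdx, h₂]; omega)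
  have hc₃ : α₃.col = botIdx hn 2 := Fin.ext (by simp [PosRoot.col, botIdx, h₃]; omega)
  refine (((isRepChar_indChar _ _).mul (isRepChar_indChar _ _)).mul
    (isRepChar_indChar _ _)).eq_sum_of_constituents _ ?_ ?_ ?_
  · simp only [Finset.mem_image, Finset.mem_univ, true_and]
    rintro _ ⟨β, rfl⟩
    exact tripleChar_mem_irr hn hφ p β
  · simp only [Finset.mem_image, Finset.mem_univ, true_and]
    rintro _ ⟨β, rfl⟩
    refine charInner_indChar_mul_mul_ne_zero _ _ _ _ fun g hg₁ hg₂ _ hg => Units.ext ?_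
    have e₁ := (α₁.mem_baseGroup.1 hg₁) (topIdx hn 2) (by rw [hr₁, topIdx_lt_topIdx]; decide)
      (by rw [hc₁]; exact topIdx_lt_botIdx hn _ _)
    have e₂ := (α₂.mem_baseGroup.1 hg₂) (topIdx hn 2) (by rw [hr₂, topIdx_lt_topIdx]; decide)
      (by rw [hc₂]; exact topIdx_lt_botIdx hn _ _)
    rw [hr₁] at e₁
    rw [hr₂] at e₂
    have u₀ := hg.rel₀
    have u₁ := hg.rel₁
    -- The base groups of α₁ and α₂ kill the upper left entries in the relations, hence also the
    -- matching entries of the last column. The correction and β terms of `stabForm` then vanish,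
    -- leaving `threeForm`.
    rw [e₁, mul_zero, eq_comm, mul_eq_zero, or_iff_right p.2.2.ne_zero] at u₀
    rw [e₂, mul_zero, eq_comm, mul_eq_zero, or_iff_right p.2.2.ne_zero] at u₁
    rw [Units.val_mul, Units.val_mul, PosRoot.elemChar, PosRoot.elemChar, PosRoot.elemChar,
      stabChar, linChar_apply, linChar_apply, linChar_apply, linChar_apply,
      AddChar.mulShift_apply, AddChar.mulShift_apply, AddChar.mulShift_apply,
      ← AddChar.map_add_eq_mul, ← AddChar.map_add_eq_mul, stabForm, u₀, u₁, threeForm,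
      hr₁, hr₂, hr₃, hc₁, hc₂, hc₃]
    congr 1
    ring
  -- Comparison of degrees: (n-5) + (n-3) + (n-4) = 2 + (3n-14).
  · rw [Finset.sum_image (tripleChar_injective hn hφ p).injOn]
    simp only [tripleChar_one, Pi.mul_apply, indChar_one, PosRoot.index_baseGroup, h₁, h₂, h₃,
      Finset.sum_const, Finset.card_univ, nsmul_eq_mul]
    rw [← Nat.card_eq_fintype_card, Nat.card_prod]
    push_cast
    rw [← pow_add, ← pow_add, ← sq, ← pow_add]
    congr 1
    omega

/-- The irreducible constituents of a product of elementary characters at the roots at the entries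
`(2, n - 2)`, `(1, n - 1)` and `(3, n)`. -/
theorem constituents_indChar_mul_mul (hn : 6 ≤ n) {φ : AddChar F ℂ} (hφ : φ ≠ 1)
    {α₁ α₂ α₃ : PosRoot n} (h₁ : α₁.i = 2 ∧ α₁.j = n - 3) (h₂ : α₂.i = 1 ∧ α₂.j = n - 2)
    (h₃ : α₃.i = 3 ∧ α₃.j = n - 1) (p : Fˣ × Fˣ × Fˣ) :
    constituents (indChar (α₁.baseGroup F) (α₁.elemChar (φ.mulShift p.1)) *
      indChar (α₂.baseGroup F) (α₂.elemChar (φ.mulShift p.2.1)) *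
      indChar (α₃.baseGroup F) (α₃.elemChar (φ.mulShift p.2.2))) =
      Set.range (tripleChar hn φ p) := by
  classical
  have := Fintype.ofFinite F
  rw [indChar_mul_mul_eq_sum hn hφ h₁ h₂ h₃ p]
  have hT : ∀ χ ∈ Finset.univ.image (tripleChar hn φ p), χ ∈ irr (unitri n F) := by
    simp only [Finset.mem_image, Finset.mem_univ, true_and]
    rintro _ ⟨β, rfl⟩
    exact tripleChar_mem_irr hn hφ p β
  ext χ
  constructor
  · rintro ⟨hχ, hne⟩
    rw [charInner_finset_sum_left _ hT hχ, ne_eq, ite_eq_right_iff] at hne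
    push Not at hne
    simpa using hne.1
  · rintro ⟨β, rfl⟩
    refine ⟨tripleChar_mem_irr hn hφ p β, ?_⟩
    rw [charInner_finset_sum_left _ hT (tripleChar_mem_irr hn hφ p β), if_pos (by simp)]
    exact one_ne_zero

end TripleProduct

theorem mainTheorem8 (F : Type*) [Field F] [Finite F] (q : ℕ) (hq : Nat.card F = q)
    (n : ℕ) (hn : 6 ≤ n) (α₁ α₂ α₃ : PosRoot n)
    (h₁ : α₁.i = 2 ∧ α₁.j = n - 3) (h₂ : α₂.i = 1 ∧ α₂.j = n - 2)
    (h₃ : α₃.i = 3 ∧ α₃.j = n - 1) :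
    (∀ ξ₁ ξ₂ ξ₃ : unitri n F → ℂ,
      α₁.IsElementary ξ₁ → α₂.IsElementary ξ₂ → α₃.IsElementary ξ₃ →
        (constituents (ξ₁ * ξ₂ * ξ₃)).ncard = q ^ 2 ∧
        ξ₁ * ξ₂ * ξ₃ = ∑ᶠ χ ∈ constituents (ξ₁ * ξ₂ * ξ₃), χ ∧
        ∀ χ ∈ constituents (ξ₁ * ξ₂ * ξ₃),
          charInner (ξ₁ * ξ₂ * ξ₃) χ = 1 ∧
          χ 1 = (q : ℂ) ^ (3 * n - 14) ∧
          ∀ θ : unitri (n - 6) F → ℂ, IsKthHighestDegree 1 θ →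
            IsKthHighestDegree 3 (χ * inflate 3 (n - 6) n (by omega) F θ) ∧
            (χ * inflate 3 (n - 6) n (by omega) F θ) 1 = (q : ℂ) ^ (muExp n - 2)) ∧
    {ψ : unitri n F → ℂ | ∃ ξ₁ ξ₂ ξ₃ : unitri n F → ℂ,
        α₁.IsElementary ξ₁ ∧ α₂.IsElementary ξ₂ ∧ α₃.IsElementary ξ₃ ∧
        ∃ χ ∈ constituents (ξ₁ * ξ₂ * ξ₃), ∃ θ : unitri (n - 6) F → ℂ,
          IsKthHighestDegree 1 θ ∧ ψ = χ * inflate 3 (n - 6) n (by omega) F θ}.ncard =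
      q ^ 2 * (q - 1) ^ 3 * numIrr (n - 6) (muExp (n - 6)) F := by
  classical
  subst hq
  have := Fintype.ofFinite F
  obtain ⟨φ, hφ⟩ := exists_addChar_ne_one (F := F)
  have hmu := muExp_eq_add hn
  constructor
  · intro ξ₁ ξ₂ ξ₃ hξ₁ hξ₂ hξ₃
    obtain ⟨a, rfl⟩ := (α₁.isElementary_iff_mulShift hφ).1 hξ₁
    obtain ⟨b, rfl⟩ := (α₂.isElementary_iff_mulShift hφ).1 hξ₂
    obtain ⟨c, rfl⟩ := (α₃.isElementary_iff_mulShift hφ).1 hξ₃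
    have hcon := constituents_indChar_mul_mul hn hφ h₁ h₂ h₃ (a, b, c)
    have hsum := indChar_mul_mul_eq_sum hn hφ h₁ h₂ h₃ (a, b, c)
    dsimp only at hcon hsum
    rw [hcon]
    refine ⟨?_, ?_, ?_⟩
    · rw [← Set.image_univ, Set.ncard_image_of_injective _ (tripleChar_injective hn hφ _),
        Set.ncard_univ, Nat.card_prod, sq]
    · rw [hsum, ← finsum_mem_coe_finset, Finset.coe_image, Finset.coe_univ, Set.image_univ]
    · rintro _ ⟨β, rfl⟩
      have hone := tripleChar_one hn φ (a, b, c) β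
      refine ⟨?_, hone, fun θ hθ => ?_⟩
      · rw [hsum, charInner_finset_sum_left _ _ (tripleChar_mem_irr hn hφ _ β), if_pos (by simp)]
        simp only [Finset.mem_image, Finset.mem_univ, true_and]
        rintro _ ⟨β', rfl⟩
        exact tripleChar_mem_irr hn hφ _ β'
      · rw [isKthHighestDegree_one_iff] at hθ
        have hdeg : (tripleChar hn φ (a, b, c) β * inflate 3 (n - 6) n (by omega) F θ) 1 =
            (Nat.card F : ℂ) ^ (muExp n - 2) := by
          have h1 : inflate 3 (n - 6) n (by omega) F θ 1 = θ 1 := congrArg θ (map_one _)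
          rw [Pi.mul_apply, hone, h1, hθ.2, ← pow_add, hmu, Nat.add_sub_cancel]
        exact ⟨isKthHighestDegree_three (by omega)
          (tripleChar_mul_inflate_mem_irr hn hφ _ β hθ.1) hdeg, hdeg⟩
  · let Θ : Set (unitri (n - 6) F → ℂ) := {θ | θ ∈ irr (unitri (n - 6) F) ∧
      θ 1 = (Nat.card F : ℂ) ^ muExp (n - 6)}
    let f : (Fˣ × Fˣ × Fˣ) × (F × F) × (unitri (n - 6) F → ℂ) → unitri n F → ℂ := fun x =>
      tripleChar hn φ x.1 x.2.1 * inflate 3 (n - 6) n (by omega) F x.2.2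
    -- The characters are the injective image of the parameters (a, b, c), β and θ, so counting them
    -- is counting a product set.
    have himage : ∀ S : Set (unitri n F → ℂ), S =
        f '' ((Set.univ : Set (Fˣ × Fˣ × Fˣ)) ×ˢ ((Set.univ : Set (F × F)) ×ˢ Θ)) →
        S.ncard = Nat.card F ^ 2 * (Nat.card F - 1) ^ 3 * numIrr (n - 6) (muExp (n - 6)) F := by
      rintro _ rfl
      rw [Set.InjOn.ncard_image, Set.ncard_prod, Set.ncard_prod, Set.ncard_univ, Set.ncard_univ,
        Nat.card_prod, Nat.card_prod, Nat.card_prod, Nat.card_units]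
      · rw [numIrr]
        ring
      · rintro ⟨p, β, θ⟩ ⟨-, -, hθ⟩ ⟨p', β', θ'⟩ ⟨-, -, hθ'⟩ h
        obtain ⟨rfl, rfl, rfl⟩ := tripleChar_mul_inflate_injective hn hφ hθ.1 hθ'.1 h
        rfl
    refine himage _ ?_
    ext ψ
    constructor
    · rintro ⟨ξ₁, ξ₂, ξ₃, hξ₁, hξ₂, hξ₃, χ, hχ, θ, hθ, rfl⟩
      obtain ⟨a, rfl⟩ := (α₁.isElementary_iff_mulShift hφ).1 hξ₁
      obtain ⟨b, rfl⟩ := (α₂.isElementary_iff_mulShift hφ).1 hξ₂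
      obtain ⟨c, rfl⟩ := (α₃.isElementary_iff_mulShift hφ).1 hξ₃
      rw [constituents_indChar_mul_mul hn hφ h₁ h₂ h₃ (a, b, c)] at hχ
      obtain ⟨β, rfl⟩ := hχ
      exact ⟨((a, b, c), β, θ), ⟨trivial, trivial, isKthHighestDegree_one_iff.1 hθ⟩, rfl⟩
    · rintro ⟨⟨p, β, θ⟩, ⟨-, -, hθ⟩, rfl⟩
      refine ⟨_, _, _, (α₁.isElementary_iff_mulShift hφ).2 ⟨p.1, rfl⟩,
        (α₂.isElementary_iff_mulShift hφ).2 ⟨p.2.1, rfl⟩,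
        (α₃.isElementary_iff_mulShift hφ).2 ⟨p.2.2, rfl⟩, tripleChar hn φ p β, ?_, θ,
        isKthHighestDegree_one_iff.2 hθ, rfl⟩
      rw [constituents_indChar_mul_mul hn hφ h₁ h₂ h₃ p]
      exact ⟨β, rfl⟩
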